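/- **Systems.** Consider on a connected open set $U\subset\mathbb C^3$ holomorphic functions $A^{ij},B^{ij},C^{ij}$ ($ij=22,33,12,13,23$) and the canonical equations $$V_{jj}=V_{11}+A^{jj}V_1+B^{jj}V_2+C^{jj}V_3\ (j=2,3),\qquad V_{ij}=A^{ij}V_1+B^{ij}V_2+C^{ij}V_3\ (ij=12,13,23).$$ They define a *nondegenerate superintegrable system* on $U$ if (i) at every $x_0\in U$ the values of $V,V_1,V_2,V_3,V_{11}$ can be prescribed arbitrarily and there is exactly one germ of a solution $V$ with these values; (ii) there are five symmetric matrices $a_{(h)}$ of holomorphic functions on $U$, one of them the identity, linearly independent at each point, such that for every local solution $V$ there locally exist $W_{(h)}$ with $\sum a_{(h)}^{jk}p_jp_k+W_{(h)}$ a constant of the motion of $H=p_1^2+p_2^2+p_3^2+V$, and such that near every point these five constants of the motion are functionally independent for a suitable solution $V$. Two systems are *the same* if they are connected by a finite chain of analytic continuations (coincidence on a nonempty open set) and Euclidean motions $x\mapsto Rx+b$, $R\in SO(3,\mathbb C)$, $b\in\mathbb C^3$. **Variety.** To a system and a point $x\in U$ belongs the ten-tuple $D=(A^{12},A^{13},A^{22},A^{23},A^{33},B^{12},B^{22},B^{23},B^{33},C^{33})\in\mathbb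 C^{10}$ of values at $x$. Let $\mathcal V\subset\mathbb C^{10}$ be the set of common zeros of $$\begin{aligned} &-A^{22}B^{23}+B^{23}A^{33}+B^{12}A^{13}+A^{23}B^{22}-A^{12}A^{23}-A^{23}B^{33},\\ &(A^{33})^2+B^{12}A^{33}-A^{33}A^{22}-A^{12}B^{33}-A^{13}C^{33}+A^{12}B^{22}-B^{12}A^{22}+A^{13}B^{23}-(A^{12})^2,\\ &B^{23}C^{33}+B^{12}A^{33}+(B^{12})^2+B^{22}B^{33}-(B^{33})^2-A^{12}B^{33}-(B^{23})^2,\\ &-B^{12}A^{23}-A^{33}A^{23}+A^{13}B^{33}+A^{12}B^{23},\\ &-B^{23}A^{23}+C^{33}A^{23}+A^{22}B^{33}-A^{33}B^{33}+B^{12}A^{12},\\ &A^{13}C^{33}+2A^{13}B^{23}+B^{22}B^{33}-(B^{33})^2+A^{33}A^{22}-(A^{33})^2+2A^{12}B^{22}+(A^{12})^2-2B^{12}A^{22}\\ &\quad+(B^{12})^2+B^{23}C^{33}-(B^{23})^2-3(A^{23})^2. \end{aligned}$$ **Rotations.** Put $B^{13}=C^{12}=A^{23}$, $C^{13}=B^{12}-A^{22}+A^{33}$,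 $C^{22}=B^{23}-A^{13}$, $C^{23}=A^{12}+B^{33}$; then $R\in SO(3,\mathbb C)$ acts on $\mathbb C^{10}$ as it transforms the canonical equations under $x\mapsto Rx$. Put $$\begin{aligned} X_{\pm1}&=\pm(A^{33}+3B^{12}-2A^{22})+i(3A^{12}+B^{33}+B^{22}),\quad X_0=-\sqrt2(C^{33}+2A^{13}+B^{23}),\\ Y_{\pm3}&=\pm(A^{22}+2B^{12})+i(B^{22}-2A^{12}),\quad Y_{\pm2}=\sqrt6(A^{13}-B^{23}\pm2iA^{23}),\\ Y_{\pm1}&=\tfrac{\sqrt3}{\sqrt5}\bigl(\pm(3A^{22}-2B^{12}-4A^{33})+i(B^{22}-2A^{12}-4B^{33})\bigr),\quad Y_0=\tfrac2{\sqrt5}(2C^{33}-A^{13}-3B^{23}). \end{aligned}$$ **Translations.** Put $Z^{(1)}=X_0^2-2X_{-1}X_1$, $Z^{(5X)}_m=5Z^{(5b)}_m+2Z^{(5a)}_m$, $Z^{(9Y)}_m=24Z^{(9b)}_m-5Z^{(9a)}_m$, where $Z^{(5a)},Z^{(5b)}$ ($|m|\le2$) and $Z^{(9a)},Z^{(9b)}$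 ($|m|\le4$) are the standard $so(3,\mathbb C)$-blocks of quadratics ($J_-f_m=\sqrt{(l+m)(l-m+1)}f_{m-1}$, $l=2$ resp. $4$, with $J_-$ acting so on $X_m$ ($l=1$) and $Y_m$ ($l=3$)) with highest weight vectors $X_1^2$, $\ Y_1^2-\frac{\sqrt{10}}{\sqrt3}Y_0Y_2+\frac{\sqrt5}{\sqrt3}Y_{-1}Y_3$, $\ Y_2^2-\frac{2\sqrt3}{\sqrt5}Y_1Y_3$, $\ X_1Y_3$. With $\partial_\pm=i\partial_y\pm\partial_x$ the infinitesimal translations are the quadratic vector fields $\partial_x,\partial_y,\partial_z$ on $\mathbb C^{10}$ given by $$\begin{aligned} \partial_\pm X_{\pm1}&=\tfrac1{30}Z^{(5X)}_{\pm2},\quad \partial_\mp X_{\pm1}=\tfrac1{30\sqrt6}Z^{(5X)}_0-\tfrac19Z^{(1)},\quad \partial_zX_{\pm1}=-\tfrac1{60}Z^{(5X)}_{\pm1},\\ \partial_\pm X_0&=\tfrac1{30\sqrt2}Z^{(5X)}_{\pm1},\quad \partial_zX_0=-\tfrac1{30\sqrt3}Z^{(5X)}_0-\tfrac1{9\sqrt2}Z^{(1)},\\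 \partial_\pm Y_{\pm3}&=\tfrac1{90}Z^{(9Y)}_{\pm4},\quad \partial_\mp Y_{\pm3}=\tfrac1{180\sqrt7}Z^{(9Y)}_{\pm2}+\tfrac1{35}Z^{(5X)}_{\pm2},\quad \partial_zY_{\pm3}=-\tfrac1{180\sqrt2}Z^{(9Y)}_{\pm3},\\ \partial_\pm Y_{\pm2}&=\tfrac1{60\sqrt3}Z^{(9Y)}_{\pm3},\quad \partial_\mp Y_{\pm2}=\tfrac1{60\sqrt{21}}Z^{(9Y)}_{\pm1}+\tfrac{\sqrt2}{35\sqrt3}Z^{(5X)}_{\pm1},\quad \partial_zY_{\pm2}=-\tfrac1{30\sqrt{42}}Z^{(9Y)}_{\pm2}+\tfrac1{35\sqrt6}Z^{(5X)}_{\pm2},\\ \partial_\pm Y_{\pm1}&=\tfrac1{12\sqrt{105}}Z^{(9Y)}_{\pm2}+\tfrac1{35\sqrt{15}}Z^{(5X)}_{\pm2},\quad \partial_\mp Y_{\pm1}=\tfrac1{30\sqrt{42}}Z^{(9Y)}_0+\tfrac{\sqrt2}{35\sqrt5}Z^{(5X)}_0,\\ \partial_zY_{\pm1}&=-\tfrac1{12\sqrt{210}}Z^{(9Y)}_{\pm1}+\tfrac2{35\sqrt{15}}Z^{(5X)}_{\pm1},\quad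 \partial_\pm Y_0=\tfrac1{18\sqrt{70}}Z^{(9Y)}_{\pm1}+\tfrac1{35\sqrt5}Z^{(5X)}_{\pm1},\\ \partial_zY_0&=-\tfrac1{45\sqrt{14}}Z^{(9Y)}_0+\tfrac{\sqrt3}{35\sqrt{10}}Z^{(5X)}_0. \end{aligned}$$ **Theorem.** 1. $SO(3,\mathbb C)$ acts linearly on $\mathbb C^{10}$ and preserves $\mathcal V$. $\mathbb C^{10}$ is the direct sum of the irreducible subrepresentations $\{Y=0\}$ of dimension 3 and $\{X=0\}$ of dimension 7, and with $J_+=iJ_x+J_y$, $J_-=iJ_x-J_y$, $J_3=iJ_z$ (where $J_x,J_y,J_z$ are the Lie derivatives along the infinitesimal rotations $E_{23}-E_{32}$, $E_{13}-E_{31}$, $E_{12}-E_{21}$) one has $J_\pm f_m=\sqrt{(l\mp m)(l\pm m+1)}\,f_{m\pm1}$, $J_3f_m=mf_m$ for $f=X$ ($l=1$) and $f=Y$ ($l=3$). 2. For each $D\in\mathcal V$ there are a ball around $0\in\mathbb C^3$ and a unique solution $\Phi$ on it of the translation equations with $\Phi(0)=D$; it has values in $\mathcal V$, and integral curves of infinitesimal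 translations that start in $\mathcal V$ stay in $\mathcal V$. Rotations and translations are compatible: $R\cdot P_v(D)=P_{Rv}(R\cdot D)$ on $\mathcal V$, where $P_v$ is the vector field of the translation $v$. The vector fields of all elements of $e(3,\mathbb C)$ are tangent to $\mathcal V$ and on $\mathcal V$ satisfy the commutation relations of $e(3,\mathbb C)$ (with the sign of a left action). Thus $E(3,\mathbb C)$ acts locally on $\mathcal V$. 3. The ten-tuples of all nondegenerate superintegrable systems at all points lie in $\mathcal V$; for each $D\in\mathcal V$ and each $x\in\mathbb C^3$ there is such a system with ten-tuple $D$ at $x$, and any two such systems coincide near $x$. 4. Two points $D,D'\in\mathcal V$ determine the same superintegrable system (i.e. are values of two systems that are the same) if and only if they lie on the same leaf, i.e. on the same orbit of the local action of $E(3,\mathbb C)$: $D'$ can be reached from $D$ in finitely many steps, each a rotation in $SO(3,\mathbb C)$ or a motion along an integral curve in $\mathcal V$ of an infinitesimal translation $v\in\mathbb C^3$, or the inverse of such a step. -/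

import Mathlib

open Topology

noncomputable section

namespace Superintegrable

/-! ### Complex Euclidean 3-space, the canonical equations and superintegrable systems -/

/-- Complex Euclidean three-space, with coordinates `x = x 0`, `y = x 1`, `z = x 2`. -/
abbrev C3 : Type := Fin 3 → ℂ

/-- The partial derivative `∂f/∂xᵢ`. -/
def pd (i : Fin 3) (f : C3 → ℂ) (x : C3) : ℂ := fderiv ℂ f x (Pi.single i 1)

/-- The fifteen coefficients of the canonical equations. The five rows belong to
`V₂₂ - V₁₁`, `V₃₃ - V₁₁`, `V₁₂`, `V₁₃`, `V₂₃` (in this order), the three columns are the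
coefficients `A, B, C` of `V₁, V₂, V₃`. -/
abbrev Coeffs : Type := Fin 5 → Fin 3 → ℂ

/-- `V` is a holomorphic solution on `N` of the canonical equations with coefficients `K`. -/
def IsPotential (K : C3 → Coeffs) (N : Set C3) (V : C3 → ℂ) : Prop :=
  DifferentiableOn ℂ V N ∧ ∀ x ∈ N,
    pd 1 (pd 1 V) x = pd 0 (pd 0 V) x + ∑ k, K x 0 k * pd k V x ∧
    pd 2 (pd 2 V) x = pd 0 (pd 0 V) x + ∑ k, K x 1 k * pd k V x ∧
    pd 0 (pd 1 V) x = ∑ k, K x 2 k * pd k V x ∧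
    pd 0 (pd 2 V) x = ∑ k, K x 3 k * pd k V x ∧
    pd 1 (pd 2 V) x = ∑ k, K x 4 k * pd k V x

/-- `V` has prescribed values of `V, V₁, V₂, V₃, V₁₁` at the point `x₀`. -/
def HasData (V : C3 → ℂ) (x₀ : C3) (c : ℂ) (g : Fin 3 → ℂ) (c₁₁ : ℂ) : Prop :=
  V x₀ = c ∧ (∀ i, pd i V x₀ = g i) ∧ pd 0 (pd 0 V) x₀ = c₁₁

/-- Nondegeneracy: at each point of `U` the values of `V, V₁, V₂, V₃, V₁₁` can be prescribed
arbitrarily, and there is one and only one (germ of a) solution of the canonical equations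
with these values. -/
def IsNondegenerate (U : Set C3) (K : C3 → Coeffs) : Prop :=
  ∀ x₀ ∈ U, ∀ (c : ℂ) (g : Fin 3 → ℂ) (c₁₁ : ℂ),
    (∃ N : Set C3, IsOpen N ∧ x₀ ∈ N ∧ N ⊆ U ∧
      ∃ V, IsPotential K N V ∧ HasData V x₀ c g c₁₁) ∧
    ∀ (N : Set C3) (V V' : C3 → ℂ), IsOpen N → x₀ ∈ N → N ⊆ U →
      IsPotential K N V → HasData V x₀ c g c₁₁ →
      IsPotential K N V' → HasData V' x₀ c g c₁₁ → V =ᶠ[𝓝 x₀] V'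

/-- Phase space, with points `(x, p)`. -/
abbrev Phase : Type := C3 × C3

/-- The Poisson bracket `{f, g} = ∑ⱼ (∂f/∂xⱼ ∂g/∂pⱼ - ∂f/∂pⱼ ∂g/∂xⱼ)`. -/
def poisson (f g : Phase → ℂ) (z : Phase) : ℂ :=
  ∑ j, (fderiv ℂ f z (Pi.single j 1, 0) * fderiv ℂ g z (0, Pi.single j 1)
    - fderiv ℂ f z (0, Pi.single j 1) * fderiv ℂ g z (Pi.single j 1, 0))

/-- The function `∑ aʲᵏ(x) pⱼ pₖ + W(x)` on phase space. -/
def quadFun (a : C3 → Matrix (Fin 3) (Fin 3) ℂ) (W : C3 → ℂ) (z : Phase) : ℂ :=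
  ∑ j, ∑ k, a z.1 j k * z.2 j * z.2 k + W z.1

/-- The Hamiltonian `p₁² + p₂² + p₃² + V(x)`. -/
def hamiltonian (V : C3 → ℂ) (z : Phase) : ℂ :=
  z.2 0 ^ 2 + z.2 1 ^ 2 + z.2 2 ^ 2 + V z.1

/-- `∑ aʲᵏ pⱼ pₖ + W` is a constant of the motion over `N` for the potential `V`. -/
def IsConstantOfMotion (N : Set C3) (V : C3 → ℂ) (a : C3 → Matrix (Fin 3) (Fin 3) ℂ)
    (W : C3 → ℂ) : Prop :=
  DifferentiableOn ℂ W N ∧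
    ∀ x ∈ N, ∀ p : C3, poisson (hamiltonian V) (quadFun a W) (x, p) = 0

/-- Second order superintegrability of the family of all solutions of the canonical equations:
there are five quadratic forms `a h` in the momenta, the first one that of the Hamiltonian,
which are linearly independent at each point of `U` (functional linear independence), which
for every potential of the family extend (locally) to constants of the motion, and for which
near every point the five constants of the motion are functionally independent for suitable
potentials of the family. -/
def IsSuperintegrable (U : Set C3) (K : C3 → Coeffs) : Prop :=
  ∃ a : Fin 5 → C3 → Matrix (Fin 3) (Fin 3) ℂ,
    (∀ x ∈ U, a 0 x = 1) ∧
    (∀ h, ∀ x ∈ U, (a h x).IsSymm) ∧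
    (∀ h i j, DifferentiableOn ℂ (fun x => a h x i j) U) ∧
    (∀ x ∈ U, LinearIndependent ℂ (fun h => a h x)) ∧
    (∀ x₀ ∈ U, ∀ (N : Set C3) (V : C3 → ℂ), IsOpen N → x₀ ∈ N → N ⊆ U → IsPotential K N V →
      ∃ N' : Set C3, IsOpen N' ∧ x₀ ∈ N' ∧ N' ⊆ N ∧
        ∃ W : Fin 5 → C3 → ℂ, ∀ h, IsConstantOfMotion N' V (a h) (W h)) ∧
    (∀ x₀ ∈ U, ∃ (N : Set C3) (V : C3 → ℂ) (W : Fin 5 → C3 → ℂ) (p : C3),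
      IsOpen N ∧ x₀ ∈ N ∧ N ⊆ U ∧ IsPotential K N V ∧
      (∀ h, IsConstantOfMotion N V (a h) (W h)) ∧
      LinearIndependent ℂ (fun h => fderiv ℂ (quadFun (a h) (W h)) (x₀, p)))

/-- A second order superintegrable system with nondegenerate potential over a connected open set
`U` of regular points of complex Euclidean three-space, given by the coefficients of its
canonical equations (the values of `K` outside `U` are irrelevant). -/
structure System where
  U : Set C3
  isOpen : IsOpen U
  isConnected : IsConnected U
  K : C3 → Coeffs
  holomorphic : ∀ r k, DifferentiableOn ℂ (fun x => K x r k) U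
  nondegenerate : IsNondegenerate U K
  superintegrable : IsSuperintegrable U K

/-- Membership in `SO(3, ℂ)` (complex orthogonal, not unitary). -/
def IsRotation (R : Matrix (Fin 3) (Fin 3) ℂ) : Prop := R * R.transpose = 1 ∧ R.det = 1

/-- `S'` is a direct analytic continuation of `S`: the two systems coincide on some nonempty
open set. -/
def System.Continues (S S' : System) : Prop :=
  ∃ N : Set C3, IsOpen N ∧ N.Nonempty ∧ N ⊆ S.U ∧ N ⊆ S'.U ∧ ∀ x ∈ N, S.K x = S'.K x

/-- `S'` is the image of `S` under a Euclidean motion `x ↦ R x + b`: the motion maps the domain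
and the potentials of `S` to the domain and the potentials of `S'`. -/
def System.IsMotionOf (S S' : System) : Prop :=
  ∃ (R : Matrix (Fin 3) (Fin 3) ℂ) (b : C3), IsRotation R ∧
    S'.U = (fun x => R.mulVec x + b) '' S.U ∧
    ∀ (N : Set C3) (V : C3 → ℂ), IsOpen N → N ⊆ S.U →
      (IsPotential S.K N V ↔
        IsPotential S'.K ((fun x => R.mulVec x + b) '' N)
          (fun y => V (R.transpose.mulVec (y - b))))

/-- Two systems are the same (as analytic systems, up to Euclidean motions) if they are connected
by analytic continuations and Euclidean motions. -/
def System.Same : System → System → Prop :=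
  Relation.EqvGen (fun S S' => S.Continues S' ∨ S.IsMotionOf S')

/-! ### Ten-tuples and the variety -/

/-- Ten-tuples `(A¹², A¹³, A²², A²³, A³³, B¹², B²², B²³, B³³, C³³)`. -/
abbrev Ten : Type := Fin 10 → ℂ

abbrev A12 (D : Ten) : ℂ := D 0
abbrev A13 (D : Ten) : ℂ := D 1
abbrev A22 (D : Ten) : ℂ := D 2
abbrev A23 (D : Ten) : ℂ := D 3
abbrev A33 (D : Ten) : ℂ := D 4
abbrev B12 (D : Ten) : ℂ := D 5
abbrev B22 (D : Ten) : ℂ := D 6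
abbrev B23 (D : Ten) : ℂ := D 7
abbrev B33 (D : Ten) : ℂ := D 8
abbrev C33 (D : Ten) : ℂ := D 9

/-- The ten-tuple contained in the fifteen coefficients. -/
def tenOf (K : Coeffs) : Ten :=
  ![K 2 0, K 3 0, K 0 0, K 4 0, K 1 0, K 2 1, K 0 1, K 4 1, K 1 1, K 1 2]

/-- The system `S` takes on the value `D` at some point. -/
def System.Takes (S : System) (D : Ten) : Prop := ∃ x ∈ S.U, tenOf (S.K x) = D

/-- The ten-tuples `D` and `D'` determine the same superintegrable system. -/
def SameSystem (D D' : Ten) : Prop :=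
  ∃ S S' : System, S.Takes D ∧ S'.Takes D' ∧ S.Same S'

/-- The six quadratic polynomials. -/
def quadric (D : Ten) : Fin 6 → ℂ :=
  ![-A22 D * B23 D + B23 D * A33 D + B12 D * A13 D + A23 D * B22 D - A12 D * A23 D
      - A23 D * B33 D,
    A33 D ^ 2 + B12 D * A33 D - A33 D * A22 D - A12 D * B33 D - A13 D * C33 D + A12 D * B22 D
      - B12 D * A22 D + A13 D * B23 D - A12 D ^ 2,
    B23 D * C33 D + B12 D * A33 D + B12 D ^ 2 + B22 D * B33 D - B33 D ^ 2 - A12 D * B33 D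
      - B23 D ^ 2,
    -B12 D * A23 D - A33 D * A23 D + A13 D * B33 D + A12 D * B23 D,
    -B23 D * A23 D + C33 D * A23 D + A22 D * B33 D - A33 D * B33 D + B12 D * A12 D,
    A13 D * C33 D + 2 * A13 D * B23 D + B22 D * B33 D - B33 D ^ 2 + A33 D * A22 D - A33 D ^ 2
      + 2 * A12 D * B22 D + A12 D ^ 2 - 2 * B12 D * A22 D + B12 D ^ 2 + B23 D * C33 D
      - B23 D ^ 2 - 3 * A23 D ^ 2]

/-- The algebraic variety in `ℂ¹⁰` cut out by the six quadratics. -/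
def variety : Set Ten := {D | ∀ k, quadric D k = 0}

/-! ### Rotations -/

/-- The coefficient of `Vₖ` in `Vᵢⱼ - δᵢⱼ V₁₁`, where the five coefficients that are missing in the
ten-tuple are `B¹³ = C¹² = A²³`, `C¹³ = B¹² - A²² + A³³`, `C²² = B²³ - A¹³`,
`C²³ = A¹² + B³³`. -/
def tensor (D : Ten) : Fin 3 → Fin 3 → Fin 3 → ℂ :=
  ![![![0, 0, 0],
      ![A12 D, B12 D, A23 D],
      ![A13 D, A23 D, B12 D - A22 D + A33 D]],
    ![![A12 D, B12 D, A23 D],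
      ![A22 D, B22 D, B23 D - A13 D],
      ![A23 D, B23 D, A12 D + B33 D]],
    ![![A13 D, A23 D, B12 D - A22 D + A33 D],
      ![A23 D, B23 D, A12 D + B33 D],
      ![A33 D, B33 D, C33 D]]]

/-- The ten-tuple of a tensor: if `Vᵢⱼ = δᵢⱼ F + ∑ₖ Tᵢⱼₖ Vₖ`, then `Tᵢⱼₖ - δᵢⱼ T₁₁ₖ` is the
coefficient of `Vₖ` in `Vᵢⱼ - δᵢⱼ V₁₁`. -/
def tenOfTensor (T : Fin 3 → Fin 3 → Fin 3 → ℂ) : Ten :=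
  ![T 0 1 0, T 0 2 0, T 1 1 0 - T 0 0 0, T 1 2 0, T 2 2 0 - T 0 0 0,
    T 0 1 1, T 1 1 1 - T 0 0 1, T 1 2 1, T 2 2 1 - T 0 0 1, T 2 2 2 - T 0 0 2]

/-- The action of a rotation on ten-tuples, as it results from the behaviour of the canonical
equations under the change of variables `x ↦ R x`. -/
def rot (R : Matrix (Fin 3) (Fin 3) ℂ) (D : Ten) : Ten :=
  tenOfTensor fun i j k => ∑ a, ∑ b, ∑ c, R i a * R j b * R k c * tensor D a b c

/-- The linear vector field on ten-tuples generated by the infinitesimal rotation `J`. -/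
def rotField (J : Matrix (Fin 3) (Fin 3) ℂ) (D : Ten) : Ten :=
  tenOfTensor fun i j k =>
    ∑ a, (J i a * tensor D a j k + J j a * tensor D i a k + J k a * tensor D i j a)

/-- The square root of a natural number, as a complex number. -/
def rt (n : ℕ) : ℂ := ((Real.sqrt n : ℝ) : ℂ)

/-- The block of dimension three: `X₊₁, X₀, X₋₁`. -/
def X (D : Ten) : ℤ → ℂ
  | 1 => A33 D + 3 * B12 D - 2 * A22 D + Complex.I * (3 * A12 D + B33 D + B22 D)
  | 0 => -rt 2 * (C33 D + 2 * A13 D + B23 D)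
  | -1 => -A33 D - 3 * B12 D + 2 * A22 D + Complex.I * (3 * A12 D + B33 D + B22 D)
  | _ => 0

/-- The block of dimension seven: `Y₊₃, …, Y₋₃`. -/
def Y (D : Ten) : ℤ → ℂ
  | 3 => A22 D + 2 * B12 D + Complex.I * (B22 D - 2 * A12 D)
  | 2 => rt 6 * (A13 D - B23 D + 2 * Complex.I * A23 D)
  | 1 => rt 3 / rt 5 *
      (3 * A22 D - 2 * B12 D - 4 * A33 D + Complex.I * (B22 D - 2 * A12 D - 4 * B33 D))
  | 0 => 2 / rt 5 * (2 * C33 D - A13 D - 3 * B23 D)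
  | -1 => rt 3 / rt 5 *
      (2 * B12 D + 4 * A33 D - 3 * A22 D + Complex.I * (B22 D - 2 * A12 D - 4 * B33 D))
  | -2 => rt 6 * (A13 D - B23 D - 2 * Complex.I * A23 D)
  | -3 => -A22 D - 2 * B12 D + Complex.I * (B22 D - 2 * A12 D)
  | _ => 0

/-- The ten-tuples in the `X`-block, i.e. those for which all `Yₘ` vanish. -/
def blockX : Set Ten := {D | ∀ m, Y D m = 0}

/-- The ten-tuples in the `Y`-block, i.e. those for which all `Xₘ` vanish. -/
def blockY : Set Ten := {D | ∀ m, X D m = 0}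

/-- A linear subspace is invariant under rotations. -/
def RotInvariant (W : Submodule ℂ Ten) : Prop :=
  ∀ R, IsRotation R → ∀ D ∈ W, rot R D ∈ W

/-- A linear subspace is an irreducible representation of the rotation group. -/
def RotIrreducible (W : Submodule ℂ Ten) : Prop :=
  RotInvariant W ∧ W ≠ ⊥ ∧ ∀ W' ≤ W, RotInvariant W' → W' = ⊥ ∨ W' = W

/-- Infinitesimal rotations in the coordinate planes. -/
def Jx : Matrix (Fin 3) (Fin 3) ℂ := !![0, 0, 0; 0, 0, 1; 0, -1, 0]
def Jy : Matrix (Fin 3) (Fin 3) ℂ := !![0, 0, 1; 0, 0, 0; -1, 0, 0]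
def Jz : Matrix (Fin 3) (Fin 3) ℂ := !![0, 1, 0; -1, 0, 0; 0, 0, 0]

/-- The components `f` of weights `-l, …, l` transform under the infinitesimal rotations
`J₊ = i Jₓ + J_y`, `J₋ = i Jₓ - J_y`, `J₃ = i J_z` as in the standard irreducible representation of
highest weight `l`. The Lie derivative of a linear function `f` of `D` along the linear vector
field `rotField J` is `f (rotField J D)`. -/
def IsStandardBlock (l : ℕ) (f : Ten → ℤ → ℂ) : Prop :=
  ∀ (D : Ten) (m : ℤ), -(l : ℤ) ≤ m → m ≤ l →
    f (rotField (Complex.I • Jx + Jy) D) m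
      = ((Real.sqrt ((l - m) * (l + m + 1)) : ℝ) : ℂ) * f D (m + 1) ∧
    f (rotField (Complex.I • Jx - Jy) D) m
      = ((Real.sqrt ((l + m) * (l - m + 1)) : ℝ) : ℂ) * f D (m - 1) ∧
    f (rotField (Complex.I • Jz) D) m = m * f D m

/-! ### Translations -/

def Z1a (D : Ten) : ℂ := X D 0 ^ 2 - 2 * X D (-1) * X D 1

def Z5a (D : Ten) : ℤ → ℂ
  | 2 => X D 1 ^ 2
  | 1 => rt 2 * X D 0 * X D 1
  | 0 => rt 2 / rt 3 * (X D 0 ^ 2 + X D (-1) * X D 1)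
  | -1 => rt 2 * X D 0 * X D (-1)
  | -2 => X D (-1) ^ 2
  | _ => 0

def Z5b (D : Ten) : ℤ → ℂ
  | 2 => Y D 1 ^ 2 - rt 10 / rt 3 * Y D 0 * Y D 2 + rt 5 / rt 3 * Y D (-1) * Y D 3
  | 1 => 1 / rt 3 * Y D 0 * Y D 1 - rt 5 / rt 2 * Y D (-1) * Y D 2
      + 5 / rt 6 * Y D (-2) * Y D 3
  | 0 => rt 2 / rt 3 * Y D 0 ^ 2 - rt 3 / rt 2 * Y D (-1) * Y D 1
      + 5 / rt 6 * Y D (-3) * Y D 3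
  | -1 => 1 / rt 3 * Y D 0 * Y D (-1) - rt 5 / rt 2 * Y D 1 * Y D (-2)
      + 5 / rt 6 * Y D 2 * Y D (-3)
  | -2 => Y D (-1) ^ 2 - rt 10 / rt 3 * Y D 0 * Y D (-2) + rt 5 / rt 3 * Y D 1 * Y D (-3)
  | _ => 0

/-- The block of dimension nine with highest weight vector `Y₂² - (2√3/√5) Y₁ Y₃`; the other
components are obtained from it by applying `J₋`. -/
def Z9a (D : Ten) : ℤ → ℂ
  | 4 => Y D 2 ^ 2 - 2 * rt 3 / rt 5 * Y D 1 * Y D 3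
  | 3 => 2 / rt 5 * Y D 1 * Y D 2 - 3 * rt 2 / rt 5 * Y D 0 * Y D 3
  | 2 => 2 / rt 7 * Y D 1 ^ 2 - rt 6 / rt 35 * Y D 0 * Y D 2
      - 6 * rt 3 / rt 35 * Y D (-1) * Y D 3
  | 1 => rt 6 / rt 7 * Y D 0 * Y D 1 - 8 / rt 35 * Y D (-1) * Y D 2
      - 2 * rt 3 / rt 7 * Y D (-2) * Y D 3
  | 0 => 3 * rt 2 / rt 35 * Y D 0 ^ 2 - rt 2 / rt 35 * Y D (-1) * Y D 1
      - rt 14 / rt 5 * Y D (-2) * Y D 2 - 3 * rt 2 / rt 35 * Y D (-3) * Y D 3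
  | -1 => rt 6 / rt 7 * Y D 0 * Y D (-1) - 8 / rt 35 * Y D 1 * Y D (-2)
      - 2 * rt 3 / rt 7 * Y D 2 * Y D (-3)
  | -2 => 2 / rt 7 * Y D (-1) ^ 2 - rt 6 / rt 35 * Y D 0 * Y D (-2)
      - 6 * rt 3 / rt 35 * Y D 1 * Y D (-3)
  | -3 => 2 / rt 5 * Y D (-1) * Y D (-2) - 3 * rt 2 / rt 5 * Y D 0 * Y D (-3)
  | -4 => Y D (-2) ^ 2 - 2 * rt 3 / rt 5 * Y D (-1) * Y D (-3)
  | _ => 0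

/-- The block of dimension nine with highest weight vector `X₁ Y₃`; the other components are
obtained from it by applying `J₋`. -/
def Z9b (D : Ten) : ℤ → ℂ
  | 4 => X D 1 * Y D 3
  | 3 => 1 / 2 * X D 0 * Y D 3 + rt 3 / 2 * X D 1 * Y D 2
  | 2 => 1 / rt 28 * X D (-1) * Y D 3 + rt 3 / rt 7 * X D 0 * Y D 2
      + rt 15 / rt 28 * X D 1 * Y D 1
  | 1 => rt 3 / rt 28 * X D (-1) * Y D 2 + rt 15 / rt 28 * X D 0 * Y D 1
      + rt 5 / rt 14 * X D 1 * Y D 0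
  | 0 => rt 3 / rt 14 * X D (-1) * Y D 1 + 2 / rt 7 * X D 0 * Y D 0
      + rt 3 / rt 14 * X D 1 * Y D (-1)
  | -1 => rt 3 / rt 28 * X D 1 * Y D (-2) + rt 15 / rt 28 * X D 0 * Y D (-1)
      + rt 5 / rt 14 * X D (-1) * Y D 0
  | -2 => 1 / rt 28 * X D 1 * Y D (-3) + rt 3 / rt 7 * X D 0 * Y D (-2)
      + rt 15 / rt 28 * X D (-1) * Y D (-1)
  | -3 => 1 / 2 * X D 0 * Y D (-3) + rt 3 / 2 * X D (-1) * Y D (-2)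
  | -4 => X D (-1) * Y D (-3)
  | _ => 0

def Z5X (D : Ten) (m : ℤ) : ℂ := 5 * Z5b D m + 2 * Z5a D m

def Z9Y (D : Ten) (m : ℤ) : ℂ := 24 * Z9b D m - 5 * Z9a D m

/-- `∂₊ Xₘ`, where `∂₊ = i ∂_y + ∂ₓ`. -/
def dpX (D : Ten) : ℤ → ℂ
  | 1 => 1 / 30 * Z5X D 2
  | 0 => 1 / (30 * rt 2) * Z5X D 1
  | -1 => 1 / (30 * rt 6) * Z5X D 0 - 1 / 9 * Z1a D
  | _ => 0

/-- `∂₋ Xₘ`, where `∂₋ = i ∂_y - ∂ₓ`. -/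
def dmX (D : Ten) : ℤ → ℂ
  | 1 => 1 / (30 * rt 6) * Z5X D 0 - 1 / 9 * Z1a D
  | 0 => 1 / (30 * rt 2) * Z5X D (-1)
  | -1 => 1 / 30 * Z5X D (-2)
  | _ => 0

/-- `∂_z Xₘ`. -/
def dzX (D : Ten) : ℤ → ℂ
  | 1 => -(1 / 60) * Z5X D 1
  | 0 => -(1 / (30 * rt 3)) * Z5X D 0 - 1 / (9 * rt 2) * Z1a D
  | -1 => -(1 / 60) * Z5X D (-1)
  | _ => 0

/-- `∂₊ Yₘ`. -/
def dpY (D : Ten) : ℤ → ℂ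
  | 3 => 1 / 90 * Z9Y D 4
  | 2 => 1 / (60 * rt 3) * Z9Y D 3
  | 1 => 1 / (12 * rt 105) * Z9Y D 2 + 1 / (35 * rt 15) * Z5X D 2
  | 0 => 1 / (18 * rt 70) * Z9Y D 1 + 1 / (35 * rt 5) * Z5X D 1
  | -1 => 1 / (30 * rt 42) * Z9Y D 0 + rt 2 / (35 * rt 5) * Z5X D 0
  | -2 => 1 / (60 * rt 21) * Z9Y D (-1) + rt 2 / (35 * rt 3) * Z5X D (-1)
  | -3 => 1 / (180 * rt 7) * Z9Y D (-2) + 1 / 35 * Z5X D (-2)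
  | _ => 0

/-- `∂₋ Yₘ`. -/
def dmY (D : Ten) : ℤ → ℂ
  | 3 => 1 / (180 * rt 7) * Z9Y D 2 + 1 / 35 * Z5X D 2
  | 2 => 1 / (60 * rt 21) * Z9Y D 1 + rt 2 / (35 * rt 3) * Z5X D 1
  | 1 => 1 / (30 * rt 42) * Z9Y D 0 + rt 2 / (35 * rt 5) * Z5X D 0
  | 0 => 1 / (18 * rt 70) * Z9Y D (-1) + 1 / (35 * rt 5) * Z5X D (-1)
  | -1 => 1 / (12 * rt 105) * Z9Y D (-2) + 1 / (35 * rt 15) * Z5X D (-2)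
  | -2 => 1 / (60 * rt 3) * Z9Y D (-3)
  | -3 => 1 / 90 * Z9Y D (-4)
  | _ => 0

/-- `∂_z Yₘ`. -/
def dzY (D : Ten) : ℤ → ℂ
  | 3 => -(1 / (180 * rt 2)) * Z9Y D 3
  | 2 => -(1 / (30 * rt 42)) * Z9Y D 2 + 1 / (35 * rt 6) * Z5X D 2
  | 1 => -(1 / (12 * rt 210)) * Z9Y D 1 + 2 / (35 * rt 15) * Z5X D 1
  | 0 => -(1 / (45 * rt 14)) * Z9Y D 0 + rt 3 / (35 * rt 10) * Z5X D 0
  | -1 => -(1 / (12 * rt 210)) * Z9Y D (-1) + 2 / (35 * rt 15) * Z5X D (-1)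
  | -2 => -(1 / (30 * rt 42)) * Z9Y D (-2) + 1 / (35 * rt 6) * Z5X D (-2)
  | -3 => -(1 / (180 * rt 2)) * Z9Y D (-3)
  | _ => 0

/-- The derivative of `Xₘ` in the direction `v`, i.e. `v₁ ∂ₓ Xₘ + v₂ ∂_y Xₘ + v₃ ∂_z Xₘ`. -/
def transX (v : C3) (D : Ten) (m : ℤ) : ℂ :=
  v 0 * ((dpX D m - dmX D m) / 2) + v 1 * ((dpX D m + dmX D m) / (2 * Complex.I))
    + v 2 * dzX D m

/-- The derivative of `Yₘ` in the direction `v`. -/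
def transY (v : C3) (D : Ten) (m : ℤ) : ℂ :=
  v 0 * ((dpY D m - dmY D m) / 2) + v 1 * ((dpY D m + dmY D m) / (2 * Complex.I))
    + v 2 * dzY D m

/-- The ten-tuple with given components `Xₘ` and `Yₘ`. -/
def ofXY (x y : ℤ → ℂ) : Ten :=
  let a := (x 1 + x (-1)) / (2 * Complex.I)
  let b := (x 1 - x (-1)) / 2
  let c := -x 0 / rt 2
  let y₁ := (y 3 - y (-3)) / 2
  let y₂ := (y 3 + y (-3)) / (2 * Complex.I)
  let y₃ := (y 2 - y (-2)) / (2 * Complex.I * rt 6)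
  let y₄ := (y 2 + y (-2)) / (2 * rt 6)
  let y₅ := rt 5 / (2 * rt 3) * (y 1 - y (-1))
  let y₆ := rt 5 / (2 * Complex.I * rt 3) * (y 1 + y (-1))
  let y₇ := rt 5 / 2 * y 0
  let b33 := (y₂ - y₆) / 4
  let a12 := (a - b33 - y₂) / 5
  let b12 := (4 * b + 5 * y₁ + y₅) / 20
  let b23 := (2 * c - y₇ - 5 * y₄) / 10
  ![a12, y₄ + b23, y₁ - 2 * b12, y₃ / 2, (3 * y₁ - 8 * b12 - y₅) / 4, b12, y₂ + 2 * a12, b23,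
    b33, (y₇ + y₄ + 4 * b23) / 2]

/-- The quadratic vector field on ten-tuples generated by the infinitesimal translation `v`. -/
def transField (v : C3) (D : Ten) : Ten := ofXY (transX v D) (transY v D)

/-- The vector field on ten-tuples generated by the element `(J, v)` of the Lie algebra
`e(3, ℂ) = so(3, ℂ) ⋉ ℂ³`. -/
def euclField (ξ : Matrix (Fin 3) (Fin 3) ℂ × C3) (D : Ten) : Ten :=
  rotField ξ.1 D + transField ξ.2 D

/-- The bracket of `e(3, ℂ)`. -/
def euclBracket (ξ η : Matrix (Fin 3) (Fin 3) ℂ × C3) : Matrix (Fin 3) (Fin 3) ℂ × C3 :=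
  (ξ.1 * η.1 - η.1 * ξ.1, ξ.1.mulVec η.2 - η.1.mulVec ξ.2)

/-- `Φ` is (on the set `N` of translations) the local translation flow through `D`. -/
def IsTranslationFlow (N : Set C3) (D : Ten) (Φ : C3 → Ten) : Prop :=
  Φ 0 = D ∧ ∀ x ∈ N, ∃ L : C3 →L[ℂ] Ten, HasFDerivAt Φ L x ∧ ∀ v, L v = transField v (Φ x)

/-- `γ : [0, 1] → ℂ¹⁰` is an integral curve of the infinitesimal translation `v`. -/
def IsTranslationCurve (v : C3) (γ : ℝ → Ten) : Prop :=
  ∀ t ∈ Set.Icc (0 : ℝ) 1, HasDerivWithinAt γ (transField v (γ t)) (Set.Icc 0 1) t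

/-- `D'` is obtained from the point `D` of the variety by a rotation, or by following the local
flow of translations in a fixed direction `v ∈ ℂ³` within the variety. -/
def LeafStep (D D' : Ten) : Prop :=
  (D ∈ variety ∧ ∃ R, IsRotation R ∧ D' = rot R D) ∨
  (∃ (v : C3) (γ : ℝ → Ten), IsTranslationCurve v γ ∧ (∀ t ∈ Set.Icc (0 : ℝ) 1, γ t ∈ variety) ∧
    γ 0 = D ∧ γ 1 = D')

/-- `D` and `D'` lie on the same leaf, i.e. on the same orbit of the (local) action of the
Euclidean group. -/
def SameLeaf : Ten → Ten → Prop := Relation.EqvGen LeafStep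

end Superintegrable

end

/-! A ten-tuple is a cubic form on ℂ³. In Vᵢⱼ = δᵢⱼ F + ∑ₖ Tᵢⱼₖ Vₖ the function F is free, so T
matters only up to terms δᵢⱼ uₖ. The relations for the five missing coefficients say that this class
contains a totally symmetric tensor G (`cub`). Thus ℂ¹⁰ is Sym³(ℂ³) with its natural rotation
action, and the two blocks are the trace part and the trace-free part.

Put (Gᵢ)ⱼₖ = Gᵢⱼₖ. The commutators [Gᵢ, Gₗ] have the symmetries of a curvature tensor, hence six
independent components in dimension three, and the six quadrics are an invertible linear combination
of these (`mem_variety_iff`). So D lies in the variety exactly if u·v = B_u v with B_u = ⅓ ∑ uₗ Gₗ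
is an associative (and always commutative) product on ℂ³; the standard bilinear form is invariant
under it.

The translation field is a quadratic expression in G (`transField_eq`). On the variety its
Ricci-type terms vanish and it becomes ∂_v Gᵢ = ⅓ G_v Gᵢ (`gam_transField_of_mem`). Tangency,
compatibility with rotations and the commutation relations are then matrix algebra, and the flow is
explicit: Gᵢ (1 - B_x)⁻¹ (`hasDV_flow`).

Existence of systems. With a unit formally adjoined to the algebra, one calculates as in one
variable. The potentials are spanned by constants, the functions ⟨w, (1 - x)⁻²⟩ and, formally, (1 -
x)² + (1 - x)⁻². Every symmetric matrix A extends to a Killing tensor `killing D A` that is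
compatible with all of these potentials. A choice of five of the six forms gives
`isSuperintegrable_flow`; `isNondegenerate_flow` follows because F and the vector (1 - B_x)³∇V - (a
known term) are first integrals.

Necessity. For a given system the canonical equations and the Bertrand–Darboux equations express all
first derivatives of ∇V (up to F) and of the Killing tensors. The symmetry of second derivatives of
the Killing tensors gives linear relations for the five matrices a_h. Five independent vectors in a
space of dimension six have an annihilator of dimension at most one, so all these relations are
proportional and their 2×2 minors vanish. This forces the obstruction to be a single scalar τ of
constant-curvature type (`rigidity`, `scalar_of_integrability`). Differentiating the commutator
relation once more gives τ = 0 (`scalar_eq_zero`). What remains is associativity and the translation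
equation (`System.mem_variety_and_solvesTranslation`).

Leaves. By uniqueness for the translation equation a system is locally determined by one value, so
any system agrees locally with an explicit one, and a rotation of the value is realized by a motion
of the explicit systems. Connectedness of [0, 1] and of the domains turns these local statements
into the equivalence of leaves and systems. -/

open Topology

noncomputable section

namespace Superintegrable

/-! ### The symmetric tensor of a ten-tuple -/

/-- The totally symmetric tensor `Gᵢⱼₖ` of a ten-tuple: it differs from `tensor` by `δᵢⱼ uₖ`. -/
def cub (D : Ten) (i j k : Fin 3) : ℂ :=
  tensor D i j k + if i = j then ![B12 D - A22 D, A12 D, A13 D] k else 0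

lemma cub_comm₁₂ (D : Ten) (i j k : Fin 3) : cub D i j k = cub D j i k := by
  fin_cases i <;> fin_cases j <;> fin_cases k <;> simp [cub, tensor]

/-- This is the meaning of the relations for B¹³, C¹², C¹³, C²², C²³: after adding δᵢⱼ uₖ with u =
(B¹² - A²², A¹², A¹³) the tensor is totally symmetric. -/
lemma cub_comm₂₃ (D : Ten) (i j k : Fin 3) : cub D i j k = cub D i k j := by
  fin_cases i <;> fin_cases j <;> fin_cases k <;> simp [cub, tensor] <;> ring

/-- The term δᵢⱼ uₖ can be moved into the free function F, so every construction on `tensor` may be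
carried out on the symmetric `cub` instead. -/
lemma tenOfTensor_add_diag (T : Fin 3 → Fin 3 → Fin 3 → ℂ) (u : Fin 3 → ℂ) :
    tenOfTensor (fun i j k => T i j k + if i = j then u k else 0) = tenOfTensor T := by
  ext n; fin_cases n <;> simp [tenOfTensor]

lemma tenOfTensor_cub (D : Ten) : tenOfTensor (cub D) = D := by
  ext n; fin_cases n <;> simp [tenOfTensor, cub, tensor]

/-- Together with `tenOfTensor_cub` this identifies ten-tuples with Sym³(ℂ³), which also has
dimension ten. -/
lemma cub_tenOfTensor {T : Fin 3 → Fin 3 → Fin 3 → ℂ} (h₁ : ∀ i j k, T i j k = T j i k)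
    (h₂ : ∀ i j k, T i j k = T i k j) : cub (tenOfTensor T) = T := by
  have e1 := h₁ 1 0
  have e2 := h₁ 2 0
  have e3 := h₁ 2 1
  have f1 := fun i => h₂ i 1 0
  have f2 := fun i => h₂ i 2 0
  have f3 := fun i => h₂ i 2 1
  ext i j k
  fin_cases i <;> fin_cases j <;> fin_cases k <;>
    simp [cub, tensor, tenOfTensor, e1, e2, e3, f1, f2, f3]

/-- The matrices `(Gᵢ)ⱼₖ = Gᵢⱼₖ`. -/
def gam (D : Ten) (i : Fin 3) : Matrix (Fin 3) (Fin 3) ℂ := Matrix.of fun j k => cub D i j k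

@[simp] lemma gam_apply (D : Ten) (i j k : Fin 3) : gam D i j k = cub D i j k := rfl

lemma gam_injective {D E : Ten} (h : ∀ i, gam D i = gam E i) : D = E := by
  rw [← tenOfTensor_cub D, ← tenOfTensor_cub E]
  congr 1; ext i j k; exact congrFun (congrFun (h i) j) k

lemma gam_transpose (D : Ten) (i : Fin 3) : (gam D i).transpose = gam D i := by
  ext j k; exact cub_comm₂₃ D i k j

lemma gam_tenOfTensor {T : Fin 3 → Fin 3 → Fin 3 → ℂ} (h₁ : ∀ i j k, T i j k = T j i k)
    (h₂ : ∀ i j k, T i j k = T i k j) (i : Fin 3) :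
    gam (tenOfTensor T) i = Matrix.of fun j k => T i j k := by
  ext j k; simp [cub_tenOfTensor h₁ h₂]

/-- The commutator of the matrices `Gᵢ` and `Gₗ` of two ten-tuples. -/
def comm (D E : Ten) (i l : Fin 3) : Matrix (Fin 3) (Fin 3) ℂ :=
  gam D i * gam E l - gam E l * gam D i

/-- The six quadratics as linear combinations of the components of the commutators. -/
def quadricOfComm (C : Fin 3 → Fin 3 → Matrix (Fin 3) (Fin 3) ℂ) : Fin 6 → ℂ :=
  ![-C 0 1 1 2, C 0 1 0 1 - C 0 2 0 2, C 1 2 1 2 - C 0 1 0 1, C 0 1 0 2, C 0 2 1 2,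
    C 0 1 0 1 + C 0 2 0 2 + C 1 2 1 2]

lemma quadric_eq (D : Ten) : quadric D = quadricOfComm (comm D D) := by
  ext n; fin_cases n <;>
    simp [quadric, quadricOfComm, comm, Matrix.mul_apply, Fin.sum_univ_three, cub, tensor] <;> ring

lemma comm_self_swap (D : Ten) (i l : Fin 3) : comm D D i l = -comm D D l i := by
  simp [comm]

lemma comm_self_apply_swap (D : Ten) (i l j m : Fin 3) :
    comm D D i l j m = -comm D D i l m j := by
  simp only [comm, Matrix.sub_apply, Matrix.mul_apply, gam_apply, neg_sub]
  congr 1 <;> refine Finset.sum_congr rfl fun k _ => ?_ <;>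
    rw [cub_comm₂₃ D _ j k, cub_comm₂₃ D _ k m, mul_comm]

/-- With the two antisymmetries these are the symmetries of a curvature tensor; in dimension three
they leave the six components with i < l, j < m and (i, l) ≤ (j, m). -/
lemma comm_self_pair_swap (D : Ten) (i l j m : Fin 3) : comm D D i l j m = comm D D j m i l := by
  simp only [comm, Matrix.sub_apply, Matrix.mul_apply, gam_apply]
  congr 1
  · refine Finset.sum_congr rfl fun k _ => ?_
    rw [cub_comm₁₂ D i j, cub_comm₂₃ D l k, cub_comm₂₃ D m k, cub_comm₁₂ D l m]
  · refine Finset.sum_congr rfl fun k _ => ?_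
    rw [cub_comm₂₃ D i k, cub_comm₂₃ D j k, cub_comm₁₂ D i m, cub_comm₁₂ D l j, mul_comm]

/-- The quadrics are six linear combinations of the six independent commutator components, and the
combination can be inverted. So the variety is the set of cubic forms whose product is associative.
-/
theorem mem_variety_iff {D : Ten} :
    D ∈ variety ↔ ∀ i l, gam D i * gam D l = gam D l * gam D i := by
  constructor
  · intro h
    have h' : ∀ k, quadricOfComm (comm D D) k = 0 := fun k => by rw [← quadric_eq]; exact h k
    have h0 := h' 0; have h1 := h' 1; have h2 := h' 2; have h3 := h' 3; have h4 := h' 4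
    have h5 := h' 5
    simp only [quadricOfComm, Matrix.cons_val, neg_eq_zero] at h0 h1 h2 h3 h4 h5
    have a1 : comm D D 0 1 0 1 = 0 := by linear_combination (h1 - h2 + h5) / 3
    have a2 : comm D D 0 2 0 2 = 0 := by linear_combination a1 - h1
    have a3 : comm D D 1 2 1 2 = 0 := by linear_combination a1 + h2
    have b0 := comm_self_pair_swap D 0 1 1 2
    have b3 := comm_self_pair_swap D 0 1 0 2
    have b4 := comm_self_pair_swap D 0 2 1 2
    have key : ∀ i l j m, i < l → j < m → comm D D i l j m = 0 := by
      intro i l j m hi hj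
      fin_cases i <;> fin_cases l <;> simp at hi <;> fin_cases j <;> fin_cases m <;>
        simp at hj <;> simp_all
    have key₂ : ∀ i l j m, i < l → comm D D i l j m = 0 := by
      intro i l j m hi
      rcases lt_trichotomy j m with hj | hj | hj
      · exact key i l j m hi hj
      · subst hj
        have := comm_self_apply_swap D i l j j
        linear_combination this / 2
      · rw [comm_self_apply_swap, key i l m j hi hj, neg_zero]
    intro i l
    rw [← sub_eq_zero]
    change comm D D i l = 0
    rcases lt_trichotomy i l with hi | hi | hi
    · ext j m; exact key₂ i l j m hi
    · subst hi; simp [comm]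
    · rw [comm_self_swap, neg_eq_zero]; ext j m; exact key₂ l i j m hi
  · intro h k
    have : comm D D = fun _ _ => 0 := by ext1 i; ext1 l; simp [comm, h i l]
    rw [quadric_eq, this]; fin_cases k <;> simp [quadricOfComm]

/-- The matrix `∑ₗ vₗ Gₗ`. -/
def gamv (D : Ten) (v : C3) : Matrix (Fin 3) (Fin 3) ℂ := ∑ l, v l • gam D l

/-! ### Rotations in terms of symmetric matrices -/

lemma IsRotation.transpose_mul {R : Matrix (Fin 3) (Fin 3) ℂ} (h : IsRotation R) :
    R.transpose * R = 1 := mul_eq_one_comm.mp h.1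

lemma IsRotation.transpose {R : Matrix (Fin 3) (Fin 3) ℂ} (h : IsRotation R) :
    IsRotation R.transpose := ⟨by simpa using h.transpose_mul, by simpa using h.2⟩

lemma IsRotation.mul {R S : Matrix (Fin 3) (Fin 3) ℂ} (h : IsRotation R) (h' : IsRotation S) :
    IsRotation (R * S) :=
  ⟨by rw [Matrix.transpose_mul, Matrix.mul_assoc, ← Matrix.mul_assoc S, h'.1, Matrix.one_mul, h.1],
    by simp [h.2, h'.2]⟩

lemma IsRotation.one : IsRotation 1 := ⟨by simp, by simp⟩

/-- The action of a matrix on tensors of rank three. -/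
def act (R : Matrix (Fin 3) (Fin 3) ℂ) (T : Fin 3 → Fin 3 → Fin 3 → ℂ) (i j k : Fin 3) : ℂ :=
  ∑ a, ∑ b, ∑ c, R i a * R j b * R k c * T a b c

lemma act_eq (R : Matrix (Fin 3) (Fin 3) ℂ) (T : Fin 3 → Fin 3 → Fin 3 → ℂ) (i j k : Fin 3) :
    act R T i j k
      = (∑ a, R i a • (R * (Matrix.of fun b c => T a b c) * R.transpose)) j k := by
  simp only [act, Matrix.sum_apply, Matrix.smul_apply, Matrix.mul_apply, Matrix.of_apply,
    Matrix.transpose_apply, smul_eq_mul, Finset.mul_sum, Finset.sum_mul]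
  refine Finset.sum_congr rfl fun a _ => ?_
  rw [Finset.sum_comm]
  refine Finset.sum_congr rfl fun c _ => Finset.sum_congr rfl fun b _ => ?_
  ring

/-- Orthogonality preserves δᵢⱼ, so the ambiguity δᵢⱼ uₖ is mapped to an ambiguity of the same kind.
Hence `rot`, defined through `tensor`, can be computed on `cub`. -/
lemma act_diag {R : Matrix (Fin 3) (Fin 3) ℂ} (hR : IsRotation R) (u : Fin 3 → ℂ)
    (i j k : Fin 3) :
    act R (fun a b c => if a = b then u c else 0) i j k = if i = j then R.mulVec u k else 0 := by
  have h : ∑ a, R i a * R j a = if i = j then 1 else 0 := by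
    have := congrFun (congrFun hR.1 i) j
    simpa [Matrix.mul_apply, Matrix.one_apply] using this
  calc act R (fun a b c => if a = b then u c else 0) i j k
      = (∑ a, R i a * R j a) * R.mulVec u k := by
        simp only [act, Matrix.mulVec, dotProduct, Finset.sum_mul, Finset.mul_sum]
        conv_rhs => rw [Finset.sum_comm]
        refine Finset.sum_congr rfl fun a _ => ?_
        rw [Finset.sum_comm]
        refine Finset.sum_congr rfl fun c _ => ?_
        simp [mul_assoc]
    _ = _ := by rw [h]; split_ifs <;> simp

lemma act_add (R : Matrix (Fin 3) (Fin 3) ℂ) (T T' : Fin 3 → Fin 3 → Fin 3 → ℂ) (i j k : Fin 3) :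
    act R (fun a b c => T a b c + T' a b c) i j k = act R T i j k + act R T' i j k := by
  simp only [act, mul_add, Finset.sum_add_distrib]

lemma rot_eq {R : Matrix (Fin 3) (Fin 3) ℂ} (hR : IsRotation R) (D : Ten) :
    rot R D = tenOfTensor (act R (cub D)) := by
  rw [show act R (cub D) = fun i j k => act R (tensor D) i j k + if i = j then
    R.mulVec ![B12 D - A22 D, A12 D, A13 D] k else 0 from ?_, tenOfTensor_add_diag]
  · rfl
  · ext i j k
    rw [← act_diag hR, ← act_add]; rfl

lemma act_comm₁₂ (R : Matrix (Fin 3) (Fin 3) ℂ) (D : Ten) (i j k : Fin 3) :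
    act R (cub D) i j k = act R (cub D) j i k := by
  simp only [act]
  rw [Finset.sum_comm]
  refine Finset.sum_congr rfl fun a _ => Finset.sum_congr rfl fun b _ =>
    Finset.sum_congr rfl fun c _ => ?_
  rw [cub_comm₁₂ D b a c]; ring

lemma act_comm₂₃ (R : Matrix (Fin 3) (Fin 3) ℂ) (D : Ten) (i j k : Fin 3) :
    act R (cub D) i j k = act R (cub D) i k j := by
  simp only [act]
  refine Finset.sum_congr rfl fun a _ => ?_
  rw [Finset.sum_comm]
  refine Finset.sum_congr rfl fun b _ => Finset.sum_congr rfl fun c _ => ?_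
  rw [cub_comm₂₃ D a c b]; ring

lemma cub_rot {R : Matrix (Fin 3) (Fin 3) ℂ} (hR : IsRotation R) (D : Ten) :
    cub (rot R D) = act R (cub D) := by
  rw [rot_eq hR, cub_tenOfTensor (act_comm₁₂ R D) (act_comm₂₃ R D)]

lemma gam_rot {R : Matrix (Fin 3) (Fin 3) ℂ} (hR : IsRotation R) (D : Ten) (i : Fin 3) :
    gam (rot R D) i = ∑ a, R i a • (R * gam D a * R.transpose) := by
  ext j k
  rw [gam_apply, cub_rot hR, act_eq]; rfl

lemma gam_rot' {R : Matrix (Fin 3) (Fin 3) ℂ} (hR : IsRotation R) (D : Ten) (i : Fin 3) :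
    gam (rot R D) i = R * gamv D (R i) * R.transpose := by
  rw [gam_rot hR, gamv, Matrix.mul_sum, Matrix.sum_mul]
  simp

/-- Equivariance without indices: rotations conjugate the multiplication operators. All
compatibility statements between rotations and translations come from this formula. -/
lemma gamv_rot {R : Matrix (Fin 3) (Fin 3) ℂ} (hR : IsRotation R) (D : Ten) (v : C3) :
    gamv (rot R D) (R.mulVec v) = R * gamv D v * R.transpose := by
  have h : ∀ a, ∑ i, R.mulVec v i * R i a = v a := fun a => by
    have := congrFun (congrArg (fun M => M.mulVec v) hR.transpose_mul) a
    simp only [← Matrix.mulVec_mulVec, Matrix.one_mulVec] at this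
    rw [← this]
    simp [Matrix.mulVec, dotProduct, mul_comm]
  simp only [gamv, gam_rot hR, Finset.smul_sum, smul_smul, Matrix.mul_sum, Matrix.sum_mul,
    Matrix.mul_smul, Matrix.smul_mul]
  rw [Finset.sum_comm]
  refine Finset.sum_congr rfl fun a _ => ?_
  rw [← Finset.sum_smul, h]

lemma conj_mul {R : Matrix (Fin 3) (Fin 3) ℂ} (hR : IsRotation R) (M N : Matrix (Fin 3) (Fin 3) ℂ) :
    (R * M * R.transpose) * (R * N * R.transpose) = R * (M * N) * R.transpose := by
  simp only [Matrix.mul_assoc]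
  rw [← Matrix.mul_assoc R.transpose R, hR.transpose_mul, Matrix.one_mul]

lemma gamv_commute {D : Ten} (hD : D ∈ variety) (v w : C3) :
    gamv D v * gamv D w = gamv D w * gamv D v := by
  rw [mem_variety_iff] at hD
  simp only [gamv]
  exact Commute.sum_left _ _ _ fun a _ => Commute.sum_right _ _ _ fun b _ =>
    ((show Commute _ _ from hD a b).smul_left _).smul_right _

theorem rot_mem_variety {R : Matrix (Fin 3) (Fin 3) ℂ} (hR : IsRotation R) {D : Ten}
    (hD : D ∈ variety) : rot R D ∈ variety := by
  rw [mem_variety_iff]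
  intro i l
  rw [gam_rot' hR, gam_rot' hR, conj_mul hR, conj_mul hR, gamv_commute hD]

theorem rot_one (D : Ten) : rot 1 D = D := by
  apply gam_injective
  intro i
  rw [gam_rot IsRotation.one]
  simp [Matrix.one_apply]

theorem rot_isLinearMap (R : Matrix (Fin 3) (Fin 3) ℂ) : IsLinearMap ℂ (rot R) := by
  have htA : ∀ (D E : Ten) a b c, tensor (D + E) a b c = tensor D a b c + tensor E a b c := by
    intro D E a b c
    fin_cases a <;> fin_cases b <;> fin_cases c <;> simp [tensor] <;> ring
  have htS : ∀ (s : ℂ) (D : Ten) a b c, tensor (s • D) a b c = s * tensor D a b c := by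
    intro s D a b c
    fin_cases a <;> fin_cases b <;> fin_cases c <;> simp [tensor] <;> ring
  constructor
  · intro D E
    have : act R (tensor (D + E)) = fun i j k => act R (tensor D) i j k + act R (tensor E) i j k := by
      ext i j k; rw [← act_add]; congr 1; ext a b c; exact htA D E a b c
    change tenOfTensor (act R (tensor (D + E))) =
      tenOfTensor (act R (tensor D)) + tenOfTensor (act R (tensor E))
    rw [this]
    ext n; fin_cases n <;> simp [tenOfTensor] <;> ring
  · intro s D
    have : act R (tensor (s • D)) = fun i j k => s * act R (tensor D) i j k := by
      ext i j k
      simp only [act, htS, Finset.mul_sum]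
      refine Finset.sum_congr rfl fun a _ => Finset.sum_congr rfl fun b _ =>
        Finset.sum_congr rfl fun c _ => by ring
    change tenOfTensor (act R (tensor (s • D))) = s • tenOfTensor (act R (tensor D))
    rw [this]
    ext n; fin_cases n <;> simp [tenOfTensor] <;> ring

theorem rot_mul {R S : Matrix (Fin 3) (Fin 3) ℂ} (hR : IsRotation R) (hS : IsRotation S) (D : Ten) :
    rot (R * S) D = rot R (rot S D) := by
  apply gam_injective
  intro i
  rw [gam_rot (hR.mul hS), gam_rot hR]
  simp only [gam_rot hS, Matrix.mul_sum, Matrix.sum_mul, Finset.smul_sum, Matrix.mul_smul,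
    Matrix.smul_mul, smul_smul, Matrix.transpose_mul]
  rw [Finset.sum_comm]
  refine Finset.sum_congr rfl fun a _ => ?_
  rw [← Finset.sum_smul, Matrix.mul_apply]
  simp only [Matrix.mul_assoc]

/-- The product rule for the three factors of R, evaluated at R = 1; orthogonality plays no role. -/
theorem rot_hasDerivAt (R : ℂ → Matrix (Fin 3) (Fin 3) ℂ) (J : Matrix (Fin 3) (Fin 3) ℂ)
    (h0 : R 0 = 1) (hR : ∀ i j, HasDerivAt (fun t => R t i j) (J i j) 0) (D : Ten) :
    HasDerivAt (fun t => rot (R t) D) (rotField J D) 0 := by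
  have key : ∀ i j k, HasDerivAt (fun t => act (R t) (tensor D) i j k)
      (∑ a, (J i a * tensor D a j k + J j a * tensor D i a k + J k a * tensor D i j a)) 0 := by
    intro i j k
    have h : HasDerivAt (fun t => act (R t) (tensor D) i j k) _ 0 :=
      HasDerivAt.fun_sum fun a _ => HasDerivAt.fun_sum fun b _ => HasDerivAt.fun_sum fun c _ =>
        (((hR i a).mul (hR j b)).mul (hR k c)).mul_const (tensor D a b c)
    refine h.congr_deriv ?_
    simp only [h0, Matrix.one_apply, Pi.mul_apply, add_mul, Finset.sum_add_distrib, ite_mul,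
      mul_ite, zero_mul, mul_zero, one_mul, mul_one, Finset.sum_ite_eq, Finset.mem_univ, if_true,
      Finset.sum_ite_irrel, Finset.sum_const_zero]
  rw [hasDerivAt_pi]
  intro n
  change HasDerivAt (fun t => tenOfTensor (act (R t) (tensor D)) n) _ 0
  fin_cases n
  · exact key 0 1 0
  · exact key 0 2 0
  · exact (key 1 1 0).sub (key 0 0 0)
  · exact key 1 2 0
  · exact (key 2 2 0).sub (key 0 0 0)
  · exact key 0 1 1
  · exact (key 1 1 1).sub (key 0 0 1)
  · exact key 1 2 1
  · exact (key 2 2 1).sub (key 0 0 1)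
  · exact (key 2 2 2).sub (key 0 0 2)

/-! ### Square roots and the standard blocks -/

lemma rt_sq (n : ℕ) : rt n ^ 2 = n := by
  rw [rt, ← Complex.ofReal_pow, Real.sq_sqrt (Nat.cast_nonneg n)]; simp

lemma rt_mul (m n : ℕ) : rt (m * n) = rt m * rt n := by
  simp only [rt]; push_cast; rw [Real.sqrt_mul (Nat.cast_nonneg m)]; simp

lemma rt_ne_zero {n : ℕ} (h : n ≠ 0) : rt n ≠ 0 := by
  intro h0; have := rt_sq n; rw [h0] at this; simp at this; exact h (by exact_mod_cast this.symm)

/-- Moves all roots into numerators. After splitting composite radicands, the remaining identities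
are polynomial in the roots of primes and follow from their squares. -/
lemma rt_inv (n : ℕ) : (rt n)⁻¹ = rt n / n := by
  rcases eq_or_ne n 0 with rfl | h
  · simp [rt]
  · have := rt_ne_zero h
    have h' : (n : ℂ) ≠ 0 := by exact_mod_cast h
    field_simp
    rw [rt_sq]

lemma rt_two_sq : rt 2 ^ 2 = 2 := by simpa using rt_sq 2
lemma rt_three_sq : rt 3 ^ 2 = 3 := by simpa using rt_sq 3
lemma rt_five_sq : rt 5 ^ 2 = 5 := by simpa using rt_sq 5
lemma rt_seven_sq : rt 7 ^ 2 = 7 := by simpa using rt_sq 7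

lemma rt_six : rt 6 = rt 2 * rt 3 := rt_mul 2 3
lemma rt_ten : rt 10 = rt 2 * rt 5 := rt_mul 2 5
lemma rt_twelve : rt 12 = 2 * rt 3 := by
  rw [show 12 = 2 * (2 * 3) from rfl, rt_mul, rt_mul, ← mul_assoc, ← sq, rt_two_sq]
lemma rt_fourteen : rt 14 = rt 2 * rt 7 := rt_mul 2 7
lemma rt_fifteen : rt 15 = rt 3 * rt 5 := rt_mul 3 5
lemma rt_twentyone : rt 21 = rt 3 * rt 7 := rt_mul 3 7
lemma rt_twentyeight : rt 28 = 2 * rt 7 := by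
  rw [show 28 = 2 * (2 * 7) from rfl, rt_mul, rt_mul, ← mul_assoc, ← sq, rt_two_sq]
lemma rt_thirtyfive : rt 35 = rt 5 * rt 7 := rt_mul 5 7
lemma rt_fortytwo : rt 42 = rt 2 * rt 3 * rt 7 := by rw [← rt_mul, ← rt_mul]
lemma rt_seventy : rt 70 = rt 2 * rt 5 * rt 7 := by rw [← rt_mul, ← rt_mul]
lemma rt_hundredfive : rt 105 = rt 3 * rt 5 * rt 7 := by rw [← rt_mul, ← rt_mul]
lemma rt_twohundredten : rt 210 = rt 2 * rt 3 * rt 5 * rt 7 := by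
  rw [← rt_mul, ← rt_mul, ← rt_mul]

lemma sqrt_eq_rt {a : ℝ} {n : ℕ} (h : a = n) : ((Real.sqrt a : ℝ) : ℂ) = rt n := by
  rw [h, rt]

/-- The contraction with the sparse matrix is carried out once here, so that the verification of the
weights deals only with explicit components. -/
lemma rotField_plus (D : Ten) : rotField (Complex.I • Jx + Jy) D =
    tenOfTensor fun i j k => Complex.I *
      (![0, tensor D 2 j k, -tensor D 1 j k] i + ![0, tensor D i 2 k, -tensor D i 1 k] j
        + ![0, tensor D i j 2, -tensor D i j 1] k)
      + (![tensor D 2 j k, 0, -tensor D 0 j k] i + ![tensor D i 2 k, 0, -tensor D i 0 k] j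
        + ![tensor D i j 2, 0, -tensor D i j 0] k) := by
  rw [rotField]
  congr 1; ext i j k
  fin_cases i <;> fin_cases j <;> fin_cases k <;>
    simp [Jx, Jy, Fin.sum_univ_three] <;> ring

lemma rotField_minus (D : Ten) : rotField (Complex.I • Jx - Jy) D =
    tenOfTensor fun i j k => Complex.I *
      (![0, tensor D 2 j k, -tensor D 1 j k] i + ![0, tensor D i 2 k, -tensor D i 1 k] j
        + ![0, tensor D i j 2, -tensor D i j 1] k)
      - (![tensor D 2 j k, 0, -tensor D 0 j k] i + ![tensor D i 2 k, 0, -tensor D i 0 k] j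
        + ![tensor D i j 2, 0, -tensor D i j 0] k) := by
  rw [rotField]
  congr 1; ext i j k
  fin_cases i <;> fin_cases j <;> fin_cases k <;>
    simp [Jx, Jy, Fin.sum_univ_three] <;> ring

lemma rotField_three (D : Ten) : rotField (Complex.I • Jz) D =
    tenOfTensor fun i j k => Complex.I *
      (![tensor D 1 j k, -tensor D 0 j k, 0] i + ![tensor D i 1 k, -tensor D i 0 k, 0] j
        + ![tensor D i j 1, -tensor D i j 0, 0] k) := by
  rw [rotField]
  congr 1; ext i j k
  fin_cases i <;> fin_cases j <;> fin_cases k <;>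
    simp [Jz, Fin.sum_univ_three] <;> ring

theorem isStandardBlock_X : IsStandardBlock 1 X := by
  intro D m h1 h2
  rw [rotField_plus, rotField_minus, rotField_three]
  have h1' : -1 ≤ m := h1
  have h2' : m ≤ 1 := h2
  have s0 : ∀ a : ℝ, a = 0 → ((Real.sqrt a : ℝ) : ℂ) = 0 := fun a h => by simp [h]
  have s2 : ∀ a : ℝ, a = 2 → ((Real.sqrt a : ℝ) : ℂ) = rt 2 := fun a h =>
    sqrt_eq_rt (by simpa using h)
  have hI := Complex.I_sq
  have h2' := rt_two_sq
  interval_cases m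
  · rw [s2 _ (by norm_num), s0 _ (by norm_num)]
    simp [X, tenOfTensor, tensor]
    refine ⟨?_, ?_, ?_⟩ <;> grind
  · rw [s2 _ (by norm_num), s2 _ (by norm_num)]
    simp [X, tenOfTensor, tensor]
    refine ⟨?_, ?_, ?_⟩ <;> grind
  · rw [s0 _ (by norm_num), s2 _ (by norm_num)]
    simp [X, tenOfTensor, tensor]
    refine ⟨?_, ?_, ?_⟩ <;> grind

set_option linter.unusedSimpArgs false in
theorem isStandardBlock_Y : IsStandardBlock 3 Y := by
  intro D m h1 h2
  rw [rotField_plus, rotField_minus, rotField_three]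
  have h1' : -3 ≤ m := h1
  have h2' : m ≤ 3 := h2
  have s0 : ∀ a : ℝ, a = 0 → ((Real.sqrt a : ℝ) : ℂ) = 0 := fun a h => by simp [h]
  have s6 : ∀ a : ℝ, a = 6 → ((Real.sqrt a : ℝ) : ℂ) = rt 2 * rt 3 := fun a h => by
    rw [← rt_six]; exact sqrt_eq_rt (by simpa using h)
  have s10 : ∀ a : ℝ, a = 10 → ((Real.sqrt a : ℝ) : ℂ) = rt 2 * rt 5 := fun a h => by
    rw [← rt_ten]; exact sqrt_eq_rt (by simpa using h)
  have s12 : ∀ a : ℝ, a = 12 → ((Real.sqrt a : ℝ) : ℂ) = 2 * rt 3 := fun a h => by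
    rw [← rt_twelve]; exact sqrt_eq_rt (by simpa using h)
  have hI := Complex.I_sq
  have e2 := rt_two_sq
  have e3 := rt_three_sq
  have e5 := rt_five_sq
  interval_cases m
  · rw [s6 _ (by norm_num), s0 _ (by norm_num)]
    simp [Y, tenOfTensor, tensor, div_eq_mul_inv, rt_inv, rt_six]
    refine ⟨?_, ?_, ?_⟩ <;> grind
  · rw [s10 _ (by norm_num), s6 _ (by norm_num)]
    simp [Y, tenOfTensor, tensor, div_eq_mul_inv, rt_inv, rt_six]
    refine ⟨?_, ?_, ?_⟩ <;> grind
  · rw [s12 _ (by norm_num), s10 _ (by norm_num)]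
    simp [Y, tenOfTensor, tensor, div_eq_mul_inv, rt_inv, rt_six]
    refine ⟨?_, ?_, ?_⟩ <;> grind
  · rw [s12 _ (by norm_num), s12 _ (by norm_num)]
    simp [Y, tenOfTensor, tensor, div_eq_mul_inv, rt_inv, rt_six]
    refine ⟨?_, ?_, ?_⟩ <;> grind
  · rw [s10 _ (by norm_num), s12 _ (by norm_num)]
    simp [Y, tenOfTensor, tensor, div_eq_mul_inv, rt_inv, rt_six]
    refine ⟨?_, ?_, ?_⟩ <;> grind
  · rw [s6 _ (by norm_num), s10 _ (by norm_num)]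
    simp [Y, tenOfTensor, tensor, div_eq_mul_inv, rt_inv, rt_six]
    refine ⟨?_, ?_, ?_⟩ <;> grind
  · rw [s0 _ (by norm_num), s6 _ (by norm_num)]
    simp [Y, tenOfTensor, tensor, div_eq_mul_inv, rt_inv, rt_six]
    refine ⟨?_, ?_, ?_⟩ <;> grind

/-! ### Ten-tuples with prescribed block components. -/

lemma X_ofXY (x y : ℤ → ℂ) : X (ofXY x y) 1 = x 1 ∧ X (ofXY x y) 0 = x 0 ∧
    X (ofXY x y) (-1) = x (-1) := by
  have hI := Complex.I_sq
  have e2 := rt_two_sq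
  refine ⟨?_, ?_, ?_⟩ <;>
    simp [X, ofXY, div_eq_mul_inv, rt_inv] <;> grind

lemma Y_ofXY (x y : ℤ → ℂ) : Y (ofXY x y) 3 = y 3 ∧ Y (ofXY x y) 2 = y 2 ∧
    Y (ofXY x y) 1 = y 1 ∧ Y (ofXY x y) 0 = y 0 ∧
    Y (ofXY x y) (-1) = y (-1) ∧ Y (ofXY x y) (-2) = y (-2) ∧ Y (ofXY x y) (-3) = y (-3) := by
  have hI := Complex.I_sq
  have e2 := rt_two_sq
  have e3 := rt_three_sq
  have e5 := rt_five_sq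
  refine ⟨?_, ?_, ?_, ?_, ?_, ?_, ?_⟩ <;>
    simp [Y, ofXY, div_eq_mul_inv, rt_inv, rt_six] <;> grind

/-- For |m| > 1 both sides are zero by the default branches of the definitions; the last two
patterns cover these weights. -/
theorem X_transField (v : C3) (D : Ten) : ∀ m, X (transField v D) m = transX v D m
  | 1 => (X_ofXY _ _).1
  | 0 => (X_ofXY _ _).2.1
  | -1 => (X_ofXY _ _).2.2
  | Int.ofNat (n + 2) => by
    change 0 = v 0 * ((0 - 0) / 2) + v 1 * ((0 + 0) / (2 * Complex.I)) + v 2 * 0; simp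
  | Int.negSucc (n + 1) => by
    change 0 = v 0 * ((0 - 0) / 2) + v 1 * ((0 + 0) / (2 * Complex.I)) + v 2 * 0; simp

theorem Y_transField (v : C3) (D : Ten) : ∀ m, Y (transField v D) m = transY v D m
  | 3 => (Y_ofXY _ _).1
  | 2 => (Y_ofXY _ _).2.1
  | 1 => (Y_ofXY _ _).2.2.1
  | 0 => (Y_ofXY _ _).2.2.2.1
  | -1 => (Y_ofXY _ _).2.2.2.2.1
  | -2 => (Y_ofXY _ _).2.2.2.2.2.1
  | -3 => (Y_ofXY _ _).2.2.2.2.2.2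
  | Int.ofNat (n + 4) => by
    change 0 = v 0 * ((0 - 0) / 2) + v 1 * ((0 + 0) / (2 * Complex.I)) + v 2 * 0; simp
  | Int.negSucc (n + 3) => by
    change 0 = v 0 * ((0 - 0) / 2) + v 1 * ((0 + 0) / (2 * Complex.I)) + v 2 * 0; simp

/-! ### The translation field as a quadratic expression in the symmetric tensor. -/

/-- The contraction `∑ₘ Gₗᵢₘ Hₘⱼₖ`. -/
def contr (D E : Ten) (l i j k : Fin 3) : ℂ := ∑ m, cub D l i m * cub E m j k

/-- The Ricci-type contraction of the commutators. -/
def ricci (D E : Ten) (i j : Fin 3) : ℂ := ∑ k, comm D E k i j k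

def ricciScalar (D E : Ten) : ℂ := ∑ i, ricci D E i i

/-- The bilinear form of the quartic tensor of the translation field. -/
def transTensor (D E : Ten) (l i j k : Fin 3) : ℂ :=
  1 / 9 * (contr D E l i j k + contr D E l j i k + contr D E l k i j)
    -- The coefficients 13/63 and 16/105 are those that match the prescribed blocks Z⁽¹⁾, Z⁽⁵ˣ⁾,
    -- Z⁽⁹ʸ⁾ for every ten-tuple. For D = E on the variety the terms that carry them vanish.
    + 13 / 63 * ((if l = i then ricci D E j k else 0) + (if l = j then ricci D E i k else 0)
      + (if l = k then ricci D E i j else 0) + (if i = j then ricci D E l k else 0)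
      + (if i = k then ricci D E l j else 0) + (if j = k then ricci D E l i else 0))
    - 16 / 105 * ricciScalar D E * ((if l = i ∧ j = k then 1 else 0)
      + (if l = j ∧ i = k then 1 else 0) + (if l = k ∧ i = j then 1 else 0))

/-- The components `Xₘ`, `Yₘ` without their irrational factors. -/
def xr (D : Ten) : ℤ → ℂ
  | 0 => -(C33 D + 2 * A13 D + B23 D)
  | m => X D m

def yr (D : Ten) : ℤ → ℂ
  | 2 => A13 D - B23 D + 2 * Complex.I * A23 D
  | 1 => 3 * A22 D - 2 * B12 D - 4 * A33 D + Complex.I * (B22 D - 2 * A12 D - 4 * B33 D)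
  | 0 => 2 * C33 D - A13 D - 3 * B23 D
  | -1 => 2 * B12 D + 4 * A33 D - 3 * A22 D + Complex.I * (B22 D - 2 * A12 D - 4 * B33 D)
  | -2 => A13 D - B23 D - 2 * Complex.I * A23 D
  | m => Y D m

/-- The components `Z⁽⁵ˣ⁾ₘ` without their irrational factors. -/
def z5r (D : Ten) : ℤ → ℂ
  | 2 => 5 * (3 / 5 * yr D 1 ^ 2 - 4 * yr D 0 * yr D 2 + yr D (-1) * yr D 3) + 2 * xr D 1 ^ 2
  | 1 => 5 * (2 / 5 * yr D 0 * yr D 1 - 3 * yr D (-1) * yr D 2 + 5 * yr D (-2) * yr D 3)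
      + 4 * xr D 0 * xr D 1
  | 0 => 5 * (8 / 5 * yr D 0 ^ 2 - 9 / 5 * yr D (-1) * yr D 1 + 5 * yr D (-3) * yr D 3)
      + 8 * xr D 0 ^ 2 + 4 * xr D (-1) * xr D 1
  | -1 => 5 * (2 / 5 * yr D 0 * yr D (-1) - 3 * yr D 1 * yr D (-2) + 5 * yr D 2 * yr D (-3))
      + 4 * xr D 0 * xr D (-1)
  | -2 => 5 * (3 / 5 * yr D (-1) ^ 2 - 4 * yr D 0 * yr D (-2) + yr D 1 * yr D (-3))
      + 2 * xr D (-1) ^ 2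
  | _ => 0

/-- The components `Z⁽⁹ʸ⁾ₘ` without their irrational factors. -/
def z9r (D : Ten) : ℤ → ℂ
  | 4 => 24 * (xr D 1 * yr D 3) - 5 * (6 * yr D 2 ^ 2 - 6 / 5 * yr D 1 * yr D 3)
  | 3 => 24 * (1 / 2 * xr D 0 * yr D 3 + 3 / 2 * xr D 1 * yr D 2)
      - 6 * (yr D 1 * yr D 2 - yr D 0 * yr D 3)
  | 2 => 24 * (1 / 2 * xr D (-1) * yr D 3 + 6 * xr D 0 * yr D 2 + 3 / 2 * xr D 1 * yr D 1)
      - (6 * yr D 1 ^ 2 - 12 * yr D 0 * yr D 2 - 18 * yr D (-1) * yr D 3)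
  | 1 => 24 * (3 / 2 * xr D (-1) * yr D 2 + 3 / 2 * xr D 0 * yr D 1 + xr D 1 * yr D 0)
      - (6 * yr D 0 * yr D 1 - 24 * yr D (-1) * yr D 2 - 30 * yr D (-2) * yr D 3)
  | 0 => 24 * (3 / 2 * xr D (-1) * yr D 1 + 4 * xr D 0 * yr D 0 + 3 / 2 * xr D 1 * yr D (-1))
      - (12 * yr D 0 ^ 2 - 3 * yr D (-1) * yr D 1 - 210 * yr D (-2) * yr D 2
        - 15 * yr D (-3) * yr D 3)
  | -1 => 24 * (3 / 2 * xr D 1 * yr D (-2) + 3 / 2 * xr D 0 * yr D (-1) + xr D (-1) * yr D 0)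
      - (6 * yr D 0 * yr D (-1) - 24 * yr D 1 * yr D (-2) - 30 * yr D 2 * yr D (-3))
  | -2 => 24 * (1 / 2 * xr D 1 * yr D (-3) + 6 * xr D 0 * yr D (-2) + 3 / 2 * xr D (-1) * yr D (-1))
      - (6 * yr D (-1) ^ 2 - 12 * yr D 0 * yr D (-2) - 18 * yr D 1 * yr D (-3))
  | -3 => 24 * (1 / 2 * xr D 0 * yr D (-3) + 3 / 2 * xr D (-1) * yr D (-2))
      - 6 * (yr D (-1) * yr D (-2) - yr D 0 * yr D (-3))
  | -4 => 24 * (xr D (-1) * yr D (-3)) - 5 * (6 * yr D (-2) ^ 2 - 6 / 5 * yr D (-1) * yr D (-3))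
  | _ => 0

lemma X_eq_xr (D : Ten) : X D 1 = xr D 1 ∧ X D 0 = rt 2 * xr D 0 ∧ X D (-1) = xr D (-1) :=
  ⟨rfl, by simp only [X, xr]; ring, rfl⟩

lemma Y_eq_yr (D : Ten) : Y D 3 = yr D 3 ∧ Y D 2 = rt 6 * yr D 2 ∧ Y D 1 = rt 3 / rt 5 * yr D 1 ∧
    Y D 0 = 2 / rt 5 * yr D 0 ∧ Y D (-1) = rt 3 / rt 5 * yr D (-1) ∧ Y D (-2) = rt 6 * yr D (-2) ∧
    Y D (-3) = yr D (-3) :=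
  ⟨rfl, rfl, rfl, rfl, rfl, rfl, rfl⟩

/-- Each component is one root factor times a polynomial with rational coefficients in `xr`, `yr`.
Splitting off these factors reduces `transField_eq` to an identity over ℚ(i). -/
lemma Z5X_eq (D : Ten) : Z5X D 2 = z5r D 2 ∧ Z5X D 1 = z5r D 1 ∧ Z5X D 0 = z5r D 0 / rt 6 ∧
    Z5X D (-1) = z5r D (-1) ∧ Z5X D (-2) = z5r D (-2) := by
  have e2 := rt_two_sq
  have e3 := rt_three_sq
  have e5 := rt_five_sq
  obtain ⟨x1, x0, xm⟩ := X_eq_xr D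
  obtain ⟨y3, y2, y1, y0, ym1, ym2, ym3⟩ := Y_eq_yr D
  refine ⟨?_, ?_, ?_, ?_, ?_⟩ <;>
    simp only [Z5X, Z5a, Z5b, x1, x0, xm, y3, y2, y1, y0, ym1, ym2, ym3, z5r, div_eq_mul_inv,
      mul_inv, rt_inv, rt_six, rt_ten, Nat.cast_ofNat] <;> grind

lemma Z1a_eq (D : Ten) : Z1a D = 2 * xr D 0 ^ 2 - 2 * xr D (-1) * xr D 1 := by
  have e2 := rt_two_sq
  obtain ⟨x1, x0, xm⟩ := X_eq_xr D
  rw [Z1a, x1, x0, xm]; grind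

lemma Z9Y_eq (D : Ten) : Z9Y D 4 = z9r D 4 ∧ Z9Y D 3 = rt 2 * z9r D 3 ∧ Z9Y D 2 = z9r D 2 / rt 7 ∧
    Z9Y D 1 = rt 2 / rt 7 * z9r D 1 ∧ Z9Y D 0 = rt 2 / rt 35 * z9r D 0 ∧
    Z9Y D (-1) = rt 2 / rt 7 * z9r D (-1) ∧ Z9Y D (-2) = z9r D (-2) / rt 7 ∧
    Z9Y D (-3) = rt 2 * z9r D (-3) ∧ Z9Y D (-4) = z9r D (-4) := by
  have e2 := rt_two_sq
  have e3 := rt_three_sq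
  have e5 := rt_five_sq
  have e7 := rt_seven_sq
  obtain ⟨x1, x0, xm⟩ := X_eq_xr D
  obtain ⟨y3, y2, y1, y0, ym1, ym2, ym3⟩ := Y_eq_yr D
  refine ⟨?_, ?_, ?_, ?_, ?_, ?_, ?_, ?_, ?_⟩ <;>
    simp only [Z9Y, Z9a, Z9b, x1, x0, xm, y3, y2, y1, y0, ym1, ym2, ym3, z9r, div_eq_mul_inv,
      mul_inv, rt_inv, rt_six, rt_fourteen, rt_fifteen, rt_twentyeight, rt_thirtyfive,
      Nat.cast_ofNat] <;> grind


lemma dX_eq (D : Ten) : (dpX D 1 = z5r D 2 / 30 ∧ dpX D 0 = rt 2 * (z5r D 1 / 60) ∧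
      dpX D (-1) = z5r D 0 / 180 - Z1a D / 9) ∧
    (dmX D 1 = z5r D 0 / 180 - Z1a D / 9 ∧ dmX D 0 = rt 2 * (z5r D (-1) / 60) ∧
      dmX D (-1) = z5r D (-2) / 30) ∧
    (dzX D 1 = -z5r D 1 / 60 ∧ dzX D 0 = rt 2 * (-z5r D 0 / 180 - Z1a D / 18) ∧
      dzX D (-1) = -z5r D (-1) / 60) := by
  have e2 := rt_two_sq
  have e3 := rt_three_sq
  obtain ⟨z2, z1, z0, zm1, zm2⟩ := Z5X_eq D
  refine ⟨⟨?_, ?_, ?_⟩, ⟨?_, ?_, ?_⟩, ⟨?_, ?_, ?_⟩⟩ <;>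
    simp only [dpX, dmX, dzX, z2, z1, z0, zm1, zm2, div_eq_mul_inv, mul_inv, rt_inv, rt_six,
      Nat.cast_ofNat] <;> grind

set_option linter.unusedSimpArgs false in
lemma dpY_eq (D : Ten) : dpY D 3 = z9r D 4 / 90 ∧ dpY D 2 = rt 6 * (z9r D 3 / 180) ∧
    dpY D 1 = rt 3 / rt 5 * (z9r D 2 / 252 + z5r D 2 / 105) ∧
    dpY D 0 = 2 / rt 5 * (z9r D 1 / 252 + z5r D 1 / 70) ∧
    dpY D (-1) = rt 3 / rt 5 * (z9r D 0 / 630 + z5r D 0 / 105) ∧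
    dpY D (-2) = rt 6 * (z9r D (-1) / 1260 + z5r D (-1) / 105) ∧
    dpY D (-3) = z9r D (-2) / 1260 + z5r D (-2) / 35 := by
  have e2 := rt_two_sq
  have e3 := rt_three_sq
  have e5 := rt_five_sq
  have e7 := rt_seven_sq
  obtain ⟨z2, z1, z0, zm1, zm2⟩ := Z5X_eq D
  obtain ⟨w4, w3, w2, w1, w0, wm1, wm2, wm3, wm4⟩ := Z9Y_eq D
  refine ⟨?_, ?_, ?_, ?_, ?_, ?_, ?_⟩ <;>
    simp only [dpY, z2, z1, z0, zm1, zm2, w4, w3, w2, w1, w0, wm1, wm2, wm3, wm4, div_eq_mul_inv,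
      mul_inv, rt_inv, rt_six, rt_fifteen, rt_twentyone, rt_thirtyfive, rt_fortytwo, rt_seventy,
      rt_hundredfive, Nat.cast_ofNat] <;> grind

set_option linter.unusedSimpArgs false in
lemma dmY_eq (D : Ten) : dmY D (-3) = z9r D (-4) / 90 ∧ dmY D (-2) = rt 6 * (z9r D (-3) / 180) ∧
    dmY D (-1) = rt 3 / rt 5 * (z9r D (-2) / 252 + z5r D (-2) / 105) ∧
    dmY D 0 = 2 / rt 5 * (z9r D (-1) / 252 + z5r D (-1) / 70) ∧
    dmY D 1 = rt 3 / rt 5 * (z9r D 0 / 630 + z5r D 0 / 105) ∧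
    dmY D 2 = rt 6 * (z9r D 1 / 1260 + z5r D 1 / 105) ∧
    dmY D 3 = z9r D 2 / 1260 + z5r D 2 / 35 := by
  have e2 := rt_two_sq
  have e3 := rt_three_sq
  have e5 := rt_five_sq
  have e7 := rt_seven_sq
  obtain ⟨z2, z1, z0, zm1, zm2⟩ := Z5X_eq D
  obtain ⟨w4, w3, w2, w1, w0, wm1, wm2, wm3, wm4⟩ := Z9Y_eq D
  refine ⟨?_, ?_, ?_, ?_, ?_, ?_, ?_⟩ <;>
    simp only [dmY, z2, z1, z0, zm1, zm2, w4, w3, w2, w1, w0, wm1, wm2, wm3, wm4, div_eq_mul_inv,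
      mul_inv, rt_inv, rt_six, rt_fifteen, rt_twentyone, rt_thirtyfive, rt_fortytwo, rt_seventy,
      rt_hundredfive, Nat.cast_ofNat] <;> grind

set_option linter.unusedSimpArgs false in
lemma dzY_eq (D : Ten) : dzY D 3 = -z9r D 3 / 180 ∧
    dzY D 2 = rt 6 * (-z9r D 2 / 1260 + z5r D 2 / 210) ∧
    dzY D 1 = rt 3 / rt 5 * (-z9r D 1 / 252 + 2 * z5r D 1 / 105) ∧
    dzY D 0 = 2 / rt 5 * (-z9r D 0 / 630 + z5r D 0 / 140) ∧
    dzY D (-1) = rt 3 / rt 5 * (-z9r D (-1) / 252 + 2 * z5r D (-1) / 105) ∧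
    dzY D (-2) = rt 6 * (-z9r D (-2) / 1260 + z5r D (-2) / 210) ∧
    dzY D (-3) = -z9r D (-3) / 180 := by
  have e2 := rt_two_sq
  have e3 := rt_three_sq
  have e5 := rt_five_sq
  have e7 := rt_seven_sq
  obtain ⟨z2, z1, z0, zm1, zm2⟩ := Z5X_eq D
  obtain ⟨w4, w3, w2, w1, w0, wm1, wm2, wm3, wm4⟩ := Z9Y_eq D
  refine ⟨?_, ?_, ?_, ?_, ?_, ?_, ?_⟩ <;>
    simp only [dzY, z2, z1, z0, zm1, zm2, w4, w3, w2, w1, w0, wm1, wm2, wm3, wm4, div_eq_mul_inv,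
      mul_inv, rt_inv, rt_six, rt_ten, rt_fourteen, rt_fifteen, rt_thirtyfive, rt_fortytwo,
      rt_twohundredten, Nat.cast_ofNat] <;> grind

/-- `ofXY` in terms of components without irrational factors. -/
lemma ofXY_eq {x y : ℤ → ℂ} {p c m u₃ u₂ u₁ u₀ w₁ w₂ w₃ : ℂ} (x1 : x 1 = p) (x0 : x 0 = rt 2 * c)
    (xm : x (-1) = m) (y3 : y 3 = u₃) (y2 : y 2 = rt 6 * u₂)
    (y1 : y 1 = rt 3 / rt 5 * u₁) (y0 : y 0 = 2 / rt 5 * u₀)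
    (ym1 : y (-1) = rt 3 / rt 5 * w₁) (ym2 : y (-2) = rt 6 * w₂)
    (ym3 : y (-3) = w₃) :
    ofXY x y =
      let a := -Complex.I / 2 * (p + m)
      let b := (p - m) / 2
      let y₁ := (u₃ - w₃) / 2
      let y₂ := -Complex.I / 2 * (u₃ + w₃)
      let y₄ := (u₂ + w₂) / 2
      let y₅ := (u₁ - w₁) / 2
      let b33 := (y₂ + Complex.I / 2 * (u₁ + w₁)) / 4
      let a12 := (a - b33 - y₂) / 5
      let b12 := (4 * b + 5 * y₁ + y₅) / 20
      let b23 := (-2 * c - u₀ - 5 * y₄) / 10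
      ![a12, y₄ + b23, y₁ - 2 * b12, -Complex.I / 4 * (u₂ - w₂),
        (3 * y₁ - 8 * b12 - y₅) / 4, b12, y₂ + 2 * a12, b23, b33, (u₀ + y₄ + 4 * b23) / 2] := by
  have e2 := rt_ne_zero (n := 2) (by norm_num)
  have e3 := rt_ne_zero (n := 3) (by norm_num)
  have e5 := rt_ne_zero (n := 5) (by norm_num)
  have e6 := rt_ne_zero (n := 6) (by norm_num)
  have hI : ∀ z : ℂ, z / (2 * Complex.I) = -Complex.I / 2 * z := fun z => by
    rw [div_eq_mul_inv, mul_inv, Complex.inv_I]; ring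
  have hc : -(rt 2 * c) / rt 2 = -c := by field_simp
  have y₅ : rt 5 / (2 * rt 3) * (rt 3 / rt 5 * u₁ - rt 3 / rt 5 * w₁)
      = (u₁ - w₁) / 2 := by field_simp
  have y₆ : rt 5 / (2 * Complex.I * rt 3) * (rt 3 / rt 5 * u₁ + rt 3 / rt 5 * w₁)
      = -Complex.I / 2 * (u₁ + w₁) := by rw [← hI]; field_simp
  have y₃ : (rt 6 * u₂ - rt 6 * w₂) / (2 * Complex.I * rt 6)
      = -Complex.I / 2 * (u₂ - w₂) := by rw [← hI]; field_simp
  have y₄ : (rt 6 * u₂ + rt 6 * w₂) / (2 * rt 6) = (u₂ + w₂) / 2 := by field_simp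
  have y₇ : rt 5 / 2 * (2 / rt 5 * u₀) = u₀ := by field_simp
  simp only [ofXY, x1, x0, xm, y3, y2, y1, y0, ym1, ym2, ym3, hc, y₅, y₆, y₃, y₄, y₇, hI]
  ext n; fin_cases n <;> simp <;> ring

/-- The derivative in the direction `v` in terms of `∂₊`, `∂₋`, `∂_z`. -/
def dirDeriv (v : C3) (a b c : ℂ) : ℂ :=
  v 0 * ((a - b) / 2) + v 1 * (-Complex.I / 2 * (a + b)) + v 2 * c

lemma dirDeriv_mul (v : C3) (k a b c : ℂ) :
    dirDeriv v (k * a) (k * b) (k * c) = k * dirDeriv v a b c := by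
  simp only [dirDeriv]; ring

lemma transX_eq (v : C3) (D : Ten) (m : ℤ) :
    transX v D m = dirDeriv v (dpX D m) (dmX D m) (dzX D m) := by
  simp only [transX, dirDeriv, div_eq_mul_inv, mul_inv, Complex.inv_I]; ring

lemma transY_eq (v : C3) (D : Ten) (m : ℤ) :
    transY v D m = dirDeriv v (dpY D m) (dmY D m) (dzY D m) := by
  simp only [transY, dirDeriv, div_eq_mul_inv, mul_inv, Complex.inv_I]; ring

lemma cub_values (D : Ten) : cub D 0 0 0 = B12 D - A22 D ∧ cub D 0 0 1 = A12 D ∧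
    cub D 0 0 2 = A13 D ∧ cub D 0 1 1 = B12 D ∧ cub D 0 1 2 = A23 D ∧
    cub D 0 2 2 = B12 D - A22 D + A33 D ∧ cub D 1 1 1 = B22 D + A12 D ∧ cub D 1 1 2 = B23 D ∧
    cub D 1 2 2 = A12 D + B33 D ∧ cub D 2 2 2 = C33 D + A13 D := by
  simp [cub, tensor]

-- The bridge from the representation-theoretic formulas to tensors. The root factors cancel between
-- `ofXY` and the derivative relations, and what is left is a polynomial identity in v, in the ten
-- coordinates and in i. It is valid on all of ℂ¹⁰, not only on the variety, and therefore may be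
-- differentiated.
set_option linter.unusedSimpArgs false in
set_option maxHeartbeats 1000000 in
theorem transField_eq (v : C3) (D : Ten) :
    transField v D = tenOfTensor fun i j k => ∑ l, v l * transTensor D D l i j k := by
  obtain ⟨⟨px1, px0, pxm⟩, ⟨mx1, mx0, mxm⟩, ⟨zx1, zx0, zxm⟩⟩ := dX_eq D
  obtain ⟨p3, p2, p1, p0, pm1, pm2, pm3⟩ := dpY_eq D
  obtain ⟨m3, m2, m1, m0, mm1, mm2, mm3⟩ := dmY_eq D
  obtain ⟨z3, z2, z1, z0, zm1, zm2, zm3⟩ := dzY_eq D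
  rw [transField, ofXY_eq (transX_eq v D 1)
    (by rw [transX_eq, px0, mx0, zx0, dirDeriv_mul]) (transX_eq v D (-1)) (transY_eq v D 3)
    (by rw [transY_eq, p2, mm2, z2, dirDeriv_mul]) (by rw [transY_eq, p1, mm1, z1, dirDeriv_mul])
    (by rw [transY_eq, p0, m0, z0, dirDeriv_mul])
    (by rw [transY_eq, pm1, m1, zm1, dirDeriv_mul])
    (by rw [transY_eq, pm2, m2, zm2, dirDeriv_mul]) (transY_eq v D (-3))]
  rw [px1, mx1, zx1, pxm, mxm, zxm, p3, mm3, z3, pm3, m3, zm3]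
  have i2 := Complex.I_sq
  have i3 : Complex.I ^ 3 = -Complex.I := Complex.I_pow_three
  have i4 : Complex.I ^ 4 = 1 := Complex.I_pow_four
  obtain ⟨h0, h1, h2, h3, h4, h5, h6, h7, h8, h9⟩ := cub_values D
  ext n
  fin_cases n <;>
    (simp only [tenOfTensor, transTensor, Fin.sum_univ_three, Matrix.cons_val, Fin.reduceFinMk,
      Fin.reduceEq, Fin.zero_eta, Fin.mk_one, and_self, and_true, and_false, if_true, if_false]
     simp only [contr, ricci, ricciScalar, comm, Matrix.sub_apply, Matrix.mul_apply, gam_apply,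
      Fin.sum_univ_three]
     -- Sorting the indices reduces the entries of the cubic tensor to the ten of `cub_values`.
     simp only [cub_comm₁₂ D 1 0, cub_comm₁₂ D 2 0, cub_comm₁₂ D 2 1, cub_comm₂₃ D _ 1 0,
      cub_comm₂₃ D _ 2 0, cub_comm₂₃ D _ 2 1, h0, h1, h2, h3, h4, h5, h6, h7, h8, h9,
      dirDeriv, z5r, z9r, xr, yr, X, Y, Z1a_eq]
     ring_nf
     try simp only [i2, i3, i4]
     try ring_nf)

/-! ### The translation field on the variety -/

lemma cub_add (D E : Ten) (i j k : Fin 3) : cub (D + E) i j k = cub D i j k + cub E i j k := by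
  fin_cases i <;> fin_cases j <;> fin_cases k <;> simp [cub, tensor] <;> ring

lemma cub_smul (s : ℂ) (D : Ten) (i j k : Fin 3) : cub (s • D) i j k = s * cub D i j k := by
  fin_cases i <;> fin_cases j <;> fin_cases k <;> simp [cub, tensor] <;> ring

lemma gam_add (D E : Ten) (i : Fin 3) : gam (D + E) i = gam D i + gam E i := by
  ext j k; exact cub_add D E i j k

lemma gam_smul (s : ℂ) (D : Ten) (i : Fin 3) : gam (s • D) i = s • gam D i := by
  ext j k; exact cub_smul s D i j k

lemma gam_neg (D : Ten) (i : Fin 3) : gam (-D) i = -gam D i := by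
  rw [← neg_one_smul ℂ D, gam_smul, neg_one_smul]

lemma gam_sub (D E : Ten) (i : Fin 3) : gam (D - E) i = gam D i - gam E i := by
  rw [sub_eq_add_neg, gam_add, gam_neg, sub_eq_add_neg]

lemma contr_eq (D E : Ten) (l i j k : Fin 3) : contr D E l i j k = (gam D l * gam E j) i k := by
  simp only [contr, Matrix.mul_apply, gam_apply]
  exact Finset.sum_congr rfl fun m _ => by rw [cub_comm₁₂ E m j]

lemma contr_eq' (D E : Ten) (l i j k : Fin 3) : contr D E l i j k = (gam D i * gam E j) l k := by
  rw [← contr_eq]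
  simp only [contr]
  exact Finset.sum_congr rfl fun m _ => by rw [cub_comm₁₂ D l i]

lemma contr_swap_right (D E : Ten) (l i j k : Fin 3) :
    contr D E l i j k = contr D E l i k j := by
  simp only [contr]
  exact Finset.sum_congr rfl fun m _ => by rw [cub_comm₂₃ E m j]

lemma transTensor_line (D E : Ten) (t : ℂ) (l i j k : Fin 3) :
    transTensor (D + t • E) (D + t • E) l i j k = transTensor D D l i j k
      + t * (transTensor D E l i j k + transTensor E D l i j k)
      + t ^ 2 * transTensor E E l i j k := by
  have h1 : ∀ a b c d, contr (D + t • E) (D + t • E) a b c d = contr D D a b c d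
      + t * (contr D E a b c d + contr E D a b c d) + t ^ 2 * contr E E a b c d := by
    intro a b c d
    simp only [contr, cub_add, cub_smul, Fin.sum_univ_three]; ring
  have h2 : ∀ a b, ricci (D + t • E) (D + t • E) a b = ricci D D a b
      + t * (ricci D E a b + ricci E D a b) + t ^ 2 * ricci E E a b := by
    intro a b
    simp only [ricci, comm, gam_add, gam_smul, Matrix.mul_apply, Matrix.sub_apply,
      Matrix.add_apply, Matrix.smul_apply, smul_eq_mul, Fin.sum_univ_three]
    ring
  have h3 : ricciScalar (D + t • E) (D + t • E) = ricciScalar D D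
      + t * (ricciScalar D E + ricciScalar E D) + t ^ 2 * ricciScalar E E := by
    simp only [ricciScalar, h2, Fin.sum_univ_three]; ring
  have h4 : ∀ (P : Prop) [Decidable P] (a : ℂ), (if P then a else 0) = (if P then 1 else 0) * a := by
    intro P _ a; simp
  simp only [transTensor, h1, h2, h3]
  simp only [h4 _ (ricci _ _ _ _ + _ + _), h4 _ (ricci _ _ _ _)]
  ring

lemma tenOfTensor_line (T T' T'' : Fin 3 → Fin 3 → Fin 3 → ℂ) (t : ℂ) :
    tenOfTensor (fun i j k => T i j k + t * T' i j k + t ^ 2 * T'' i j k)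
      = tenOfTensor T + t • tenOfTensor T' + t ^ 2 • tenOfTensor T'' := by
  ext n; fin_cases n <;> simp [tenOfTensor] <;> ring

/-- The derivative of the translation field. -/
def transBil (v : C3) (D E : Ten) : Ten :=
  tenOfTensor fun i j k => ∑ l, v l * (transTensor D E l i j k + transTensor E D l i j k)

lemma transField_line (v : C3) (D E : Ten) (t : ℂ) :
    transField v (D + t • E) = transField v D + t • transBil v D E + t ^ 2 • transField v E := by
  simp only [transField_eq, transBil]
  rw [← tenOfTensor_line]
  congr 1; ext i j k
  simp only [transTensor_line, Fin.sum_univ_three]; ring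

/-- The derivative of a quadratic map is the coefficient of t on a line. This is applied to the
translation field and to the quadrics. -/
lemma fderiv_apply_of_line {F : Type*} [NormedAddCommGroup F] [NormedSpace ℂ F] {f : Ten → F}
    {D E : Ten} (hf : DifferentiableAt ℂ f D) {b c : F}
    (h : ∀ t : ℂ, f (D + t • E) = f D + t • b + t ^ 2 • c) : fderiv ℂ f D E = b := by
  have h1 : HasDerivAt (fun t : ℂ => f (D + t • E)) (fderiv ℂ f D E) 0 := by
    have hl : HasDerivAt (fun t : ℂ => D + t • E) E 0 := by
      simpa using ((hasDerivAt_id (0 : ℂ)).smul_const E).const_add D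
    have hf' : HasFDerivAt f (fderiv ℂ f D) (D + (0 : ℂ) • E) := by simpa using hf.hasFDerivAt
    exact hf'.comp_hasDerivAt 0 hl
  have h2 : HasDerivAt (fun t : ℂ => f (D + t • E)) b 0 := by
    simp only [h]
    have h3 := ((hasDerivAt_id (0 : ℂ)).smul_const b).const_add (f D)
    have h4 := ((hasDerivAt_pow 2 (0 : ℂ)).smul_const c)
    simpa [Pi.add_def] using h3.add h4
  exact h1.unique h2

lemma contDiff_cub (i j k : Fin 3) {n : WithTop ℕ∞} : ContDiff ℂ n fun D : Ten => cub D i j k := by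
  have : IsLinearMap ℂ fun D : Ten => cub D i j k :=
    ⟨fun D E => cub_add D E i j k, fun s D => cub_smul s D i j k⟩
  exact (LinearMap.toContinuousLinearMap this.mk').contDiff

lemma contDiff_transTensor (l i j k : Fin 3) {n : WithTop ℕ∞} :
    ContDiff ℂ n fun D : Ten => transTensor D D l i j k := by
  have h1 : ∀ a b c d, ContDiff ℂ n fun D : Ten => contr D D a b c d := fun a b c d =>
    ContDiff.sum fun m _ => (contDiff_cub _ _ _).mul (contDiff_cub _ _ _)
  have h2 : ∀ a b, ContDiff ℂ n fun D : Ten => ricci D D a b := by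
    intro a b
    simp only [ricci, comm, Matrix.sub_apply, Matrix.mul_apply, gam_apply]
    exact ContDiff.sum fun m _ => (ContDiff.sum fun _ _ =>
      (contDiff_cub _ _ _).mul (contDiff_cub _ _ _)).sub (ContDiff.sum fun _ _ =>
      (contDiff_cub _ _ _).mul (contDiff_cub _ _ _))
  have h3 : ContDiff ℂ n fun D : Ten => ricciScalar D D := ContDiff.sum fun i _ => h2 i i
  have h4 : ∀ (P : Prop) [Decidable P] a b,
      ContDiff ℂ n fun D : Ten => if P then ricci D D a b else 0 := by
    intro P _ a b; split_ifs
    · exact h2 a b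
    · exact contDiff_const
  simp only [transTensor]
  exact ((contDiff_const.mul (((h1 _ _ _ _).add (h1 _ _ _ _)).add (h1 _ _ _ _))).add
    (contDiff_const.mul ((((((h4 _ _ _).add (h4 _ _ _)).add (h4 _ _ _)).add (h4 _ _ _)).add
      (h4 _ _ _)).add (h4 _ _ _)))).sub ((contDiff_const.mul h3).mul contDiff_const)

lemma contDiff_tenOfTensor {E : Type*} [NormedAddCommGroup E] [NormedSpace ℂ E] {n : WithTop ℕ∞}
    {T : E → Fin 3 → Fin 3 → Fin 3 → ℂ} (h : ∀ i j k, ContDiff ℂ n fun x => T x i j k) :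
    ContDiff ℂ n fun x => tenOfTensor (T x) := by
  rw [contDiff_pi]
  intro m
  fin_cases m
  · exact h 0 1 0
  · exact h 0 2 0
  · exact (h 1 1 0).sub (h 0 0 0)
  · exact h 1 2 0
  · exact (h 2 2 0).sub (h 0 0 0)
  · exact h 0 1 1
  · exact (h 1 1 1).sub (h 0 0 1)
  · exact h 1 2 1
  · exact (h 2 2 1).sub (h 0 0 1)
  · exact (h 2 2 2).sub (h 0 0 2)

theorem contDiff_transField (v : C3) {n : WithTop ℕ∞} : ContDiff ℂ n (transField v) := by
  simp only [funext (transField_eq v)]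
  exact contDiff_tenOfTensor fun i j k => ContDiff.sum fun l _ =>
    contDiff_const.mul (contDiff_transTensor l i j k)

lemma fderiv_transField (v : C3) (D E : Ten) :
    fderiv ℂ (transField v) D E = transBil v D E :=
  fderiv_apply_of_line ((contDiff_transField v (n := 1)).differentiable (by simp) D)
    (transField_line v D E)

/-- The infinitesimal commutation relations: `E` is tangent to the variety at `D`. -/
def IsTangent (D E : Ten) : Prop := ∀ i l, comm D E i l + comm E D i l = 0

/-- The quadrics are linear in the commutators, so their derivative is linear in the polarized
commutators, which `IsTangent` makes zero. -/
lemma fderiv_quadric_of_isTangent {D E : Ten} (h : IsTangent D E) : fderiv ℂ quadric D E = 0 := by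
  have hd : DifferentiableAt ℂ quadric D := by
    rw [differentiableAt_pi]
    intro k
    have : ∀ i l j m, Differentiable ℂ fun D : Ten => comm D D i l j m := by
      intro i l j m
      simp only [comm, Matrix.sub_apply, Matrix.mul_apply, gam_apply]
      have hc : ∀ i j k, Differentiable ℂ fun D : Ten => cub D i j k := fun i j k =>
        (contDiff_cub i j k (n := 1)).differentiable (by simp)
      exact (Differentiable.fun_sum fun _ _ => (hc _ _ _).mul (hc _ _ _)).sub
        (Differentiable.fun_sum fun _ _ => (hc _ _ _).mul (hc _ _ _))
    simp only [quadric_eq]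
    fin_cases k
    · exact (this 0 1 1 2).neg D
    · exact ((this 0 1 0 1).sub (this 0 2 0 2)) D
    · exact ((this 1 2 1 2).sub (this 0 1 0 1)) D
    · exact this 0 1 0 2 D
    · exact this 0 2 1 2 D
    · exact (((this 0 1 0 1).add (this 0 2 0 2)).add (this 1 2 1 2)) D
  refine fderiv_apply_of_line hd (c := quadric E) fun t => ?_
  have key : ∀ i l, comm (D + t • E) (D + t • E) i l
      = comm D D i l + t ^ 2 • comm E E i l := by
    intro i l
    have := h i l
    simp only [comm, gam_add, gam_smul, add_mul, mul_add, smul_mul_assoc, mul_smul_comm,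
      smul_sub] at this ⊢
    rw [← sub_eq_zero]
    calc _ = t • (gam D i * gam E l - gam E l * gam D i
        + (gam E i * gam D l - gam D l * gam E i)) := by module
      _ = 0 := by rw [this, smul_zero]
  simp only [quadric_eq]
  ext k
  fin_cases k <;> simp [quadricOfComm, key] <;> ring

lemma isTangent_self {D : Ten} (hD : D ∈ variety) : IsTangent D D := by
  intro i l; simp [comm, mem_variety_iff.mp hD i l]

lemma IsTangent.mul_eq {D E : Ten} (h : IsTangent D E) (i l : Fin 3) :
    gam D i * gam E l + gam E i * gam D l = gam E l * gam D i + gam D l * gam E i := by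
  have := h i l
  simp only [comm] at this
  rw [← sub_eq_zero, ← this]; abel

lemma IsTangent.contr_swap {D E : Ten} (h : IsTangent D E) (l i j k : Fin 3) :
    contr D E l i j k + contr E D l i j k = contr D E l j i k + contr E D l j i k := by
  have := congrFun (congrFun (h.mul_eq i j) l) k
  simp only [Matrix.add_apply, ← contr_eq'] at this
  rw [this, add_comm]

/-- The Ricci-type terms are traces of polarized commutators and drop out. By `IsTangent.contr_swap`
the three remaining contractions agree, and 3 · 1/9 = 1/3. -/
lemma IsTangent.transTensor {D E : Ten} (h : IsTangent D E) (l i j k : Fin 3) :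
    transTensor D E l i j k + transTensor E D l i j k
      = 1 / 3 * (contr D E l i j k + contr E D l i j k) := by
  have h1 : ∀ a b, ricci D E a b + ricci E D a b = 0 := by
    intro a b
    simp only [ricci, ← Finset.sum_add_distrib, ← Matrix.add_apply, h _ _, Matrix.zero_apply,
      Finset.sum_const_zero]
  have h2 : ∀ a b, ricci E D a b = -ricci D E a b := fun a b => by linear_combination h1 a b
  have h3 : ricciScalar E D = -ricciScalar D E := by simp [ricciScalar, h2]
  have h4 : ∀ (P : Prop) [Decidable P] (a : ℂ), (if P then -a else 0) = -(if P then a else 0) := by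
    intro P _ a; split_ifs <;> simp
  have h5 := h.contr_swap l i j k
  have h6 : contr D E l i j k + contr E D l i j k = contr D E l k i j + contr E D l k i j := by
    rw [contr_swap_right D E l i, contr_swap_right E D l i]; exact h.contr_swap l i k j
  simp only [Superintegrable.transTensor, h2, h3, h4]
  linear_combination -1 / 9 * h5 - 1 / 9 * h6

lemma IsTangent.gam_transBil {D E : Ten} (h : IsTangent D E) (v : C3) (i : Fin 3) :
    gam (transBil v D E) i = (1 / 3 : ℂ) • (gamv D v * gam E i + gamv E v * gam D i) := by
  simp only [transBil, h.transTensor]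
  rw [gam_tenOfTensor]
  · ext j k
    rw [Matrix.of_apply]
    simp only [gamv, Matrix.sum_mul, Matrix.smul_apply, Matrix.add_apply, Matrix.sum_apply,
      Matrix.smul_mul, ← contr_eq, smul_eq_mul, ← Finset.sum_add_distrib, Finset.mul_sum]
    refine Finset.sum_congr rfl fun l _ => ?_
    linear_combination v l / 3 * h.contr_swap l i j k
  · intro i j k
    exact Finset.sum_congr rfl fun l _ => by rw [h.contr_swap]
  · intro i j k
    exact Finset.sum_congr rfl fun l _ => by
      rw [contr_swap_right D E l i j, contr_swap_right E D l i j]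

lemma transBil_self (v : C3) (D : Ten) : transBil v D D = (2 : ℂ) • transField v D := by
  rw [transField_eq, transBil]
  ext n; fin_cases n <;> simp [tenOfTensor, Fin.sum_univ_three] <;> ring

/-- The central formula ∂_v Gᵢ = ⅓ G_v Gᵢ. By homogeneity of the quadrics D is tangent to the
variety at D, so the formula for the polarized field applies with E = D and is halved. -/
theorem gam_transField_of_mem {D : Ten} (hD : D ∈ variety) (v : C3) (i : Fin 3) :
    gam (transField v D) i = (1 / 3 : ℂ) • (gamv D v * gam D i) := by
  have h := (isTangent_self hD).gam_transBil v i
  rw [transBil_self, gam_smul] at h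
  have : gam (transField v D) i = (1 / 2 : ℂ) • ((2 : ℂ) • gam (transField v D) i) := by module
  rw [this, h]; module

/-! ### Infinitesimal rotations -/

/-- Infinitesimal form of `rot_eq`: for antisymmetric J the contributions of J to the first two
indices of δᵢⱼ uₖ cancel, and a diagonal term remains. -/
lemma rotField_eq {J : Matrix (Fin 3) (Fin 3) ℂ} (hJ : J.transpose = -J) (D : Ten) :
    rotField J D = tenOfTensor fun i j k =>
      ∑ a, (J i a * cub D a j k + J j a * cub D i a k + J k a * cub D i j a) := by
  have hJ' : ∀ i j, J i j = -J j i := fun i j => by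
    have := congrFun (congrFun hJ j) i; simpa using this
  rw [rotField, ← tenOfTensor_add_diag _ (J.mulVec ![B12 D - A22 D, A12 D, A13 D])]
  congr 1; ext i j k
  simp only [cub, mul_add, Finset.sum_add_distrib, mul_ite, mul_zero, Finset.sum_ite_eq,
    Finset.sum_ite_eq', Finset.mem_univ, if_true, Finset.sum_ite_irrel, Finset.sum_const_zero,
    Matrix.mulVec, dotProduct]
  rw [hJ' i j]
  ring

theorem gam_rotField {J : Matrix (Fin 3) (Fin 3) ℂ} (hJ : J.transpose = -J) (D : Ten) (i : Fin 3) :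
    gam (rotField J D) i = gamv D (J i) + (J * gam D i - gam D i * J) := by
  have hJ' : ∀ i j, J i j = -J j i := fun i j => by
    have := congrFun (congrFun hJ j) i; simpa using this
  rw [rotField_eq hJ, gam_tenOfTensor]
  · ext j k
    simp only [Matrix.of_apply, gamv, Matrix.add_apply, Matrix.sum_apply, Matrix.sub_apply,
      Matrix.smul_apply, Matrix.mul_apply, gam_apply, smul_eq_mul, ← Finset.sum_sub_distrib,
      ← Finset.sum_add_distrib]
    exact Finset.sum_congr rfl fun a _ => by rw [hJ' a k]; ring
  · intro i j k
    refine Finset.sum_congr rfl fun a _ => ?_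
    rw [cub_comm₁₂ D a j, cub_comm₁₂ D i a, cub_comm₁₂ D i j]; ring
  · intro i j k
    refine Finset.sum_congr rfl fun a _ => ?_
    rw [cub_comm₂₃ D a j, cub_comm₂₃ D i a, cub_comm₂₃ D i j]; ring

lemma gamv_add (D : Ten) (v w : C3) : gamv D (v + w) = gamv D v + gamv D w := by
  simp [gamv, add_smul, Finset.sum_add_distrib]

lemma gamv_smul (D : Ten) (s : ℂ) (v : C3) : gamv D (s • v) = s • gamv D v := by
  simp [gamv, mul_smul, Finset.smul_sum]

lemma gam_eq_gamv (D : Ten) (i : Fin 3) : gam D i = gamv D (Pi.single i 1) := by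
  simp [gamv, Pi.single_apply]

/-- The derivative of `gamv_rot` with v held fixed: the commutator comes from the conjugation, and
the term with -Jv from moving the argument back. -/
lemma gamv_rotField {J : Matrix (Fin 3) (Fin 3) ℂ} (hJ : J.transpose = -J) (D : Ten) (v : C3) :
    gamv (rotField J D) v = -gamv D (J.mulVec v) + (J * gamv D v - gamv D v * J) := by
  have hJ' : ∀ i j, J i j = -J j i := fun i j => by
    have := congrFun (congrFun hJ j) i; simpa using this
  have h : ∑ i, v i • gamv D (J i) = -gamv D (J.mulVec v) := by
    simp only [gamv, Matrix.mulVec, dotProduct, Finset.smul_sum, Finset.sum_smul, smul_smul]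
    rw [Finset.sum_comm, ← Finset.sum_neg_distrib]
    refine Finset.sum_congr rfl fun a _ => ?_
    rw [← Finset.sum_neg_distrib]
    refine Finset.sum_congr rfl fun b _ => ?_
    rw [hJ' b a]; module
  rw [← h, gamv]
  simp only [gam_rotField hJ, smul_add, smul_sub, Finset.sum_add_distrib, Finset.sum_sub_distrib,
    gamv, Matrix.mul_sum, Matrix.sum_mul, Matrix.mul_smul, Matrix.smul_mul]

lemma gamv_transField {D : Ten} (hD : D ∈ variety) (v w : C3) :
    gamv (transField v D) w = (1 / 3 : ℂ) • (gamv D v * gamv D w) := by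
  simp only [gamv, gam_transField_of_mem hD, Matrix.mul_sum, Finset.smul_sum, Matrix.mul_smul]
  exact Finset.sum_congr rfl fun a _ => by module

lemma isTangent_transField {D : Ten} (hD : D ∈ variety) (v : C3) :
    IsTangent D (transField v D) := by
  intro i l
  have hc : ∀ i l, Commute (gam D i) (gam D l) := mem_variety_iff.mp hD
  have hv : ∀ i, Commute (gam D i) (gamv D v) := fun i => by
    rw [gam_eq_gamv]; exact gamv_commute hD _ _
  have h1 : Commute (gam D i) (gam (transField v D) l) := by
    rw [gam_transField_of_mem hD]; exact ((hv i).mul_right (hc i l)).smul_right _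
  have h2 : Commute (gam (transField v D) i) (gam D l) := by
    rw [gam_transField_of_mem hD]; exact ((hv l).symm.mul_left (hc i l)).smul_left _
  simp only [comm, h1.eq, h2.eq, sub_self, add_zero]

lemma isTangent_rotField {D : Ten} (hD : D ∈ variety) {J : Matrix (Fin 3) (Fin 3) ℂ}
    (hJ : J.transpose = -J) : IsTangent D (rotField J D) := by
  intro i l
  have hc : gam D i * gam D l = gam D l * gam D i := mem_variety_iff.mp hD i l
  have hv : ∀ i v, gam D i * gamv D v = gamv D v * gam D i := fun i v => by
    rw [gam_eq_gamv]; exact gamv_commute hD _ _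
  -- Jacobi identity: [A, [J, B]] + [[J, A], B] = [J, [A, B]], which vanishes for commuting A and B.
  have key : ∀ A B P Q : Matrix (Fin 3) (Fin 3) ℂ, A * B = B * A → A * Q = Q * A → B * P = P * B →
      A * (Q + (J * B - B * J)) - (Q + (J * B - B * J)) * A
        + ((P + (J * A - A * J)) * B - B * (P + (J * A - A * J))) = 0 := by
    intro A B P Q h1 h2 h3
    calc _ = (A * Q - Q * A) - (B * P - P * B) + (J * (A * B - B * A) - (A * B - B * A) * J) := by
          noncomm_ring
      _ = 0 := by rw [h1, h2, h3]; simp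
  simp only [comm, gam_rotField hJ]
  exact key _ _ _ _ hc (hv i _) (hv l _)

lemma IsTangent.add {D E E' : Ten} (h : IsTangent D E) (h' : IsTangent D E') :
    IsTangent D (E + E') := by
  intro i l
  have h1 := h i l
  have h2 := h' i l
  simp only [comm, gam_add, mul_add, add_mul] at *
  calc _ = (gam D i * gam E l - gam E l * gam D i + (gam E i * gam D l - gam D l * gam E i))
      + (gam D i * gam E' l - gam E' l * gam D i + (gam E' i * gam D l - gam D l * gam E' i)) := by
        abel
    _ = 0 := by rw [h1, h2, add_zero]

theorem isTangent_euclField {D : Ten} (hD : D ∈ variety) {ξ : Matrix (Fin 3) (Fin 3) ℂ × C3}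
    (hξ : ξ.1.transpose = -ξ.1) : IsTangent D (euclField ξ D) :=
  (isTangent_rotField hD hξ).add (isTangent_transField hD _)

theorem rot_transField {R : Matrix (Fin 3) (Fin 3) ℂ} (hR : IsRotation R) (v : C3) {D : Ten}
    (hD : D ∈ variety) : rot R (transField v D) = transField (R.mulVec v) (rot R D) := by
  apply gam_injective
  intro i
  rw [gam_rot' hR, gam_transField_of_mem (rot_mem_variety hR hD), gamv_rot hR, gam_rot' hR,
    conj_mul hR, gamv_transField hD]
  simp

lemma rotField_isLinearMap (J : Matrix (Fin 3) (Fin 3) ℂ) : IsLinearMap ℂ (rotField J) := by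
  have htA : ∀ (D E : Ten) a b c, tensor (D + E) a b c = tensor D a b c + tensor E a b c := by
    intro D E a b c
    fin_cases a <;> fin_cases b <;> fin_cases c <;> simp [tensor] <;> ring
  have htS : ∀ (s : ℂ) (D : Ten) a b c, tensor (s • D) a b c = s * tensor D a b c := by
    intro s D a b c
    fin_cases a <;> fin_cases b <;> fin_cases c <;> simp [tensor] <;> ring
  constructor
  · intro D E
    simp only [rotField, htA, Fin.sum_univ_three]
    ext n; fin_cases n <;> simp [tenOfTensor] <;> ring
  · intro s D
    simp only [rotField, htS, Fin.sum_univ_three]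
    ext n; fin_cases n <;> simp [tenOfTensor] <;> ring

lemma fderiv_rotField (J : Matrix (Fin 3) (Fin 3) ℂ) (D E : Ten) :
    DifferentiableAt ℂ (rotField J) D ∧ fderiv ℂ (rotField J) D E = rotField J E := by
  have h : HasFDerivAt (rotField J)
      (LinearMap.toContinuousLinearMap (rotField_isLinearMap J).mk') D :=
    (LinearMap.toContinuousLinearMap (rotField_isLinearMap J).mk').hasFDerivAt
  exact ⟨h.differentiableAt, by rw [h.fderiv]; rfl⟩

lemma fderiv_euclField (ξ : Matrix (Fin 3) (Fin 3) ℂ × C3) (D E : Ten) :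
    fderiv ℂ (euclField ξ) D E = rotField ξ.1 E + transBil ξ.2 D E := by
  have h := (fderiv_rotField ξ.1 D E).1
  have h' := (contDiff_transField ξ.2 (n := 1)).differentiable (by simp) D
  change fderiv ℂ (fun D => rotField ξ.1 D + transField ξ.2 D) D E = _
  rw [fderiv_fun_add h h', add_apply, (fderiv_rotField ξ.1 D E).2, fderiv_transField]

lemma gamv_sub (D : Ten) (v w : C3) : gamv D (v - w) = gamv D v - gamv D w := by
  simp [gamv, sub_smul, Finset.sum_sub_distrib]

lemma gamv_add_left (D E : Ten) (v : C3) : gamv (D + E) v = gamv D v + gamv E v := by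
  simp [gamv, gam_add, Finset.sum_add_distrib]

lemma gamv_sub_left (D E : Ten) (v : C3) : gamv (D - E) v = gamv D v - gamv E v := by
  simp [gamv, gam_sub, smul_sub, Finset.sum_sub_distrib]

lemma gamv_neg_left (D : Ten) (v : C3) : gamv (-D) v = -gamv D v := by
  simp [gamv, gam_neg]

lemma IsTangent.gamv_transBil {D E : Ten} (h : IsTangent D E) (v u : C3) :
    gamv (transBil v D E) u = (1 / 3 : ℂ) • (gamv D v * gamv E u + gamv E v * gamv D u) := by
  conv_lhs => rw [gamv]
  conv_rhs => rw [gamv.eq_def E u, gamv.eq_def D u]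
  simp only [h.gam_transBil, Matrix.mul_sum, ← Finset.sum_add_distrib, Finset.smul_sum]
  refine Finset.sum_congr rfl fun i _ => ?_
  simp only [Matrix.mul_smul]; module

/-- The product formula for the translation field holds only on the variety. Since both fields are
tangent, `IsTangent.gamv_transBil` still gives the derivative of one along the other by the product
rule. The translation–translation part cancels because G_v and G_w commute. -/
theorem lieBracket_euclField {D : Ten} (hD : D ∈ variety) {ξ η : Matrix (Fin 3) (Fin 3) ℂ × C3}
    (hξ : ξ.1.transpose = -ξ.1) (hη : η.1.transpose = -η.1) :
    VectorField.lieBracket ℂ (euclField ξ) (euclField η) D = -euclField (euclBracket ξ η) D := by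
  have tξ := isTangent_euclField hD hξ
  have tη := isTangent_euclField hD hη
  obtain ⟨J, v⟩ := ξ
  obtain ⟨K, w⟩ := η
  simp only at hξ hη
  have hb : (J * K - K * J).transpose = -(J * K - K * J) := by
    rw [Matrix.transpose_sub, Matrix.transpose_mul, Matrix.transpose_mul, hξ, hη]; noncomm_ring
  apply gam_injective
  intro i
  rw [gam_eq_gamv, gam_eq_gamv]
  generalize (Pi.single i 1 : C3) = u
  rw [VectorField.lieBracket, fderiv_euclField, fderiv_euclField, gamv_sub_left, gamv_add_left,
    gamv_add_left, tξ.gamv_transBil, tη.gamv_transBil, gamv_neg_left]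
  simp only [euclField, euclBracket, gamv_add_left, gamv_rotField hξ, gamv_rotField hη,
    gamv_rotField hb, gamv_transField hD, Matrix.sub_mulVec, ← Matrix.mulVec_mulVec, gamv_sub]
  have hvw := gamv_commute hD v w
  -- From here on only an identity in free noncommuting matrices remains, with the single relation
  -- that `gv` and `gw` commute.
  generalize gamv D v = gv, gamv D w = gw, gamv D u = gu, gamv D (J.mulVec w) = gJw,
    gamv D (K.mulVec v) = gKv, gamv D (J.mulVec u) = gJu, gamv D (K.mulVec u) = gKu,
    gamv D (J.mulVec v) = gJv, gamv D (K.mulVec w) = gKw,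
    gamv D (J.mulVec (K.mulVec u)) = gJKu, gamv D (K.mulVec (J.mulVec u)) = gKJu at hvw ⊢
  simp only [smul_sub, smul_add, mul_add, add_mul, mul_sub, sub_mul, mul_neg, neg_mul,
    smul_mul_assoc, mul_smul_comm, ← mul_assoc, hvw]
  module

/-! ### The irreducible blocks -/

lemma X_add (D E : Ten) : ∀ m, X (D + E) m = X D m + X E m
  | 1 => by simp [X]; ring
  | 0 => by simp [X]; ring
  | -1 => by simp [X]; ring
  | Int.ofNat (n + 2) => (add_zero (0 : ℂ)).symm
  | Int.negSucc (n + 1) => (add_zero (0 : ℂ)).symm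

lemma X_smul (s : ℂ) (D : Ten) : ∀ m, X (s • D) m = s * X D m
  | 1 => by simp [X]; ring
  | 0 => by simp [X]; ring
  | -1 => by simp [X]; ring
  | Int.ofNat (n + 2) => (mul_zero s).symm
  | Int.negSucc (n + 1) => (mul_zero s).symm

lemma Y_add (D E : Ten) : ∀ m, Y (D + E) m = Y D m + Y E m
  | 3 => by simp [Y]; ring
  | 2 => by simp [Y]; ring
  | 1 => by simp [Y]; ring
  | 0 => by simp [Y]; ring
  | -1 => by simp [Y]; ring
  | -2 => by simp [Y]; ring
  | -3 => by simp [Y]; ring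
  | Int.ofNat (n + 4) => (add_zero (0 : ℂ)).symm
  | Int.negSucc (n + 3) => (add_zero (0 : ℂ)).symm

lemma Y_smul (s : ℂ) (D : Ten) : ∀ m, Y (s • D) m = s * Y D m
  | 3 => by simp [Y]; ring
  | 2 => by simp [Y]; ring
  | 1 => by simp [Y]; ring
  | 0 => by simp [Y]; ring
  | -1 => by simp [Y]; ring
  | -2 => by simp [Y]; ring
  | -3 => by simp [Y]; ring
  | Int.ofNat (n + 4) => (mul_zero s).symm
  | Int.negSucc (n + 3) => (mul_zero s).symm

lemma X_eq_zero_of_lt (D : Ten) : ∀ m : ℤ, 1 < |m| → X D m = 0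
  | 1 => by simp
  | 0 => by simp
  | -1 => by simp
  | Int.ofNat (n + 2) => fun _ => rfl
  | Int.negSucc (n + 1) => fun _ => rfl

lemma Y_eq_zero_of_lt (D : Ten) : ∀ m : ℤ, 3 < |m| → Y D m = 0
  | 3 => by simp
  | 2 => by simp
  | 1 => by simp
  | 0 => by simp
  | -1 => by simp
  | -2 => by simp
  | -3 => by simp
  | Int.ofNat (n + 4) => fun _ => rfl
  | Int.negSucc (n + 3) => fun _ => rfl

lemma X_ofXY_of_le (x y : ℤ → ℂ) {m : ℤ} (h : |m| ≤ 1) : X (ofXY x y) m = x m := by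
  rw [abs_le] at h
  obtain ⟨h1, h2⟩ := h
  obtain ⟨a, b, c⟩ := X_ofXY x y
  interval_cases m <;> assumption

lemma Y_ofXY_of_le (x y : ℤ → ℂ) {m : ℤ} (h : |m| ≤ 3) : Y (ofXY x y) m = y m := by
  rw [abs_le] at h
  obtain ⟨h1, h2⟩ := h
  obtain ⟨a, b, c, d, e, f, g⟩ := Y_ofXY x y
  interval_cases m <;> assumption

lemma ofXY_X_Y (D : Ten) : ofXY (X D) (Y D) = D := by
  have hI := Complex.I_sq
  obtain ⟨x1, x0, xm⟩ := X_eq_xr D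
  obtain ⟨y3, y2, y1, y0, ym1, ym2, ym3⟩ := Y_eq_yr D
  rw [ofXY_eq x1 x0 xm y3 y2 y1 y0 ym1 ym2 ym3]
  ext n; fin_cases n <;> simp [xr, yr, X, Y] <;> ring_nf <;> simp only [hI] <;> ring

lemma ext_XY {D E : Ten} (hX : ∀ m, X D m = X E m) (hY : ∀ m, Y D m = Y E m) : D = E := by
  rw [← ofXY_X_Y D, ← ofXY_X_Y E, funext hX, funext hY]

/-- The `X`-block as a subspace. -/
def subX : Submodule ℂ Ten where
  carrier := blockX
  add_mem' h h' m := by rw [Y_add, h m, h' m, add_zero]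
  zero_mem' m := by rw [← zero_smul ℂ (0 : Ten), Y_smul, zero_mul]
  smul_mem' s D h m := by rw [Y_smul, h m, mul_zero]

/-- The `Y`-block as a subspace. -/
def subY : Submodule ℂ Ten where
  carrier := blockY
  add_mem' h h' m := by rw [X_add, h m, h' m, add_zero]
  zero_mem' m := by rw [← zero_smul ℂ (0 : Ten), X_smul, zero_mul]
  smul_mem' s D h m := by rw [X_smul, h m, mul_zero]

lemma X_zero (m : ℤ) : X 0 m = 0 := by rw [← zero_smul ℂ (0 : Ten), X_smul, zero_mul]
lemma Y_zero (m : ℤ) : Y 0 m = 0 := by rw [← zero_smul ℂ (0 : Ten), Y_smul, zero_mul]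

lemma isCompl_subX_subY : IsCompl subX subY := by
  constructor
  · rw [Submodule.disjoint_def]
    intro D hX hY
    exact ext_XY (fun m => by rw [hY m, X_zero]) (fun m => by rw [hX m, Y_zero])
  · rw [codisjoint_iff, eq_top_iff]
    intro D _
    rw [Submodule.mem_sup]
    refine ⟨ofXY (X D) 0, fun m => ?_, ofXY 0 (Y D), fun m => ?_, ?_⟩
    · rcases le_or_gt |m| 3 with h | h
      · rw [Y_ofXY_of_le _ _ h]; rfl
      · exact Y_eq_zero_of_lt _ _ h
    · rcases le_or_gt |m| 1 with h | h
      · rw [X_ofXY_of_le _ _ h]; rfl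
      · exact X_eq_zero_of_lt _ _ h
    · apply ext_XY
      · intro m
        rw [X_add]
        rcases le_or_gt |m| 1 with h | h
        · rw [X_ofXY_of_le _ _ h, X_ofXY_of_le _ _ h, Pi.zero_apply, add_zero]
        · simp only [X_eq_zero_of_lt _ _ h, add_zero]
      · intro m
        rw [Y_add]
        rcases le_or_gt |m| 3 with h | h
        · rw [Y_ofXY_of_le _ _ h, Y_ofXY_of_le _ _ h, Pi.zero_apply, zero_add]
        · simp only [Y_eq_zero_of_lt _ _ h, add_zero]

/-- Difference quotients lie in W, and W is closed because the dimension is finite. This passes from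
invariance under the group to invariance under its Lie algebra. -/
lemma mem_of_hasDerivAt {W : Submodule ℂ Ten} {g : ℂ → Ten} {g' : Ten} (h : ∀ t, g t ∈ W)
    (hg : HasDerivAt g g' 0) : g' ∈ W := by
  have hc : IsClosed (W : Set Ten) := Submodule.closed_of_finiteDimensional W
  refine hc.mem_of_tendsto (hasDerivAt_iff_tendsto_slope.mp hg) (Filter.Eventually.of_forall ?_)
  intro t
  exact W.smul_mem _ (W.sub_mem (h t) (h 0))

lemma RotInvariant.rotField_Jx {W : Submodule ℂ Ten} (h : RotInvariant W) {D : Ten} (hD : D ∈ W) :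
    rotField Jx D ∈ W := by
  refine mem_of_hasDerivAt (g := fun t => rot
    !![1, 0, 0; 0, Complex.cos t, Complex.sin t; 0, -Complex.sin t, Complex.cos t] D)
    (fun t => h _ ?_ D hD) (rot_hasDerivAt _ _ ?_ ?_ D)
  · have := Complex.cos_sq_add_sin_sq t
    constructor
    · ext i j
      fin_cases i <;> fin_cases j <;>
        simp [Matrix.mul_apply, Fin.sum_univ_three] <;> grind
    · simp [Matrix.det_fin_three]; linear_combination this
  · ext i j; fin_cases i <;> fin_cases j <;> simp
  · have hs : HasDerivAt (fun t => Complex.sin t) 1 0 := by simpa using Complex.hasDerivAt_sin 0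
    have hc : HasDerivAt (fun t => Complex.cos t) 0 0 := by simpa using Complex.hasDerivAt_cos 0
    intro i j
    fin_cases i <;> fin_cases j <;> simp [Jx] <;>
      first | exact hasDerivAt_const _ _ | exact hs | exact hc | exact hs.neg

lemma RotInvariant.rotField_Jy {W : Submodule ℂ Ten} (h : RotInvariant W) {D : Ten} (hD : D ∈ W) :
    rotField Jy D ∈ W := by
  refine mem_of_hasDerivAt (g := fun t => rot
    !![Complex.cos t, 0, Complex.sin t; 0, 1, 0; -Complex.sin t, 0, Complex.cos t] D)
    (fun t => h _ ?_ D hD) (rot_hasDerivAt _ _ ?_ ?_ D)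
  · have := Complex.cos_sq_add_sin_sq t
    constructor
    · ext i j
      fin_cases i <;> fin_cases j <;>
        simp [Matrix.mul_apply, Fin.sum_univ_three] <;> grind
    · simp [Matrix.det_fin_three]; linear_combination this
  · ext i j; fin_cases i <;> fin_cases j <;> simp
  · have hs : HasDerivAt (fun t => Complex.sin t) 1 0 := by simpa using Complex.hasDerivAt_sin 0
    have hc : HasDerivAt (fun t => Complex.cos t) 0 0 := by simpa using Complex.hasDerivAt_cos 0
    intro i j
    fin_cases i <;> fin_cases j <;> simp [Jy] <;>
      first | exact hasDerivAt_const _ _ | exact hs | exact hc | exact hs.neg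

lemma rotField_combination (s t : ℂ) (J K : Matrix (Fin 3) (Fin 3) ℂ) (D : Ten) :
    rotField (s • J + t • K) D = s • rotField J D + t • rotField K D := by
  ext n; fin_cases n <;> simp [rotField, tenOfTensor, Fin.sum_univ_three] <;> ring

/-- A block of highest weight `l` is irreducible. -/
theorem rotIrreducible_of_isStandardBlock {l : ℕ} {f : Ten → ℤ → ℂ} (hf : IsStandardBlock l f)
    (hadd : ∀ D E m, f (D + E) m = f D m + f E m) (hsmul : ∀ (s : ℂ) D m, f (s • D) m = s * f D m)
    (hzero : ∀ (D : Ten) (m : ℤ), (l : ℤ) < |m| → f D m = 0) {W : Submodule ℂ Ten}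
    (hinj : ∀ D ∈ W, (∀ m, f D m = 0) → D = 0) {W' : Submodule ℂ Ten} (hW : W' ≤ W)
    (hinv : RotInvariant W') : W' = ⊥ ∨ W' = W := by
  have hp : ∀ D ∈ W', rotField (Complex.I • Jx + Jy) D ∈ W' := fun D hD => by
    have := rotField_combination Complex.I 1 Jx Jy D
    rw [one_smul, one_smul] at this
    rw [this]
    exact W'.add_mem (W'.smul_mem _ (hinv.rotField_Jx hD)) (hinv.rotField_Jy hD)
  have hm : ∀ D ∈ W', rotField (Complex.I • Jx - Jy) D ∈ W' := fun D hD => by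
    have := rotField_combination Complex.I (-1) Jx Jy D
    rw [neg_one_smul, neg_one_smul, ← sub_eq_add_neg] at this
    rw [this, ← sub_eq_add_neg]
    exact W'.sub_mem (W'.smul_mem _ (hinv.rotField_Jx hD)) (hinv.rotField_Jy hD)
  have hpne : ∀ m : ℤ, -(l : ℤ) ≤ m → m < l →
      ((Real.sqrt ((l - m) * (l + m + 1)) : ℝ) : ℂ) ≠ 0 := by
    intro m h1 h2
    rw [Complex.ofReal_ne_zero, Real.sqrt_ne_zero']
    have h1' : (-(l : ℝ)) ≤ m := by exact_mod_cast h1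
    have h2' : (m : ℝ) < l := by exact_mod_cast h2
    exact mul_pos (by linarith) (by linarith)
  have hmne : ∀ m : ℤ, -(l : ℤ) < m → m ≤ l →
      ((Real.sqrt ((l + m) * (l - m + 1)) : ℝ) : ℂ) ≠ 0 := by
    intro m h1 h2
    rw [Complex.ofReal_ne_zero, Real.sqrt_ne_zero']
    have h1' : (-(l : ℝ)) < m := by exact_mod_cast h1
    have h2' : (m : ℝ) ≤ l := by exact_mod_cast h2
    exact mul_pos (by linarith) (by linarith)
  have hout : ∀ (D : Ten) (m : ℤ), ¬ (-(l : ℤ) ≤ m ∧ m ≤ l) → f D m = 0 := fun D m h =>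
    hzero D m (by rw [← not_le, abs_le]; exact h)
  rcases eq_or_ne W' ⊥ with hbot | hbot
  · exact Or.inl hbot
  right
  obtain ⟨D₀, hD₀, hne⟩ := W'.ne_bot_iff.mp hbot
  -- The functions f_m are coordinates: J₊ moves the coordinate at m + 1 to m. Applied to vectors it
  -- lowers the largest occurring weight by one, until only the weight -l is left.
  have lower : ∀ (k : ℕ), (k : ℤ) ≤ 2 * l → ∀ D ∈ W', f D (-l + k) ≠ 0 →
      (∀ m : ℤ, -l + k < m → f D m = 0) →
      ∃ E ∈ W', f E (-l) ≠ 0 ∧ ∀ m : ℤ, m ≠ -l → f E m = 0 := by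
    intro k
    induction k with
    | zero =>
      intro _ D hD h1 h2
      refine ⟨D, hD, by simpa using h1, fun m hm => ?_⟩
      rcases lt_or_gt_of_ne hm with h | h
      · exact hout D m (by omega)
      · exact h2 m (by simpa using h)
    | succ k ih =>
      intro hk D hD h1 h2
      push_cast at hk h1 h2
      refine ih (by omega) _ (hp D hD) ?_ fun m hm => ?_
      · rw [(hf D _ (by omega) (by omega)).1]
        refine mul_ne_zero (hpne _ (by omega) (by omega)) ?_
        rwa [add_assoc]
      · by_cases h : -(l : ℤ) ≤ m ∧ m ≤ l
        · rw [(hf D m h.1 h.2).1, h2 (m + 1) (by omega), mul_zero]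
        · exact hout _ m h
  obtain ⟨E₀, hE₀, hE₀', hE₀''⟩ : ∃ E ∈ W', f E (-l) ≠ 0 ∧ ∀ m : ℤ, m ≠ -l → f E m = 0 := by
    -- The least such k marks the largest weight l - k at which D₀ has a nonzero coordinate.
    have hex : ∃ k : ℕ, (k : ℤ) ≤ 2 * l ∧ f D₀ (l - k) ≠ 0 := by
      by_contra! hcon
      refine hne (hinj D₀ (hW hD₀) fun m => ?_)
      by_cases h : -(l : ℤ) ≤ m ∧ m ≤ l
      · have := hcon (l - m).toNat (by omega)
        rwa [Int.toNat_of_nonneg (by omega), sub_sub_cancel] at this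
      · exact hout _ m h
    classical
    obtain ⟨hk1, hk2⟩ := Nat.find_spec hex
    set k := Nat.find hex
    refine lower (2 * l - k) (by omega) D₀ hD₀ ?_ fun m hm => ?_
    · rwa [show (-(l : ℤ) + ((2 * l - k : ℕ) : ℤ)) = l - k by omega]
    · by_cases h : m ≤ l
      · have := Nat.find_min hex (m := (l - m).toNat) (by omega)
        push Not at this
        have := this (by omega)
        rwa [Int.toNat_of_nonneg (by omega), sub_sub_cancel] at this
      · exact hout _ m (by omega)
  -- Conversely J₋ raises the weight of a vector. Starting from E₀ one obtains in W' a vector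
  -- concentrated in each weight.
  have raise : ∀ k : ℕ, (k : ℤ) ≤ 2 * l →
      ∃ E ∈ W', f E (-l + k) ≠ 0 ∧ ∀ m : ℤ, m ≠ -l + k → f E m = 0 := by
    intro k
    induction k with
    | zero => intro _; exact ⟨E₀, hE₀, by simpa using hE₀', by simpa using hE₀''⟩
    | succ k ih =>
      intro hk
      push_cast at hk ⊢
      obtain ⟨E, hE, h1, h2⟩ := ih (by omega)
      refine ⟨_, hm E hE, ?_, fun m hm => ?_⟩
      · rw [(hf E _ (by omega) (by omega)).2.1]
        refine mul_ne_zero (hmne _ (by omega) (by omega)) ?_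
        rwa [show -(l : ℤ) + (k + 1) - 1 = -l + k by ring]
      · by_cases h : -(l : ℤ) ≤ m ∧ m ≤ l
        · rw [(hf E m h.1 h.2).2.1, h2 (m - 1) (by omega), mul_zero]
        · exact hout _ m h
  refine le_antisymm hW fun D hD => ?_
  choose E hE h1 h2 using raise
  let E' : ℕ → Ten := fun k => if h : (k : ℤ) ≤ 2 * l then E k h else 0
  have hsum : ∀ (s : Finset ℕ) (c : ℕ → ℂ) (m : ℤ),
      f (∑ k ∈ s, c k • E' k) m = ∑ k ∈ s, c k * f (E' k) m := by
    intro s c m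
    induction s using Finset.induction_on with
    | empty =>
      have := hsmul 0 0 m
      simpa using this
    | insert a s ha ih => rw [Finset.sum_insert ha, Finset.sum_insert ha, hadd, hsmul, ih]
  -- The combination of weight vectors with the same coordinates as D; injectivity of the
  -- coordinates on W gives D = D'.
  let D' : Ten := ∑ k ∈ Finset.range (2 * l + 1), (f D (-l + k) / f (E' k) (-l + k)) • E' k
  have hD' : D' ∈ W' := by
    refine W'.sum_mem fun k hk => W'.smul_mem _ ?_
    rw [Finset.mem_range] at hk
    simp only [E', dif_pos (show (k : ℤ) ≤ 2 * l by omega)]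
    exact hE k _
  have : D - D' = 0 := by
    refine hinj _ (W.sub_mem hD (hW hD')) fun m => ?_
    rw [sub_eq_add_neg, ← neg_one_smul ℂ D', hadd, hsmul, hsum]
    by_cases h : -(l : ℤ) ≤ m ∧ m ≤ l
    · obtain ⟨k, hk⟩ : ∃ k : ℕ, m = -l + k := ⟨(m + l).toNat, by omega⟩
      subst hk
      have hkl : (k : ℤ) ≤ 2 * l := by omega
      rw [Finset.sum_eq_single k]
      · have : f (E' k) (-l + k) ≠ 0 := by
          simp only [E', dif_pos hkl]; exact h1 k hkl
        field_simp; ring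
      · intro b hb hbk
        rw [Finset.mem_range] at hb
        have : f (E' b) (-l + k) = 0 := by
          simp only [E', dif_pos (show (b : ℤ) ≤ 2 * l by omega)]
          exact h2 b _ _ (by omega)
        rw [this, mul_zero]
      · intro hk; exact absurd (Finset.mem_range.mpr (by omega)) hk
    · rw [hout D m h, Finset.sum_eq_zero fun k _ => by rw [hout _ m h, mul_zero]]; simp
  rw [sub_eq_zero.mp this]; exact hD'

/-! ### The blocks as trace part and trace-free part of cubic forms. -/

lemma trace_gamv (D : Ten) (v : C3) : (gamv D v).trace = ∑ a, v a * (gam D a).trace := by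
  simp [gamv, Matrix.trace_sum]

lemma trace_gam_rot {R : Matrix (Fin 3) (Fin 3) ℂ} (hR : IsRotation R) (D : Ten) (i : Fin 3) :
    (gam (rot R D) i).trace = ∑ a, R i a * (gam D a).trace := by
  rw [gam_rot' hR, Matrix.trace_mul_comm, ← Matrix.mul_assoc, hR.transpose_mul, Matrix.one_mul,
    trace_gamv]

lemma trace_gam_eq (D : Ten) : (gam D 0).trace = A33 D + 3 * B12 D - 2 * A22 D ∧
    (gam D 1).trace = 3 * A12 D + B33 D + B22 D ∧
    (gam D 2).trace = C33 D + 2 * A13 D + B23 D := by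
  refine ⟨?_, ?_, ?_⟩ <;> simp [Matrix.trace, Fin.sum_univ_three, cub, tensor] <;> ring

/-- The components Xₘ are, up to a change of basis, the traces of the Gᵢ; so the Y-block consists of
the trace-free (harmonic) cubic forms. -/
lemma mem_subY_iff {D : Ten} : D ∈ subY ↔ ∀ i, (gam D i).trace = 0 := by
  obtain ⟨h0, h1, h2⟩ := trace_gam_eq D
  have hI := Complex.I_sq
  constructor
  · intro h
    have a1 := h 1; have a0 := h 0; have am := h (-1)
    simp only [X, mul_eq_zero, neg_eq_zero, rt_ne_zero (n := 2) (by norm_num), false_or] at a1 a0 am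
    intro i
    fin_cases i
    · refine h0.trans ?_; linear_combination (a1 - am) / 2
    · refine h1.trans ?_; linear_combination (-Complex.I / 2) * (a1 + am)
        + (3 * A12 D + B33 D + B22 D) * hI
    · exact h2.trans a0
  · intro h m
    rcases le_or_gt |m| 1 with hm | hm
    · rw [abs_le] at hm
      obtain ⟨m1, m2⟩ := hm
      rw [h 0] at h0; rw [h 1] at h1; rw [h 2] at h2
      interval_cases m <;> simp only [X]
      · linear_combination h0 - Complex.I * h1
      · linear_combination rt 2 * h2
      · linear_combination -h0 - Complex.I * h1
    · exact X_eq_zero_of_lt _ _ hm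

theorem rotInvariant_subY : RotInvariant subY := by
  intro R hR D hD
  rw [mem_subY_iff] at hD ⊢
  intro i
  rw [trace_gam_rot hR]; simp [hD]

/-- The ten-tuple of the tensor `δᵢⱼ wₖ + δᵢₖ wⱼ + δⱼₖ wᵢ`. -/
def ofVec (w : C3) : Ten := tenOfTensor fun i j k =>
  (if i = j then w k else 0) + (if i = k then w j else 0) + (if j = k then w i else 0)

lemma gam_ofVec (w : C3) (i : Fin 3) : gam (ofVec w) i
    = w i • 1 + Matrix.vecMulVec (Pi.single i 1) w + Matrix.vecMulVec w (Pi.single i 1) := by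
  rw [ofVec, gam_tenOfTensor]
  · ext j k
    simp [Matrix.vecMulVec_apply, Pi.single_apply, Matrix.one_apply, eq_comm]; ring
  · intro i j k; simp only [eq_comm (a := i) (b := j)]; ring
  · intro i j k; simp only [eq_comm (a := j) (b := k)]; ring

lemma gamv_ofVec (w v : C3) : gamv (ofVec w) v
    = (w ⬝ᵥ v) • 1 + Matrix.vecMulVec v w + Matrix.vecMulVec w v := by
  ext j k
  fin_cases j <;> fin_cases k <;> simp [gamv, gam_ofVec, Fin.sum_univ_three, Matrix.vecMulVec_apply, dotProduct] <;> ring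

lemma rot_ofVec {R : Matrix (Fin 3) (Fin 3) ℂ} (hR : IsRotation R) (w : C3) :
    rot R (ofVec w) = ofVec (R.mulVec w) := by
  apply gam_injective
  intro i
  have h1 : R.mulVec (R i) = Pi.single i 1 := by
    ext j
    have := congrFun (congrFun hR.1 j) i
    simpa [Matrix.mul_apply, Matrix.mulVec, dotProduct, Matrix.one_apply, Pi.single_apply] using this
  have h2 : w ⬝ᵥ R i = R.mulVec w i := dotProduct_comm _ _
  rw [gam_rot' hR, gamv_ofVec, gam_ofVec, Matrix.mul_add, Matrix.mul_add, Matrix.add_mul,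
    Matrix.add_mul, Matrix.mul_vecMulVec, Matrix.mul_vecMulVec, Matrix.vecMulVec_mul,
    Matrix.vecMulVec_mul, Matrix.vecMul_transpose, Matrix.vecMul_transpose, h1, h2, Matrix.mul_smul,
    Matrix.smul_mul, Matrix.mul_one, hR.1]

lemma Y_ofVec (w : C3) (m : ℤ) : Y (ofVec w) m = 0 := by
  rcases le_or_gt |m| 3 with h | h
  · rw [abs_le] at h
    obtain ⟨h1, h2⟩ := h
    interval_cases m <;> simp [Y, ofVec, tenOfTensor] <;> first | ring1 | (ring_nf; simp)
  · exact Y_eq_zero_of_lt _ _ h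

lemma X_ofVec (w : C3) : X (ofVec w) 1 = 5 * (w 0 + Complex.I * w 1) ∧
    X (ofVec w) 0 = -rt 2 * (5 * w 2) ∧ X (ofVec w) (-1) = 5 * (-w 0 + Complex.I * w 1) := by
  refine ⟨?_, ?_, ?_⟩ <;> simp [X, ofVec, tenOfTensor] <;> ring_nf <;> simp

/-- The divisor 5 is the trace factor of δᵢⱼ wₖ + δᵢₖ wⱼ + δⱼₖ wᵢ in dimension three: contraction of
two indices gives (3 + 2) w. -/
lemma eq_ofVec_of_mem_subX {D : Ten} (hD : D ∈ subX) :
    D = ofVec fun i => (gam D i).trace / 5 := by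
  obtain ⟨h0, h1, h2⟩ := trace_gam_eq D
  refine ext_XY (fun m => ?_) (fun m => by rw [hD m, Y_ofVec])
  rcases le_or_gt |m| 1 with h | h
  · rw [abs_le] at h
    obtain ⟨m1, m2⟩ := h
    obtain ⟨x1, x0, xm⟩ := X_ofVec fun i => (gam D i).trace / 5
    interval_cases m
    · rw [xm, h0, h1]; simp only [X]; ring
    · rw [x0, h2]; simp only [X]; ring
    · rw [x1, h0, h1]; simp only [X]; ring
  · rw [X_eq_zero_of_lt _ _ h, X_eq_zero_of_lt _ _ h]

lemma trace_gam_ofVec (w : C3) (i : Fin 3) : (gam (ofVec w) i).trace = 5 * w i := by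
  rw [gam_ofVec]
  simp [Matrix.trace_vecMulVec]; ring

lemma finrank_subX : Module.finrank ℂ subX = 3 := by
  let e : subX ≃ₗ[ℂ] (Fin 3 → ℂ) :=
    { toFun := fun D i => (gam D i).trace / 5
      map_add' := fun D E => by
        ext i; simp [gam_add, add_div]
      map_smul' := fun s D => by ext i; simp [gam_smul, mul_div_assoc]
      invFun := fun w => ⟨ofVec w, Y_ofVec w⟩
      left_inv := fun D => Subtype.ext (eq_ofVec_of_mem_subX D.2).symm
      right_inv := fun w => by ext i; simp [trace_gam_ofVec] }
  rw [e.finrank_eq]; simp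

lemma finrank_subY : Module.finrank ℂ subY = 7 := by
  have h := Submodule.finrank_add_eq_of_isCompl isCompl_subX_subY
  rw [finrank_subX] at h
  simp at h
  omega

theorem rotInvariant_subX : RotInvariant subX := by
  intro R hR D hD
  rw [eq_ofVec_of_mem_subX hD, rot_ofVec hR]
  exact Y_ofVec _

theorem rotIrreducible_subX : RotIrreducible subX := by
  refine ⟨rotInvariant_subX, fun h => ?_, fun W' hW' hinv =>
    rotIrreducible_of_isStandardBlock isStandardBlock_X X_add X_smul
      (by simpa using X_eq_zero_of_lt) (fun D hD h => ?_) hW' hinv⟩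
  · have := finrank_subX; rw [h, finrank_bot] at this; norm_num at this
  · exact ext_XY (fun m => by rw [h m, X_zero]) (fun m => by rw [hD m, Y_zero])

theorem rotIrreducible_subY : RotIrreducible subY := by
  refine ⟨rotInvariant_subY, fun h => ?_, fun W' hW' hinv =>
    rotIrreducible_of_isStandardBlock isStandardBlock_Y Y_add Y_smul
      (by simpa using Y_eq_zero_of_lt) (fun D hD h => ?_) hW' hinv⟩
  · have := finrank_subY; rw [h, finrank_bot] at this; norm_num at this
  · exact ext_XY (fun m => by rw [hD m, X_zero]) (fun m => by rw [h m, Y_zero])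

/-! ### Directional derivatives of functions, vectors and matrices -/

/-- `f` is differentiable at `x` with directional derivatives `f' v`. -/
def HasDD (f : C3 → ℂ) (f' : C3 → ℂ) (x : C3) : Prop :=
  DifferentiableAt ℂ f x ∧ ∀ v, fderiv ℂ f x v = f' v

lemma HasDD.of_hasFDerivAt {f f' : C3 → ℂ} {x : C3} {L : C3 →L[ℂ] ℂ} (h : HasFDerivAt f L x)
    (hL : ∀ v, L v = f' v) : HasDD f f' x :=
  ⟨h.differentiableAt, fun v => by rw [h.fderiv, hL]⟩

lemma HasDD.congr_deriv {f f' g' : C3 → ℂ} {x : C3} (h : HasDD f f' x) (he : ∀ v, f' v = g' v) :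
    HasDD f g' x := ⟨h.1, fun v => (h.2 v).trans (he v)⟩

lemma HasDD.congr {f g f' : C3 → ℂ} {x : C3} (h : HasDD f f' x) (he : g =ᶠ[𝓝 x] f) :
    HasDD g f' x := ⟨h.1.congr_of_eventuallyEq he, fun v => by rw [he.fderiv_eq, h.2]⟩

lemma HasDD.pd {f f' : C3 → ℂ} {x : C3} (h : HasDD f f' x) (i : Fin 3) :
    Superintegrable.pd i f x = f' (Pi.single i 1) := h.2 _

lemma sum_smul_single (v : C3) : ∑ i, v i • (Pi.single i 1 : C3) = v := by
  ext j; simp [Finset.sum_apply, Pi.single_apply]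

lemma fderiv_eq_sum_pd (f : C3 → ℂ) (x v : C3) : fderiv ℂ f x v = ∑ i, v i * pd i f x := by
  conv_lhs => rw [← sum_smul_single v]
  simp [pd]

lemma hasDD_of_differentiableAt {f : C3 → ℂ} {x : C3} (h : DifferentiableAt ℂ f x) :
    HasDD f (fun v => ∑ i, v i * Superintegrable.pd i f x) x := ⟨h, fderiv_eq_sum_pd f x⟩

lemma hasDD_const (c : ℂ) (x : C3) : HasDD (fun _ => c) (fun _ => 0) x :=
  .of_hasFDerivAt (hasFDerivAt_const c x) fun _ => rfl

lemma hasDD_of_isLinearMap {f : C3 → ℂ} (h : IsLinearMap ℂ f) (x : C3) : HasDD f f x :=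
  .of_hasFDerivAt (LinearMap.toContinuousLinearMap h.mk').hasFDerivAt fun _ => rfl

lemma hasDD_apply (i : Fin 3) (x : C3) : HasDD (fun y => y i) (fun v => v i) x :=
  hasDD_of_isLinearMap ⟨fun _ _ => rfl, fun _ _ => rfl⟩ x

lemma HasDD.add {f g f' g' : C3 → ℂ} {x : C3} (h : HasDD f f' x) (h' : HasDD g g' x) :
    HasDD (fun y => f y + g y) (fun v => f' v + g' v) x :=
  .of_hasFDerivAt (h.1.hasFDerivAt.add h'.1.hasFDerivAt) fun v => by simp [h.2, h'.2]

lemma HasDD.sub {f g f' g' : C3 → ℂ} {x : C3} (h : HasDD f f' x) (h' : HasDD g g' x) :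
    HasDD (fun y => f y - g y) (fun v => f' v - g' v) x :=
  .of_hasFDerivAt (h.1.hasFDerivAt.sub h'.1.hasFDerivAt) fun v => by simp [h.2, h'.2]

lemma HasDD.mul {f g f' g' : C3 → ℂ} {x : C3} (h : HasDD f f' x) (h' : HasDD g g' x) :
    HasDD (fun y => f y * g y) (fun v => f' v * g x + f x * g' v) x :=
  .of_hasFDerivAt (h.1.hasFDerivAt.mul h'.1.hasFDerivAt) fun v => by simp [h.2, h'.2]; ring

lemma HasDD.const_mul {f f' : C3 → ℂ} {x : C3} (c : ℂ) (h : HasDD f f' x) :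
    HasDD (fun y => c * f y) (fun v => c * f' v) x :=
  .of_hasFDerivAt (h.1.hasFDerivAt.const_mul c) fun v => by simp [h.2]

lemma HasDD.sum {ι : Type*} (s : Finset ι) {f f' : ι → C3 → ℂ} {x : C3}
    (h : ∀ i, HasDD (f i) (f' i) x) :
    HasDD (fun y => ∑ i ∈ s, f i y) (fun v => ∑ i ∈ s, f' i v) x :=
  .of_hasFDerivAt (HasFDerivAt.fun_sum fun i _ => (h i).1.hasFDerivAt) fun v => by
    simp [(h _).2]

/-- Entrywise directional derivatives of families of functions. -/
def HasDV {ι : Type*} (f : C3 → ι → ℂ) (f' : C3 → ι → ℂ) (x : C3) : Prop :=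
  ∀ i, HasDD (fun y => f y i) (fun v => f' v i) x

/-- Entrywise directional derivatives of matrices of functions. -/
def HasDM (M : C3 → Matrix (Fin 3) (Fin 3) ℂ) (M' : C3 → Matrix (Fin 3) (Fin 3) ℂ) (x : C3) : Prop :=
  ∀ i j, HasDD (fun y => M y i j) (fun v => M' v i j) x

section
variable {M P M' P' Q' : C3 → Matrix (Fin 3) (Fin 3) ℂ} {f g f' g' h' : C3 → C3} {x : C3}

lemma HasDM.congr_deriv (h : HasDM M M' x) (he : ∀ v, M' v = Q' v) : HasDM M Q' x :=
  fun i j => (h i j).congr_deriv fun v => by rw [he]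

lemma HasDV.congr_deriv (h : HasDV f f' x) (he : ∀ v, f' v = h' v) : HasDV f h' x :=
  fun i => (h i).congr_deriv fun v => by rw [he]

lemma HasDM.add (h : HasDM M M' x) (hP : HasDM P P' x) :
    HasDM (fun y => M y + P y) (fun v => M' v + P' v) x := fun i j => (h i j).add (hP i j)

lemma HasDM.sub (h : HasDM M M' x) (hP : HasDM P P' x) :
    HasDM (fun y => M y - P y) (fun v => M' v - P' v) x := fun i j => (h i j).sub (hP i j)

lemma HasDM.mul (h : HasDM M M' x) (hP : HasDM P P' x) :
    HasDM (fun y => M y * P y) (fun v => M' v * P x + M x * P' v) x := fun i j => by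
  simp only [Matrix.mul_apply, Matrix.add_apply, ← Finset.sum_add_distrib]
  exact HasDD.sum _ fun k => (h i k).mul (hP k j)

lemma hasDM_const (A : Matrix (Fin 3) (Fin 3) ℂ) (x : C3) : HasDM (fun _ => A) (fun _ => 0) x :=
  fun i j => hasDD_const (A i j) x

lemma HasDV.add (h : HasDV f f' x) (hg : HasDV g g' x) :
    HasDV (fun y => f y + g y) (fun v => f' v + g' v) x := fun i => (h i).add (hg i)

lemma HasDV.sub (h : HasDV f f' x) (hg : HasDV g g' x) :
    HasDV (fun y => f y - g y) (fun v => f' v - g' v) x := fun i => (h i).sub (hg i)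

lemma HasDV.const_smul (h : HasDV f f' x) (c : ℂ) :
    HasDV (fun y => c • f y) (fun v => c • f' v) x := fun i => (h i).const_mul c

lemma hasDV_const (w : C3) (x : C3) : HasDV (fun _ => w) (fun _ => 0) x :=
  fun i => hasDD_const (w i) x

lemma hasDV_id (x : C3) : HasDV (fun y => y) (fun v => v) x := fun i => hasDD_apply i x

lemma HasDM.mulVec (h : HasDM M M' x) (hg : HasDV g g' x) :
    HasDV (fun y => (M y).mulVec (g y)) (fun v => (M' v).mulVec (g x) + (M x).mulVec (g' v)) x :=
  fun i => by
    simp only [Matrix.mulVec, dotProduct, Pi.add_apply, ← Finset.sum_add_distrib]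
    exact HasDD.sum _ fun k => (h i k).mul (hg k)

lemma HasDV.dotProduct (h : HasDV f f' x) (hg : HasDV g g' x) :
    HasDD (fun y => f y ⬝ᵥ g y) (fun v => f' v ⬝ᵥ g x + f x ⬝ᵥ g' v) x := by
  simp only [_root_.dotProduct, ← Finset.sum_add_distrib]
  exact HasDD.sum _ fun k => (h k).mul (hg k)

lemma hasDM_linear (h : IsLinearMap ℂ M) (x : C3) : HasDM M M x := fun i j =>
  hasDD_of_isLinearMap ⟨fun a b => by rw [h.map_add]; rfl, fun s a => by rw [h.map_smul]; rfl⟩ x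

lemma HasDM.comp_linear {T : C3 → Matrix (Fin 3) (Fin 3) ℂ} (hT : IsLinearMap ℂ T)
    (h : HasDV f f' x) : HasDM (fun y => T (f y)) (fun v => T (f' v)) x := by
  have key : ∀ z, T z = ∑ k, z k • T (Pi.single k 1) := fun z => by
    conv_lhs => rw [← sum_smul_single z]
    have h := map_sum (IsLinearMap.mk' T hT) (fun k => z k • (Pi.single k 1 : C3)) Finset.univ
    simpa only [map_smul, IsLinearMap.mk'_apply] using h
  intro i j
  simp only [key (f _), key (f' _), Matrix.sum_apply, Matrix.smul_apply, smul_eq_mul]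
  refine HasDD.sum _ fun k => ?_
  exact ((h k).mul (hasDD_const _ x)).congr_deriv fun v => by simp

lemma HasDM.differentiableAt_det (h : HasDM M M' x) : DifferentiableAt ℂ (fun y => (M y).det) x := by
  have := fun i j => (h i j).1
  simp only [Matrix.det_fin_three]
  fun_prop

/-- The derivative of the inverse matrix. -/
lemma HasDM.inv (h : HasDM M M' x) (hd : (M x).det ≠ 0) :
    HasDM (fun y => (M y)⁻¹) (fun v => -((M x)⁻¹ * M' v * (M x)⁻¹)) x := by
  have hdiff : ∀ i j, DifferentiableAt ℂ (fun y => (M y)⁻¹ i j) x := by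
    intro i j
    have h1 := fun i j => (h i j).1
    have h2 : DifferentiableAt ℂ (fun y => (M y).adjugate i j) x := by
      simp only [Matrix.adjugate_fin_three]
      fin_cases i <;> fin_cases j <;> simp <;> fun_prop
    simp only [Matrix.inv_def, Matrix.smul_apply, smul_eq_mul, Ring.inverse_eq_inv']
    exact (h.differentiableAt_det.inv hd).mul h2
  let P' : C3 → Matrix (Fin 3) (Fin 3) ℂ := fun v => Matrix.of fun i j =>
    fderiv ℂ (fun y => (M y)⁻¹ i j) x v
  have hP : HasDM (fun y => (M y)⁻¹) P' x := fun i j => ⟨hdiff i j, fun v => rfl⟩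
  have hne : ∀ᶠ y in 𝓝 x, (M y).det ≠ 0 := h.differentiableAt_det.continuousAt.eventually_ne hd
  have hu : IsUnit (M x).det := isUnit_iff_ne_zero.mpr hd
  have hmul := hP.mul h
  refine hP.congr_deriv fun v => ?_
  -- Differentiation of M⁻¹ M = 1, which holds in a neighbourhood because the determinant stays
  -- nonzero.
  have hz : P' v * M x + (M x)⁻¹ * M' v = 0 := by
    ext i j
    have h1 := (hmul i j).2 v
    have h2 : HasDD (fun y => ((M y)⁻¹ * M y) i j) (fun _ => 0) x :=
      (hasDD_const ((1 : Matrix (Fin 3) (Fin 3) ℂ) i j) x).congr <| hne.mono fun y hy => by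
        simp only [Matrix.nonsing_inv_mul _ (isUnit_iff_ne_zero.mpr hy)]
    exact h1.symm.trans (h2.2 v)
  calc P' v = (P' v * M x) * (M x)⁻¹ := by rw [Matrix.mul_assoc, Matrix.mul_nonsing_inv _ hu, mul_one]
    _ = _ := by rw [eq_neg_of_add_eq_zero_left hz, Matrix.neg_mul]

end

/-! ### The explicit translation flow -/

/-- The matrix of the product with `u`: `B_u = ∑ₗ uₗ Gₗ / 3`. -/
def bmat (D : Ten) (u : C3) : Matrix (Fin 3) (Fin 3) ℂ := (1 / 3 : ℂ) • gamv D u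

lemma bmat_isLinearMap (D : Ten) : IsLinearMap ℂ (bmat D) :=
  ⟨fun u v => by simp [bmat, gamv_add], fun s u => by simp only [bmat, gamv_smul, smul_comm s]⟩

lemma bmat_add (D : Ten) (u v : C3) : bmat D (u + v) = bmat D u + bmat D v :=
  (bmat_isLinearMap D).map_add u v

lemma bmat_smul (D : Ten) (s : ℂ) (u : C3) : bmat D (s • u) = s • bmat D u :=
  (bmat_isLinearMap D).map_smul s u

lemma bmat_sub (D : Ten) (u v : C3) : bmat D (u - v) = bmat D u - bmat D v :=
  (bmat_isLinearMap D).map_sub u v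

lemma bmat_zero (D : Ten) : bmat D 0 = 0 := (bmat_isLinearMap D).map_zero

lemma gamv_apply (D : Ten) (u : C3) (j k : Fin 3) : gamv D u j k = ∑ l, u l * cub D l j k := by
  simp [gamv, Matrix.sum_apply]

lemma bmat_transpose (D : Ten) (u : C3) : (bmat D u).transpose = bmat D u := by
  simp [bmat, gamv, Matrix.transpose_sum, gam_transpose]

/-- The product u·v = B_u v is commutative for every ten-tuple, by symmetry of the cubic tensor;
only associativity needs the variety. -/
lemma bmat_mulVec_comm (D : Ten) (u v : C3) : (bmat D u).mulVec v = (bmat D v).mulVec u := by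
  ext k
  rw [bmat, bmat, Matrix.smul_mulVec, Matrix.smul_mulVec, Pi.smul_apply, Pi.smul_apply]
  congr 1
  simp only [Matrix.mulVec, dotProduct, gamv_apply, Finset.sum_mul]
  rw [Finset.sum_comm]
  refine Finset.sum_congr rfl fun a _ => Finset.sum_congr rfl fun b _ => ?_
  rw [cub_comm₁₂ D a k b, cub_comm₂₃ D k a b, cub_comm₁₂ D k b a]; ring

section
variable {D : Ten} (hD : D ∈ variety)
include hD

lemma bmat_commute (u v : C3) : Commute (bmat D u) (bmat D v) :=
  ((show Commute _ _ from gamv_commute hD u v).smul_left _).smul_right _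

/-- The product is associative. -/
lemma bmat_bmat_mulVec (u v : C3) : bmat D ((bmat D u).mulVec v) = bmat D u * bmat D v := by
  -- (u·v)·z = z·(u·v) = u·(z·v) = u·(v·z), where the middle equality is the commutation of B_z and
  -- B_u.
  have key : ∀ z, (bmat D ((bmat D u).mulVec v)).mulVec z = (bmat D u * bmat D v).mulVec z := by
    intro z
    rw [bmat_mulVec_comm, Matrix.mulVec_mulVec, (bmat_commute hD z u).eq, ← Matrix.mulVec_mulVec,
      bmat_mulVec_comm D z v, Matrix.mulVec_mulVec]
  exact Matrix.ext_of_mulVec_single fun i => key _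

end

/-- The matrix `1 - B_x`. -/
def lmat (D : Ten) (x : C3) : Matrix (Fin 3) (Fin 3) ℂ := 1 - bmat D x

/-- The inverse of the matrix `1 - B_x`. -/
def nmat (D : Ten) (x : C3) : Matrix (Fin 3) (Fin 3) ℂ := (lmat D x)⁻¹

/-- The domain of the explicit flow. -/
def flowDomain (D : Ten) : Set C3 := {x | (lmat D x).det ≠ 0}

lemma hasDM_lmat (D : Ten) (x : C3) : HasDM (lmat D) (fun v => -bmat D v) x :=
  ((hasDM_const 1 x).sub (hasDM_linear (bmat_isLinearMap D) x)).congr_deriv fun v => by simp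

lemma isOpen_flowDomain (D : Ten) : IsOpen (flowDomain D) := by
  have : Continuous fun x => (lmat D x).det :=
    continuous_iff_continuousAt.mpr fun x => (hasDM_lmat D x).differentiableAt_det.continuousAt
  exact isOpen_ne_fun this continuous_const

lemma zero_mem_flowDomain (D : Ten) : (0 : C3) ∈ flowDomain D := by
  simp [flowDomain, lmat, bmat_zero]

lemma nmat_zero (D : Ten) : nmat D 0 = 1 := by simp [nmat, lmat, bmat_zero]

section
variable {D : Ten} {x : C3}

lemma lmat_mul_nmat (hx : x ∈ flowDomain D) : lmat D x * nmat D x = 1 :=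
  Matrix.mul_nonsing_inv _ (isUnit_iff_ne_zero.mpr hx)

lemma nmat_mul_lmat (hx : x ∈ flowDomain D) : nmat D x * lmat D x = 1 :=
  Matrix.nonsing_inv_mul _ (isUnit_iff_ne_zero.mpr hx)

lemma lmat_transpose : (lmat D x).transpose = lmat D x := by
  simp [lmat, bmat_transpose]

lemma nmat_transpose : (nmat D x).transpose = nmat D x := by
  rw [nmat, Matrix.transpose_nonsing_inv, lmat_transpose]

lemma bmat_commute_lmat (hD : D ∈ variety) (u : C3) : Commute (bmat D u) (lmat D x) :=
  (Commute.one_right _).sub_right (bmat_commute hD u x)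

lemma commute_nmat {M : Matrix (Fin 3) (Fin 3) ℂ} (h : Commute M (lmat D x))
    (hx : x ∈ flowDomain D) : Commute M (nmat D x) := by
  calc M * nmat D x = nmat D x * (lmat D x * M) * nmat D x := by
        rw [← Matrix.mul_assoc, nmat_mul_lmat hx, one_mul]
    _ = nmat D x * M := by
        rw [← h.eq, Matrix.mul_assoc, Matrix.mul_assoc, lmat_mul_nmat hx, mul_one]

lemma bmat_commute_nmat (hD : D ∈ variety) (hx : x ∈ flowDomain D) (u : C3) :
    Commute (bmat D u) (nmat D x) := commute_nmat (bmat_commute_lmat hD u) hx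

lemma gam_eq_bmat (i : Fin 3) : gam D i = (3 : ℂ) • bmat D (Pi.single i 1) := by
  rw [gam_eq_gamv, bmat, smul_smul]; norm_num

lemma gam_commute_nmat (hD : D ∈ variety) (hx : x ∈ flowDomain D) (i : Fin 3) :
    Commute (gam D i) (nmat D x) := by
  rw [gam_eq_bmat]; exact (bmat_commute_nmat hD hx _).smul_left _

lemma hasDM_nmat (hx : x ∈ flowDomain D) :
    HasDM (nmat D) (fun v => nmat D x * bmat D v * nmat D x) x :=
  ((hasDM_lmat D x).inv hx).congr_deriv fun v => by simp [nmat]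

end

/-- The translation flow through `D`. -/
def flow (D : Ten) (x : C3) : Ten := tenOfTensor fun i j k => (gam D i * nmat D x) j k

section
variable {D : Ten} (hD : D ∈ variety) {x : C3} (hx : x ∈ flowDomain D)
include hD hx

lemma gam_flow (i : Fin 3) : gam (flow D x) i = gam D i * nmat D x := by
  rw [flow, gam_tenOfTensor]
  · rfl
  · intro i j k
    simp only [Matrix.mul_apply, gam_apply]
    exact Finset.sum_congr rfl fun m _ => by rw [cub_comm₁₂]
  · intro i j k
    have h : (gam D i * nmat D x).transpose = gam D i * nmat D x := by
      rw [Matrix.transpose_mul, nmat_transpose, gam_transpose, (gam_commute_nmat hD hx i).eq]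
    exact (congrFun (congrFun h k) j :)

lemma gamv_flow (v : C3) : gamv (flow D x) v = gamv D v * nmat D x := by
  simp only [gamv, gam_flow hD hx, Matrix.sum_mul, Matrix.smul_mul]

lemma bmat_flow (v : C3) : bmat (flow D x) v = bmat D v * nmat D x := by
  simp only [bmat, gamv_flow hD hx, Matrix.smul_mul]

theorem flow_mem_variety : flow D x ∈ variety := by
  rw [mem_variety_iff]
  intro i l
  rw [gam_flow hD hx, gam_flow hD hx]
  have h1 := gam_commute_nmat hD hx
  exact (((show Commute _ _ from mem_variety_iff.mp hD i l).mul_right (h1 i)).mul_left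
    (((h1 l).symm).mul_right (Commute.refl _)))

/-- The resolvent N = (1 - B_x)⁻¹ has derivative N B_v N. As all matrices commute, Gᵢ N B_v N = ⅓
(G_v N)(Gᵢ N), which is the translation field at the point with matrices Gᵢ N. -/
theorem hasDV_flow : HasDV (flow D) (fun v => transField v (flow D x)) x := by
  have key : ∀ i j k, HasDD (fun y => (gam D i * nmat D y) j k)
      (fun v => cub (transField v (flow D x)) i j k) x := by
    intro i j k
    refine (((hasDM_const (gam D i) x).mul (hasDM_nmat hx)) j k).congr_deriv fun v => ?_
    rw [← gam_apply, gam_transField_of_mem (flow_mem_variety hD hx), gam_flow hD hx,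
      gamv_flow hD hx]
    have h1 := gam_commute_nmat hD hx i
    have h2 : Commute (bmat D v) (nmat D x) := bmat_commute_nmat hD hx v
    have h3 : Commute (gam D i) (bmat D v) := by
      rw [gam_eq_bmat]; exact (bmat_commute hD _ _).smul_left _
    have h4 : (1 / 3 : ℂ) • gamv D v = bmat D v := rfl
    have h5 : (0 : Matrix (Fin 3) (Fin 3) ℂ) * nmat D x + gam D i * (nmat D x * bmat D v * nmat D x)
        = (1 / 3 : ℂ) • (gamv D v * nmat D x * (gam D i * nmat D x)) := by
      rw [← Matrix.smul_mul, ← Matrix.smul_mul, h4, Matrix.zero_mul, zero_add, ← Matrix.mul_assoc,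
        ← Matrix.mul_assoc, h1.eq, ← Matrix.mul_assoc, Matrix.mul_assoc (nmat D x), h3.eq,
        ← Matrix.mul_assoc, h2.eq, Matrix.mul_assoc _ (gam D i), h1.eq, ← Matrix.mul_assoc]
    exact congrFun (congrFun h5 j) k
  intro n
  rw [show (fun v => transField v (flow D x) n)
    = fun v => tenOfTensor (cub (transField v (flow D x))) n by simp only [tenOfTensor_cub]]
  fin_cases n
  · exact key 0 1 0
  · exact key 0 2 0
  · exact (key 1 1 0).sub (key 0 0 0)
  · exact key 1 2 0
  · exact (key 2 2 0).sub (key 0 0 0)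
  · exact key 0 1 1
  · exact (key 1 1 1).sub (key 0 0 1)
  · exact key 1 2 1
  · exact (key 2 2 1).sub (key 0 0 1)
  · exact (key 2 2 2).sub (key 0 0 2)

end

lemma flow_zero (D : Ten) : flow D 0 = D := by
  simp only [flow, nmat_zero, Matrix.mul_one, gam_apply]
  exact tenOfTensor_cub D

section
variable {R : Matrix (Fin 3) (Fin 3) ℂ} (hR : IsRotation R) (D : Ten) (x : C3)
include hR

lemma bmat_rot (v : C3) : bmat (rot R D) (R.mulVec v) = R * bmat D v * R.transpose := by
  simp [bmat, gamv_rot hR]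

lemma lmat_rot : lmat (rot R D) (R.mulVec x) = R * lmat D x * R.transpose := by
  rw [lmat, bmat_rot hR, lmat, Matrix.mul_sub, Matrix.sub_mul, mul_one, hR.1]

lemma mem_flowDomain_rot : R.mulVec x ∈ flowDomain (rot R D) ↔ x ∈ flowDomain D := by
  simp [flowDomain, lmat_rot hR, hR.2]

variable {x}

lemma nmat_rot (hx : x ∈ flowDomain D) :
    nmat (rot R D) (R.mulVec x) = R * nmat D x * R.transpose := by
  rw [nmat, lmat_rot hR]
  apply Matrix.inv_eq_right_inv
  rw [conj_mul hR, lmat_mul_nmat hx, mul_one, hR.1]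

theorem flow_rot (hD : D ∈ variety) (hx : x ∈ flowDomain D) :
    flow (rot R D) (R.mulVec x) = rot R (flow D x) := by
  apply gam_injective
  intro i
  rw [gam_flow (rot_mem_variety hR hD) ((mem_flowDomain_rot hR D x).mpr hx), gam_rot' hR,
    nmat_rot hR D hx, conj_mul hR, gam_rot' hR, gamv_flow hD hx]

end

/-! ### Integral curves and uniqueness of the translation flow -/

lemma HasDV.exists_hasFDerivAt {ι : Type*} [Fintype ι] {f f' : C3 → ι → ℂ} {x : C3}
    (h : HasDV f f' x) : ∃ L : C3 →L[ℂ] (ι → ℂ), HasFDerivAt f L x ∧ ∀ v, L v = f' v :=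
  ⟨ContinuousLinearMap.pi fun i => fderiv ℂ (fun y => f y i) x,
    hasFDerivAt_pi.mpr fun i => (h i).1.hasFDerivAt, fun v => by ext i; exact (h i).2 v⟩

lemma HasDV.of_hasFDerivAt {ι : Type*} [Fintype ι] {f f' : C3 → ι → ℂ} {x : C3}
    {L : C3 →L[ℂ] (ι → ℂ)} (h : HasFDerivAt f L x) (hL : ∀ v, L v = f' v) : HasDV f f' x :=
  fun i => .of_hasFDerivAt (hasFDerivAt_pi'.mp h i) fun v => by rw [← hL]; rfl

lemma HasDV.hasDerivAt_line {ι : Type*} [Fintype ι] {f : C3 → ι → ℂ} {f' : C3 → ι → ℂ} {c v : C3}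
    {t : ℝ} (h : HasDV f f' (c + (t : ℂ) • v)) :
    HasDerivAt (fun s : ℝ => f (c + (s : ℂ) • v)) (f' v) t := by
  obtain ⟨L, hL, hL'⟩ := h.exists_hasFDerivAt
  have h1 : HasDerivAt (fun s : ℝ => c + (s : ℂ) • v) v t := by
    have : HasDerivAt (fun s : ℝ => (s : ℂ)) 1 t := Complex.ofRealCLM.hasDerivAt
    simpa using (this.smul_const v).const_add c
  rw [← hL']
  exact (hL.restrictScalars ℝ).comp_hasDerivAt t h1

/-- Both curves stay in one closed ball, where the polynomial field is Lipschitz; then uniqueness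
for ordinary differential equations applies. -/
theorem transCurve_unique {v : C3} {γ δ : ℝ → Ten} {a b : ℝ}
    (hγ : ∀ t ∈ Set.Icc a b, HasDerivWithinAt γ (transField v (γ t)) (Set.Icc a b) t)
    (hδ : ∀ t ∈ Set.Icc a b, HasDerivWithinAt δ (transField v (δ t)) (Set.Icc a b) t)
    (h : γ a = δ a) : Set.EqOn γ δ (Set.Icc a b) := by
  have cγ : ContinuousOn γ (Set.Icc a b) := fun t ht => (hγ t ht).continuousWithinAt
  have cδ : ContinuousOn δ (Set.Icc a b) := fun t ht => (hδ t ht).continuousWithinAt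
  obtain ⟨r, hr⟩ := (((isCompact_Icc.image_of_continuousOn cγ).union
    (isCompact_Icc.image_of_continuousOn cδ)).isBounded).subset_closedBall 0
  have hc : Continuous fun D => ‖fderiv ℂ (transField v) D‖₊ :=
    ((contDiff_transField v (n := 1)).continuous_fderiv (by simp)).nnnorm
  obtain ⟨K, hK⟩ := ((isCompact_closedBall (0 : Ten) r).image hc).bddAbove
  have hl : LipschitzOnWith K (transField v) (Metric.closedBall 0 r) :=
    (convex_closedBall (0 : Ten) r).lipschitzOnWith_of_nnnorm_fderiv_le (𝕜 := ℂ)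
      (fun x _ => (contDiff_transField v (n := 1)).differentiable (by simp) x)
      (fun x hx => hK ⟨x, hx, rfl⟩)
  have hd : ∀ {σ : ℝ → Ten} {t : ℝ} {s : Ten}, t ∈ Set.Ico a b →
      HasDerivWithinAt σ s (Set.Icc a b) t → HasDerivWithinAt σ s (Set.Ici t) t :=
    fun ht h => h.mono_of_mem_nhdsWithin (Icc_mem_nhdsGE_of_mem ht)
  exact ODE_solution_unique_of_mem_Icc_right (v := fun _ => transField v)
    (s := fun _ => Metric.closedBall 0 r) (fun t _ => hl) cγ
    (fun t ht => hd ht (hγ t (Set.Ico_subset_Icc_self ht)))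
    (fun t ht => hr (Or.inl ⟨t, Set.Ico_subset_Icc_self ht, rfl⟩)) cδ
    (fun t ht => hd ht (hδ t (Set.Ico_subset_Icc_self ht)))
    (fun t ht => hr (Or.inr ⟨t, Set.Ico_subset_Icc_self ht, rfl⟩)) h

/-- `Φ` satisfies the translation equations at `x`. -/
def SolvesTranslation (Φ : C3 → Ten) (x : C3) : Prop := HasDV Φ (fun v => transField v (Φ x)) x

/-- Restricted to the segment from the centre to x, both solutions are integral curves of the
translation x - c. -/
theorem eqOn_ball_of_solvesTranslation {Φ Ψ : C3 → Ten} {c : C3} {r : ℝ}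
    (hΦ : ∀ x ∈ Metric.ball c r, SolvesTranslation Φ x)
    (hΨ : ∀ x ∈ Metric.ball c r, SolvesTranslation Ψ x) (h : Φ c = Ψ c) :
    Set.EqOn Φ Ψ (Metric.ball c r) := by
  intro x hx
  have hmem : ∀ t ∈ Set.Icc (0 : ℝ) 1, c + (t : ℂ) • (x - c) ∈ Metric.ball c r := by
    intro t ht
    rw [mem_ball_iff_norm] at hx ⊢
    rw [add_sub_cancel_left, norm_smul, Complex.norm_real, Real.norm_of_nonneg ht.1]
    exact lt_of_le_of_lt (mul_le_of_le_one_left (norm_nonneg _) ht.2) hx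
  have := transCurve_unique (v := x - c) (γ := fun t : ℝ => Φ (c + (t : ℂ) • (x - c)))
    (δ := fun t : ℝ => Ψ (c + (t : ℂ) • (x - c))) (a := 0) (b := 1)
    (fun t ht => (hΦ _ (hmem t ht)).hasDerivAt_line.hasDerivWithinAt)
    (fun t ht => (hΨ _ (hmem t ht)).hasDerivAt_line.hasDerivWithinAt) (by simpa using h)
    (Set.right_mem_Icc.mpr zero_le_one)
  simpa using this

lemma SolvesTranslation.comp_sub {Φ : C3 → Ten} {x c : C3} (h : SolvesTranslation Φ (x - c)) :
    SolvesTranslation (fun y => Φ (y - c)) x := by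
  obtain ⟨L, hL, hL'⟩ := HasDV.exists_hasFDerivAt h
  have h1 : HasFDerivAt (fun y : C3 => y - c) (.id ℂ C3) x := (hasFDerivAt_id x).sub_const c
  exact HasDV.of_hasFDerivAt (hL.comp x h1) fun v => by simp [hL']

lemma solvesTranslation_flow {D : Ten} (hD : D ∈ variety) {x : C3} (hx : x ∈ flowDomain D) :
    SolvesTranslation (flow D) x := hasDV_flow hD hx

lemma exists_ball_subset_flowDomain (D : Ten) : ∃ r > 0, Metric.ball 0 r ⊆ flowDomain D :=
  Metric.isOpen_iff.mp (isOpen_flowDomain D) 0 (zero_mem_flowDomain D)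

theorem exists_translationFlow {D : Ten} (hD : D ∈ variety) : ∃ r > 0, ∃ Φ : C3 → Ten,
    IsTranslationFlow (Metric.ball 0 r) D Φ ∧ (∀ x ∈ Metric.ball 0 r, Φ x ∈ variety) ∧
    ∀ Ψ : C3 → Ten, IsTranslationFlow (Metric.ball 0 r) D Ψ →
      Set.EqOn Φ Ψ (Metric.ball 0 r) := by
  obtain ⟨r, hr, hsub⟩ := exists_ball_subset_flowDomain D
  refine ⟨r, hr, flow D, ⟨flow_zero D, fun x hx =>
    (hasDV_flow hD (hsub hx)).exists_hasFDerivAt⟩, fun x hx => flow_mem_variety hD (hsub hx),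
    fun Ψ hΨ => eqOn_ball_of_solvesTranslation (fun x hx => hasDV_flow hD (hsub hx))
      (fun x hx => ?_) (by rw [flow_zero, hΨ.1])⟩
  obtain ⟨L, hL, hL'⟩ := hΨ.2 x hx
  exact HasDV.of_hasFDerivAt hL hL'

/-- Near a point of the variety an integral curve is given by the flow. -/
lemma eq_flow_of_transCurve {v : C3} {γ : ℝ → Ten} {a b : ℝ}
    (hγ : ∀ t ∈ Set.Icc a b, HasDerivWithinAt γ (transField v (γ t)) (Set.Icc a b) t)
    (ha : γ a ∈ variety) (hd : ∀ t ∈ Set.Icc a b, ((t - a : ℝ) : ℂ) • v ∈ flowDomain (γ a)) :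
    ∀ t ∈ Set.Icc a b, γ t = flow (γ a) (((t - a : ℝ) : ℂ) • v) := by
  have h := transCurve_unique hγ (δ := fun t => flow (γ a) (((t - a : ℝ) : ℂ) • v))
    (fun t ht => ?_) (by simp [flow_zero])
  · exact h
  · have e : ∀ t : ℝ, ((t - a : ℝ) : ℂ) • v = -((a : ℂ) • v) + (t : ℂ) • v := fun t => by
      push_cast; module
    have h1 := hasDV_flow ha (hd t ht)
    simp only [e] at h1 ⊢
    exact h1.hasDerivAt_line.hasDerivWithinAt

lemma eventually_smul_mem_flowDomain (D : Ten) (v : C3) (a : ℝ) :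
    ∃ ε > 0, ∀ t : ℝ, |t - a| < ε → ((t - a : ℝ) : ℂ) • v ∈ flowDomain D := by
  have hc : Continuous fun t : ℝ => ((t - a : ℝ) : ℂ) • v := by fun_prop
  have h0 : ((a - a : ℝ) : ℂ) • v ∈ flowDomain D := by simpa using zero_mem_flowDomain D
  exact Metric.eventually_nhds_iff.mp
    (hc.continuousAt.eventually ((isOpen_flowDomain D).mem_nhds h0))

/-- Continuous induction: the times with values in the variety form a closed set, and from each of
them the curve continues for a while as the explicit flow, which stays in the variety. -/
theorem transCurve_mem_variety {v : C3} {γ : ℝ → Ten} (hγ : IsTranslationCurve v γ)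
    (h0 : γ 0 ∈ variety) : ∀ t ∈ Set.Icc (0 : ℝ) 1, γ t ∈ variety := by
  have cγ : ContinuousOn γ (Set.Icc 0 1) := fun t ht => (hγ t ht).continuousWithinAt
  have hvc : IsClosed variety := by
    have : variety = ⋂ k, {D | quadric D k = 0} := by ext; simp [variety]
    rw [this]
    refine isClosed_iInter fun k => isClosed_eq ?_ continuous_const
    fin_cases k <;> simp [quadric] <;> fun_prop
  have hcl : IsClosed ({t | γ t ∈ variety} ∩ Set.Icc (0 : ℝ) 1) := by
    rw [Set.inter_comm]; exact cγ.preimage_isClosed_of_isClosed isClosed_Icc hvc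
  refine fun t ht => (hcl.Icc_subset_of_forall_exists_gt (a := (0 : ℝ)) (b := 1) h0 ?_) ht
  rintro s ⟨hs, hs'⟩ y hy
  obtain ⟨ε, hε, hd⟩ := eventually_smul_mem_flowDomain (γ s) v s
  obtain ⟨z, hz1, hz2⟩ := exists_between (show s < min (min y 1) (s + ε) from
    lt_min (lt_min hy hs'.2) (by linarith))
  have hz3 := hz2.trans_le (min_le_left _ _)
  have hz4 : z ≤ 1 := hz3.le.trans (min_le_right _ _)
  have hz5 : z < s + ε := hz2.trans_le (min_le_right _ _)
  have hd' : ∀ t ∈ Set.Icc s z, ((t - s : ℝ) : ℂ) • v ∈ flowDomain (γ s) := fun t ht =>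
    hd t (by rw [abs_of_nonneg (by linarith [ht.1])]; linarith [ht.2])
  refine ⟨z, ?_, hz1, hz3.le.trans (min_le_left _ _)⟩
  have hsub : Set.Icc s z ⊆ Set.Icc 0 1 := Set.Icc_subset_Icc hs'.1 hz4
  have := eq_flow_of_transCurve (fun t ht => (hγ t (hsub ht)).mono hsub) hs hd' z
    ⟨hz1.le, le_rfl⟩
  change γ z ∈ variety
  rw [this]
  exact flow_mem_variety hs (hd' z ⟨hz1.le, le_rfl⟩)

/-! ### Partial derivatives of holomorphic functions are holomorphic -/

lemma hasDerivAt_complexLine {f : C3 → ℂ} {x u : C3} {z : ℂ} (h : DifferentiableAt ℂ f (x + z • u)) :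
    HasDerivAt (fun w : ℂ => f (x + w • u)) (fderiv ℂ f (x + z • u) u) z := by
  have h1 : HasDerivAt (fun w : ℂ => x + w • u) u z := by
    simpa using ((hasDerivAt_id z).smul_const u).const_add x
  exact h.hasFDerivAt.comp_hasDerivAt z h1

/-- Cauchy's estimate on each complex line through y. -/
lemma norm_fderiv_le_of_bound {f : C3 → ℂ} {y : C3} {R M : ℝ} (hR : 0 < R)
    (hd : ∀ z ∈ Metric.closedBall y R, DifferentiableAt ℂ f z)
    (hM : ∀ z ∈ Metric.closedBall y R, ‖f z‖ ≤ M) : ‖fderiv ℂ f y‖ ≤ M / R := by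
  have hM0 : 0 ≤ M := (norm_nonneg _).trans (hM y (Metric.mem_closedBall_self hR.le))
  refine ContinuousLinearMap.opNorm_le_of_unit_norm (div_nonneg hM0 hR.le) fun u hu => ?_
  have hmem : ∀ z : ℂ, ‖z‖ ≤ R → y + z • u ∈ Metric.closedBall y R := fun z hz => by
    rw [mem_closedBall_iff_norm, add_sub_cancel_left, norm_smul, hu, mul_one]; exact hz
  have h0 := (hasDerivAt_complexLine (x := y) (u := u) (z := 0)
    (hd _ (hmem 0 (by simpa using hR.le)))).deriv
  rw [zero_smul, add_zero] at h0
  rw [← h0]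
  refine Complex.norm_deriv_le_of_forall_mem_sphere_norm_le hR ?_ fun z hz => hM _ (hmem z ?_)
  · refine DifferentiableOn.diffContOnCl fun z hz => ?_
    rw [closure_ball _ hR.ne', mem_closedBall_zero_iff] at hz
    exact (hasDerivAt_complexLine (hd _ (hmem z hz))).differentiableAt.differentiableWithinAt
  · rw [mem_sphere_zero_iff_norm] at hz; exact hz.le

lemma fderiv_apply_eq_integral {f : C3 → ℂ} {x u : C3} {R : ℝ} {U : Set C3} (hU : IsOpen U)
    (hf : DifferentiableOn ℂ f U) (hR : 0 < R) (hu : ‖u‖ ≤ 1) (hx : Metric.closedBall x R ⊆ U) :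
    fderiv ℂ f x u = (2 * Real.pi * Complex.I : ℂ)⁻¹ • ∫ θ in (0 : ℝ)..2 * Real.pi,
      (deriv (circleMap 0 R) θ * (circleMap 0 R θ ^ 2)⁻¹) • f (x + circleMap 0 R θ • u) := by
  have hc : Continuous fun z : ℂ => x + z • u := by fun_prop
  have hmem : ∀ z : ℂ, ‖z‖ ≤ R → x + z • u ∈ U := fun z hz => hx <| by
    rw [mem_closedBall_iff_norm, add_sub_cancel_left, norm_smul]
    exact (mul_le_of_le_one_right (norm_nonneg _) hu).trans hz
  have h := Complex.two_pi_I_inv_smul_circleIntegral_sub_sq_inv_smul_of_differentiable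
    (hU.preimage hc) (c := 0) (w₀ := 0) (R := R) (f := fun z => f (x + z • u))
    (fun z hz => hmem z (by simpa using hz))
    (fun z hz => (hasDerivAt_complexLine
      (hf.differentiableAt (hU.mem_nhds hz))).differentiableAt.differentiableWithinAt)
    (Metric.mem_ball_self hR)
  have h0 := (hasDerivAt_complexLine (x := x) (u := u) (z := 0)
    (hf.differentiableAt (hU.mem_nhds (hmem 0 (by simpa using hR.le))))).deriv
  rw [zero_smul, add_zero] at h0
  rw [← h0, ← h, circleIntegral]
  simp only [sub_zero, smul_eq_mul, mul_assoc]

/-- Cauchy's formula on complex lines in the direction u writes the derivative as an integral of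
values of f; this is differentiated under the integral sign, with Cauchy's estimate as the
dominating bound. -/
theorem differentiableOn_fderiv_apply {f : C3 → ℂ} {U : Set C3} (hU : IsOpen U)
    (hf : DifferentiableOn ℂ f U) {u : C3} (hu : ‖u‖ ≤ 1) :
    DifferentiableOn ℂ (fun x => fderiv ℂ f x u) U := by
  intro x₀ hx₀
  obtain ⟨ε, hε, hball⟩ := Metric.isOpen_iff.mp hU x₀ hx₀
  -- One R each for the variation of the centre, for the circle in Cauchy's formula and for Cauchy's
  -- estimate at the points of the circle.
  obtain ⟨R, hR, hR3⟩ : ∃ R > 0, 3 * R < ε := ⟨ε / 4, by linarith, by linarith⟩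
  have hsub : Metric.closedBall x₀ (3 * R) ⊆ U :=
    (Metric.closedBall_subset_ball hR3).trans hball
  obtain ⟨M, hM⟩ := ((isCompact_closedBall x₀ (3 * R)).exists_bound_of_continuousOn
    (hf.continuousOn.mono hsub))
  have hM0 : 0 ≤ M := (norm_nonneg _).trans (hM x₀ (Metric.mem_closedBall_self (by linarith)))
  set c : ℝ → ℂ := fun θ => deriv (circleMap 0 R) θ * (circleMap 0 R θ ^ 2)⁻¹ with hc
  have hne : ∀ θ, circleMap 0 R θ ≠ 0 := fun θ => circleMap_ne_center hR.ne'
  have hcc : Continuous c := by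
    simp only [hc, deriv_circleMap]
    exact ((continuous_circleMap 0 R).mul continuous_const).mul
      (((continuous_circleMap 0 R).pow 2).inv₀ fun θ => pow_ne_zero 2 (hne θ))
  have hcn : ∀ θ, ‖c θ‖ ≤ R⁻¹ := fun θ => by
    simp only [hc, deriv_circleMap, norm_mul, norm_inv, norm_pow, norm_circleMap_zero,
      Complex.norm_I, abs_of_pos hR]
    apply le_of_eq; field_simp
  have hdist : ∀ x ∈ Metric.ball x₀ R, ∀ θ, ∀ y ∈ Metric.closedBall (x + circleMap 0 R θ • u) R,
      y ∈ Metric.closedBall x₀ (3 * R) := by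
    intro x hx θ y hy
    rw [mem_closedBall_iff_norm] at hy ⊢
    rw [mem_ball_iff_norm] at hx
    have h1 : ‖circleMap 0 R θ • u‖ ≤ R := by
      rw [norm_smul, norm_circleMap_zero, abs_of_pos hR]
      exact mul_le_of_le_one_right hR.le hu
    calc ‖y - x₀‖ = ‖(y - (x + circleMap 0 R θ • u)) + circleMap 0 R θ • u + (x - x₀)‖ := by
          congr 1; abel
      _ ≤ R + R + R := (norm_add_le _ _).trans (add_le_add ((norm_add_le _ _).trans
          (add_le_add hy h1)) hx.le)
      _ = 3 * R := by ring
  have hdist' : ∀ x ∈ Metric.ball x₀ R, ∀ θ, x + circleMap 0 R θ • u ∈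
      Metric.closedBall x₀ (3 * R) := fun x hx θ =>
    hdist x hx θ _ (Metric.mem_closedBall_self hR.le)
  have hdiff : ∀ y ∈ Metric.closedBall x₀ (3 * R), DifferentiableAt ℂ f y := fun y hy =>
    hf.differentiableAt (hU.mem_nhds (hsub hy))
  have hcont : ∀ x, Continuous fun θ => x + circleMap 0 R θ • u := fun x => by
    have := continuous_circleMap 0 R; fun_prop
  have hFc : ∀ x ∈ Metric.ball x₀ R, Continuous fun θ => c θ • f (x + circleMap 0 R θ • u) :=
    fun x hx => hcc.smul ((hf.continuousOn.mono hsub).comp_continuous (hcont x) (hdist' x hx))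
  have key := intervalIntegral.hasFDerivAt_integral_of_dominated_of_fderiv_le (𝕜 := ℂ)
    (μ := MeasureTheory.volume) (a := 0) (b := 2 * Real.pi)
    (F := fun x θ => c θ • f (x + circleMap 0 R θ • u))
    (F' := fun x θ => c θ • fderiv ℂ f (x + circleMap 0 R θ • u))
    (s := Metric.ball x₀ R) (x₀ := x₀) (bound := fun _ => R⁻¹ * (M / R))
    (Metric.ball_mem_nhds x₀ hR)
    (Filter.eventually_of_mem (Metric.ball_mem_nhds x₀ hR) fun x hx =>
      (hFc x hx).aestronglyMeasurable)
    ((hFc x₀ (Metric.mem_ball_self hR)).intervalIntegrable _ _)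
    ((hcc.measurable.smul ((measurable_fderiv ℂ f).comp
      (hcont x₀).measurable)).aestronglyMeasurable)
    (Filter.Eventually.of_forall fun θ _ x hx => by
      rw [norm_smul]
      exact mul_le_mul (hcn θ) (norm_fderiv_le_of_bound hR
        (fun z hz => hdiff z (hdist x hx θ z hz)) (fun z hz => hM z (hdist x hx θ z hz)))
        (norm_nonneg _) (inv_nonneg.mpr hR.le))
    intervalIntegrable_const
    (Filter.Eventually.of_forall fun θ _ x hx => by
      have h1 : HasFDerivAt (fun x : C3 => x + circleMap 0 R θ • u) (.id ℂ C3) x :=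
        (hasFDerivAt_id x).add_const _
      have h2 := ((hdiff _ (hdist' x hx θ)).hasFDerivAt.comp x h1).const_smul (c θ)
      exact h2.congr_fderiv (by simp))
  have heq : (fun x => fderiv ℂ f x u) =ᶠ[𝓝 x₀] fun x => (2 * Real.pi * Complex.I : ℂ)⁻¹ •
      ∫ θ in (0 : ℝ)..2 * Real.pi, c θ • f (x + circleMap 0 R θ • u) := by
    refine Filter.eventually_of_mem (Metric.ball_mem_nhds x₀ hR) fun x hx => ?_
    refine fderiv_apply_eq_integral hU hf hR hu fun y hy => hsub ?_
    rw [mem_closedBall_iff_norm] at hy ⊢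
    rw [mem_ball_iff_norm] at hx
    calc ‖y - x₀‖ = ‖(y - x) + (x - x₀)‖ := by congr 1; abel
      _ ≤ R + R := (norm_add_le _ _).trans (add_le_add hy hx.le)
      _ ≤ 3 * R := by linarith
  have hd := key.differentiableAt.const_smul ((2 * Real.pi * Complex.I : ℂ)⁻¹)
  exact (DifferentiableAt.congr_of_eventuallyEq hd heq).differentiableWithinAt

theorem differentiableOn_pd {f : C3 → ℂ} {U : Set C3} (hU : IsOpen U)
    (hf : DifferentiableOn ℂ f U) (i : Fin 3) : DifferentiableOn ℂ (pd i f) U :=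
  differentiableOn_fderiv_apply hU hf <| by
    rw [pi_norm_le_iff_of_nonneg zero_le_one]
    intro j
    rcases eq_or_ne j i with rfl | h
    · simp
    · simp [h]

theorem pd_comm {f : C3 → ℂ} {U : Set C3} (hU : IsOpen U) (hf : DifferentiableOn ℂ f U) {x : C3}
    (hx : x ∈ U) (i j : Fin 3) : pd i (pd j f) x = pd j (pd i f) x := by
  have hd : ∀ i, DifferentiableAt ℂ (pd i f) x := fun i =>
    (differentiableOn_pd hU hf i).differentiableAt (hU.mem_nhds hx)
  have hdf : DifferentiableAt ℂ (fderiv ℂ f) x := by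
    have : fderiv ℂ f = fun y => ∑ i, pd i f y • (ContinuousLinearMap.proj i : C3 →L[ℂ] ℂ) := by
      ext1 y; ext1 v
      rw [fderiv_eq_sum_pd]
      simp [mul_comm]
    rw [this]
    exact DifferentiableAt.fun_sum fun i _ => (hd i).smul_const _
  have hs := second_derivative_symmetric_of_eventually (𝕜 := ℂ) (f := f) (f' := fderiv ℂ f) (x := x)
    (Filter.eventually_of_mem (hU.mem_nhds hx) fun y hy =>
      (hf.differentiableAt (hU.mem_nhds hy)).hasFDerivAt) hdf.hasFDerivAt
    (Pi.single i 1) (Pi.single j 1)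
  have h : ∀ i j, pd i (pd j f) x = fderiv ℂ (fderiv ℂ f) x (Pi.single i 1) (Pi.single j 1) := by
    intro i j
    have := (hdf.hasFDerivAt.clm_apply (hasFDerivAt_const (Pi.single j (1 : ℂ) : C3) x)).fderiv
    change fderiv ℂ (fun y => fderiv ℂ f y (Pi.single j 1)) x (Pi.single i 1) = _
    rw [this]; simp
  rw [h, h, hs]

/-! ### Potentials in terms of the symmetric tensor -/

/-- The fifteen coefficients belonging to a ten-tuple. -/
def coeffs (D : Ten) : Coeffs :=
  ![tensor D 1 1, tensor D 2 2, tensor D 0 1, tensor D 0 2, tensor D 1 2]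

lemma tenOf_coeffs (D : Ten) : tenOf (coeffs D) = D := by
  ext n; fin_cases n <;> simp [tenOf, coeffs, tensor]

/-- At `x`, the Hessian of `V` is `δᵢⱼ F + ∑ₖ Gᵢⱼₖ Vₖ`. -/
def HasHessian (D : Ten) (F : ℂ) (V : C3 → ℂ) (x : C3) : Prop :=
  ∀ i j, pd i (pd j V) x = (if i = j then F else 0) + ∑ k, cub D i j k * pd k V x

/-- Passing from `tensor` to `cub` changes V₁₁ into F = V₁₁ - ∑ G₁₁ₖ Vₖ. The five equations then
become one statement about the Hessian that is symmetric in all coordinates. -/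
theorem isPotential_iff {K : C3 → Coeffs} {E : C3 → Ten} {N : Set C3} {V : C3 → ℂ} (hN : IsOpen N)
    (hK : ∀ x ∈ N, K x = coeffs (E x)) :
    IsPotential K N V ↔ DifferentiableOn ℂ V N ∧ ∀ x ∈ N, ∃ F, HasHessian (E x) F V x := by
  refine and_congr_right fun hd => forall₂_congr fun x hx => ?_
  have h10 := pd_comm hN hd hx 1 0
  have h20 := pd_comm hN hd hx 2 0
  have h21 := pd_comm hN hd hx 2 1
  rw [hK x hx]
  simp only [HasHessian, coeffs, Fin.sum_univ_three]
  constructor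
  · rintro ⟨e1, e2, e3, e4, e5⟩
    refine ⟨pd 0 (pd 0 V) x - ∑ k, cub (E x) 0 0 k * pd k V x, fun i j => ?_⟩
    fin_cases i <;> fin_cases j <;>
      simp [cub, tensor, Fin.sum_univ_three] at * <;> grind
  · rintro ⟨F, h⟩
    have h00 := h 0 0
    refine ⟨?_, ?_, ?_, ?_, ?_⟩
    · have := h 1 1; simp [cub, tensor] at *; grind
    · have := h 2 2; simp [cub, tensor] at *; grind
    · have := h 0 1; simp [cub, tensor] at *; grind
    · have := h 0 2; simp [cub, tensor] at *; grind
    · have := h 1 2; simp [cub, tensor] at *; grind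

/-! ### Constants of the motion -/

lemma fderiv_quadFun {a : C3 → Matrix (Fin 3) (Fin 3) ℂ} {W : C3 → ℂ} {x : C3}
    (ha : ∀ j k, DifferentiableAt ℂ (fun y => a y j k) x) (hW : DifferentiableAt ℂ W x)
    (p u η : C3) : fderiv ℂ (quadFun a W) (x, p) (u, η)
      = ∑ j, ∑ k, (fderiv ℂ (fun y => a y j k) x u * p j * p k
          + a x j k * η j * p k + a x j k * p j * η k) + fderiv ℂ W x u := by
  have hp : ∀ j, HasFDerivAt (fun z : Phase => z.2 j)
      ((ContinuousLinearMap.proj j : C3 →L[ℂ] ℂ).comp (.snd ℂ C3 C3)) (x, p) := fun j =>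
    ((ContinuousLinearMap.proj j : C3 →L[ℂ] ℂ).comp (.snd ℂ C3 C3)).hasFDerivAt
  have h1 : ∀ j k, HasFDerivAt (fun z : Phase => a z.1 j k)
      ((fderiv ℂ (fun y => a y j k) x).comp (.fst ℂ C3 C3)) (x, p) := fun j k =>
    HasFDerivAt.comp (x, p) (g := fun y => a y j k) (ha j k).hasFDerivAt hasFDerivAt_fst
  have h2 : HasFDerivAt (fun z : Phase => W z.1) ((fderiv ℂ W x).comp (.fst ℂ C3 C3)) (x, p) :=
    HasFDerivAt.comp (x, p) hW.hasFDerivAt hasFDerivAt_fst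
  have h : HasFDerivAt (quadFun a W) _ (x, p) := (HasFDerivAt.fun_sum fun j _ =>
    HasFDerivAt.fun_sum fun k _ => ((h1 j k).mul (hp j)).mul (hp k)).add h2
  rw [h.fderiv]
  simp only [add_apply, sum_apply, ContinuousLinearMap.comp_apply, smul_apply,
    ContinuousLinearMap.coe_fst', ContinuousLinearMap.coe_snd', ContinuousLinearMap.proj_apply,
    smul_eq_mul, Pi.mul_apply]
  congr 1
  exact Finset.sum_congr rfl fun j _ => Finset.sum_congr rfl fun k _ => by ring

lemma fderiv_hamiltonian {V : C3 → ℂ} {x : C3} (hV : DifferentiableAt ℂ V x) (p u η : C3) :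
    fderiv ℂ (hamiltonian V) (x, p) (u, η) = 2 * ∑ j, p j * η j + fderiv ℂ V x u := by
  have : hamiltonian V = quadFun (fun _ => 1) V := by
    ext z; simp [hamiltonian, quadFun, Fin.sum_univ_three, Matrix.one_apply]; ring
  rw [this, fderiv_quadFun (a := fun _ => 1) (fun _ _ => differentiableAt_const _) hV]
  simp [Fin.sum_univ_three, Matrix.one_apply]; ring

/-- The bracket has a part linear in p, which carries ∇W = a∇V, and a cubic part, which carries the
Killing equations. -/
lemma poisson_eq {V W : C3 → ℂ} {a : C3 → Matrix (Fin 3) (Fin 3) ℂ} {x : C3}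
    (hV : DifferentiableAt ℂ V x) (hW : DifferentiableAt ℂ W x) (hs : (a x).IsSymm)
    (ha : ∀ j k, DifferentiableAt ℂ (fun y => a y j k) x) (p : C3) :
    poisson (hamiltonian V) (quadFun a W) (x, p)
      = 2 * ∑ j, p j * (∑ k, a x j k * pd k V x - pd j W x)
        - 2 * ∑ j, ∑ k, ∑ l, pd j (fun y => a y k l) x * p j * p k * p l := by
  have h10 : a x 1 0 = a x 0 1 := hs.apply 0 1
  have h20 : a x 2 0 = a x 0 2 := hs.apply 0 2
  have h21 : a x 2 1 = a x 1 2 := hs.apply 1 2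
  simp only [poisson, fderiv_hamiltonian hV, fderiv_quadFun ha hW, pd]
  simp [Fin.sum_univ_three, h10, h20, h21]
  ring

/-- The conditions for a constant of the motion: the Killing equations and `∇W = a ∇V`. -/
lemma isConstantOfMotion_of {V W : C3 → ℂ} {a : C3 → Matrix (Fin 3) (Fin 3) ℂ} {N : Set C3}
    (hN : IsOpen N) (hV : DifferentiableOn ℂ V N) (hW : DifferentiableOn ℂ W N)
    (hs : ∀ x ∈ N, (a x).IsSymm) (ha : ∀ j k, DifferentiableOn ℂ (fun y => a y j k) N)
    (hK : ∀ x ∈ N, ∀ j k l, pd j (fun y => a y k l) x + pd k (fun y => a y l j) x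
      + pd l (fun y => a y j k) x = 0)
    (hWV : ∀ x ∈ N, ∀ j, pd j W x = ∑ k, a x j k * pd k V x) :
    IsConstantOfMotion N V a W := by
  refine ⟨hW, fun x hx p => ?_⟩
  have hn := hN.mem_nhds hx
  rw [poisson_eq (hV.differentiableAt hn) (hW.differentiableAt hn) (hs x hx)
    (fun j k => (ha j k).differentiableAt hn)]
  have h3 : ∑ j, ∑ k, ∑ l, pd j (fun y => a y k l) x * p j * p k * p l = 0 := by
    have e : ∀ f : Fin 3 → Fin 3 → Fin 3 → ℂ,
        ∑ j, ∑ k, ∑ l, f j k l = ∑ j, ∑ k, ∑ l, f k l j ∧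
        ∑ j, ∑ k, ∑ l, f j k l = ∑ j, ∑ k, ∑ l, f l j k := by
      intro f; simp only [Fin.sum_univ_three]; constructor <;> ring
    set f : Fin 3 → Fin 3 → Fin 3 → ℂ := fun j k l =>
      pd j (fun y => a y k l) x * p j * p k * p l with hf
    have h0 : ∑ j, ∑ k, ∑ l, (f j k l + f k l j + f l j k) = 0 :=
      Finset.sum_eq_zero fun j _ => Finset.sum_eq_zero fun k _ => Finset.sum_eq_zero fun l _ => by
        linear_combination p j * p k * p l * hK x hx j k l
    simp only [Finset.sum_add_distrib] at h0
    rw [← (e f).1, ← (e f).2] at h0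
    linear_combination h0 / 3
  rw [h3]
  simp [hWV x hx]

/-- A cubic form vanishes only if its symmetrized coefficients do. -/
lemma cubic_eq_zero {b : Fin 3 → ℂ} {f : Fin 3 → Fin 3 → Fin 3 → ℂ}
    (hf : ∀ j k l, f j k l = f j l k)
    (h : ∀ p : C3, ∑ j, p j * b j - ∑ j, ∑ k, ∑ l, f j k l * p j * p k * p l = 0) :
    (∀ j, b j = 0) ∧ ∀ j k l, f j k l + f k l j + f l j k = 0 := by
  -- The degrees one and three are separated by evaluating at p and at 2p.
  have h1 : ∀ (p : C3) (t : ℂ), t * ∑ j, p j * b j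
      - t ^ 3 * ∑ j, ∑ k, ∑ l, f j k l * p j * p k * p l = 0 := fun p t => by
    rw [← h (t • p)]
    simp [Fin.sum_univ_three]; ring
  have h2 : ∀ p : C3, ∑ j, p j * b j = 0 ∧ ∑ j, ∑ k, ∑ l, f j k l * p j * p k * p l = 0 := fun p =>
    ⟨by linear_combination (8 * h1 p 1 - h1 p 2) / 6, by linear_combination (2 * h1 p 1 - h1 p 2) / 6⟩
  refine ⟨fun j => ?_, fun j k l => ?_⟩
  · have := (h2 (Pi.single j 1)).1
    simpa [Pi.single_apply] using this
  · have hp := fun x y z : ℂ => (h2 ![x, y, z]).2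
    simp only [Fin.sum_univ_three, Matrix.cons_val] at hp
    have s1 := fun j => hf j 1 0
    have s2 := fun j => hf j 2 0
    have s3 := fun j => hf j 2 1
    simp only [s1, s2, s3] at hp
    have a100 := hp 1 0 0; have a010 := hp 0 1 0; have a001 := hp 0 0 1
    have a110 := hp 1 1 0; have a101 := hp 1 0 1; have a011 := hp 0 1 1
    have b110 := hp 1 (-1) 0; have b101 := hp 1 0 (-1); have b011 := hp 0 1 (-1)
    have a111 := hp 1 1 1
    fin_cases j <;> fin_cases k <;> fin_cases l <;> simp [s1, s2, s3] <;> grind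

lemma IsConstantOfMotion.conditions {V W : C3 → ℂ} {a : C3 → Matrix (Fin 3) (Fin 3) ℂ} {N : Set C3}
    (hN : IsOpen N) (hV : DifferentiableOn ℂ V N)
    (hs : ∀ x ∈ N, (a x).IsSymm) (ha : ∀ j k, DifferentiableOn ℂ (fun y => a y j k) N)
    (h : IsConstantOfMotion N V a W) {x : C3} (hx : x ∈ N) :
    (∀ j, pd j W x = ∑ k, a x j k * pd k V x) ∧
    ∀ j k l, pd j (fun y => a y k l) x + pd k (fun y => a y l j) x
      + pd l (fun y => a y j k) x = 0 := by
  have hn := hN.mem_nhds hx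
  have hsymm : ∀ j k l, pd j (fun y => a y k l) x = pd j (fun y => a y l k) x := by
    intro j k l
    have : (fun y => a y k l) =ᶠ[𝓝 x] fun y => a y l k :=
      Filter.eventually_of_mem hn fun y hy => (hs y hy).apply l k
    simp only [pd, this.fderiv_eq]
  obtain ⟨h1, h2⟩ := cubic_eq_zero (b := fun j => ∑ k, a x j k * pd k V x - pd j W x)
    (f := fun j k l => pd j (fun y => a y k l) x) hsymm fun p => by
      have := h.2 x hx p
      rw [poisson_eq (hV.differentiableAt hn) (h.1.differentiableAt hn) (hs x hx)
        (fun j k => (ha j k).differentiableAt hn)] at this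
      linear_combination this / 2
  exact ⟨fun j => by linear_combination -h1 j, h2⟩

/-! ### Explicit potentials and quadratic constants of the motion -/

open Matrix in
lemma mulVec_dotProduct_of_transpose {M : Matrix (Fin 3) (Fin 3) ℂ} (hM : M.transpose = M)
    (u v : C3) : M *ᵥ u ⬝ᵥ v = u ⬝ᵥ M *ᵥ v := by
  rw [dotProduct_mulVec, ← mulVec_transpose, hM]

/-- The vector `2 x - x·x`. -/
def yvec (D : Ten) (x : C3) : C3 := (2 : ℂ) • x - (bmat D x).mulVec x

/-- The vector `(1 - x)⁻² (2 x - x·x)`. -/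
def qvec (D : Ten) (x : C3) : C3 := (nmat D x * nmat D x).mulVec (yvec D x)

/-- The potential with parameters `c`, `w` and `F`. -/
def pot (D : Ten) (c : ℂ) (w : C3) (F : ℂ) (x : C3) : ℂ :=
  c + (1 / 2 * (w ⬝ᵥ qvec D x) + F / 8 * (yvec D x ⬝ᵥ qvec D x))

/-- The gradient of the potential. -/
def potGrad (D : Ten) (w : C3) (F : ℂ) (x : C3) : C3 :=
  (nmat D x * nmat D x * nmat D x).mulVec
    (w + (F / 4) • (yvec D x + (lmat D x * lmat D x).mulVec (yvec D x)))

/-- The Killing tensor that starts with the symmetric form `A`. -/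
def killing (D : Ten) (A : Matrix (Fin 3) (Fin 3) ℂ) (x : C3) : Matrix (Fin 3) (Fin 3) ℂ :=
  lmat D x * A * lmat D x + bmat D (A.mulVec (yvec D x))

/-- The potential term of the constant of the motion that belongs to `killing`. -/
def killingPot (D : Ten) (A : Matrix (Fin 3) (Fin 3) ℂ) (w : C3) (F : ℂ) (x : C3) : ℂ :=
  1 / 2 * (A.mulVec (yvec D x) ⬝ᵥ (nmat D x * nmat D x).mulVec w)
    + F / 8 * (A.mulVec (yvec D x) ⬝ᵥ qvec D x)

open Matrix

lemma hasDV_yvec (D : Ten) (x : C3) : HasDV (yvec D) (fun v => (2 : ℂ) • lmat D x *ᵥ v) x := by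
  refine (((hasDV_id x).const_smul 2).sub
    ((hasDM_linear (bmat_isLinearMap D) x).mulVec (hasDV_id x))).congr_deriv fun v => ?_
  rw [bmat_mulVec_comm D v x, lmat, sub_mulVec, one_mulVec]
  module

lemma yvec_zero (D : Ten) : yvec D 0 = 0 := by simp [yvec]

lemma killing_transpose {D : Ten} {A : Matrix (Fin 3) (Fin 3) ℂ} (hA : A.transpose = A) (x : C3) :
    (killing D A x).transpose = killing D A x := by
  rw [killing, transpose_add, transpose_mul, transpose_mul, lmat_transpose, hA, bmat_transpose,
    Matrix.mul_assoc]

lemma killing_zero (D : Ten) (A : Matrix (Fin 3) (Fin 3) ℂ) : killing D A 0 = A := by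
  simp [killing, yvec_zero, lmat, bmat_zero]

section
variable {D : Ten} (hD : D ∈ variety)
include hD

/-- With a unit adjoined, y = 2x - x² is 1 - (1 - x)², and accordingly `qvec` plays the role of (1 -
x)⁻² - 1. This dictionary makes the later derivatives those of one-variable calculus. -/
lemma bmat_yvec (x : C3) : bmat D (yvec D x) = 1 - lmat D x * lmat D x := by
  rw [yvec, bmat_sub, bmat_smul, bmat_bmat_mulVec hD, lmat]
  simp only [Matrix.mul_sub, Matrix.sub_mul, Matrix.one_mul, Matrix.mul_one]
  module

lemma bmat_mulVec_yvec (x v : C3) :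
    bmat D v *ᵥ yvec D x = (1 - lmat D x * lmat D x) *ᵥ v := by
  rw [bmat_mulVec_comm, bmat_yvec hD]

lemma killing_one (x : C3) : killing D 1 x = 1 := by
  rw [killing, Matrix.mul_one, one_mulVec, bmat_yvec hD, add_sub_cancel]

variable {x : C3} (hx : x ∈ flowDomain D)
include hx

lemma hasDM_nmat_mul_nmat : HasDM (fun y => nmat D y * nmat D y)
    (fun v => (2 : ℂ) • (nmat D x * nmat D x * nmat D x * bmat D v)) x := by
  refine ((hasDM_nmat hx).mul (hasDM_nmat hx)).congr_deriv fun v => ?_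
  have h := (bmat_commute_nmat hD hx v).eq
  simp only [Matrix.mul_assoc, h]
  module

lemma hasDM_nmat_cube : HasDM (fun y => nmat D y * nmat D y * nmat D y)
    (fun v => (3 : ℂ) • (nmat D x * bmat D v * (nmat D x * nmat D x * nmat D x))) x := by
  refine ((hasDM_nmat_mul_nmat hD hx).mul (hasDM_nmat hx)).congr_deriv fun v => ?_
  have h := (bmat_commute_nmat hD hx v).eq
  simp only [Matrix.smul_mul, ← Matrix.mul_assoc, ← h]
  simp only [Matrix.mul_assoc, ← h]
  simp only [← Matrix.mul_assoc, ← h]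
  module

omit hD in
lemma nmat_cube_lmat : nmat D x * nmat D x * nmat D x * lmat D x = nmat D x * nmat D x := by
  rw [Matrix.mul_assoc, nmat_mul_lmat hx, Matrix.mul_one]

omit hD in
lemma nmat_sq_lmat : nmat D x * nmat D x * lmat D x = nmat D x := by
  rw [Matrix.mul_assoc, nmat_mul_lmat hx, Matrix.mul_one]

/-- This is d((1 - x)⁻² - 1) = 2 (1 - x)⁻³ dx; the term with y is simplified by B_v y = (1 - L²) v.
-/
lemma hasDV_qvec : HasDV (qvec D) (fun v => (2 : ℂ) • (nmat D x * nmat D x * nmat D x) *ᵥ v) x := by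
  refine ((hasDM_nmat_mul_nmat hD hx).mulVec (hasDV_yvec D x)).congr_deriv fun v => ?_
  rw [smul_mulVec, ← mulVec_mulVec, bmat_mulVec_yvec hD, mulVec_smul, ← smul_add, mulVec_mulVec,
    mulVec_mulVec, ← add_mulVec, Matrix.mul_sub, Matrix.mul_one, ← Matrix.mul_assoc,
    nmat_cube_lmat hx, nmat_sq_lmat hx, sub_add_cancel]

omit hx hD in
lemma nmat_sq_transpose : (nmat D x * nmat D x).transpose = nmat D x * nmat D x := by
  rw [transpose_mul, nmat_transpose]

omit hx hD in
lemma nmat_cube_transpose :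
    (nmat D x * nmat D x * nmat D x).transpose = nmat D x * nmat D x * nmat D x := by
  rw [transpose_mul, nmat_sq_transpose, nmat_transpose, Matrix.mul_assoc]

theorem hasDD_pot (c : ℂ) (w : C3) (F : ℂ) :
    HasDD (pot D c w F) (fun v => potGrad D w F x ⬝ᵥ v) x := by
  have hq := hasDV_qvec hD hx
  refine ((hasDD_const c x).add ((((hasDV_const w x).dotProduct hq).const_mul _).add
    (((hasDV_yvec D x).dotProduct hq).const_mul _))).congr_deriv fun v => ?_
  have e : lmat D x *ᵥ v ⬝ᵥ qvec D x
      = yvec D x ⬝ᵥ (nmat D x * nmat D x * nmat D x * (lmat D x * lmat D x)) *ᵥ v := by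
    rw [dotProduct_comm, qvec, mulVec_dotProduct_of_transpose nmat_sq_transpose, mulVec_mulVec,
      ← Matrix.mul_assoc, nmat_cube_lmat hx]
  rw [potGrad, mulVec_dotProduct_of_transpose nmat_cube_transpose, add_dotProduct,
    smul_dotProduct (F / 4), add_dotProduct, mulVec_dotProduct_of_transpose (by
      rw [transpose_mul, lmat_transpose]), mulVec_mulVec]
  have e2 : lmat D x * lmat D x * (nmat D x * nmat D x * nmat D x)
      = nmat D x * nmat D x * nmat D x * (lmat D x * lmat D x) := by
    have h : Commute (lmat D x) (nmat D x) := by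
      rw [Commute, SemiconjBy, lmat_mul_nmat hx, nmat_mul_lmat hx]
    exact (((h.mul_right h).mul_right h).mul_left ((h.mul_right h).mul_right h)).eq
  rw [e2]
  simp only [zero_dotProduct, smul_dotProduct, dotProduct_smul, e, smul_eq_mul]
  ring

/-- The gradient is N³ s with ds = F L³ v. Since d(N³) = 3 N B_v N³ = G_v(flow) N³ and N³ L³ = 1,
the Hessian has the required form with the constant F. -/
theorem hasDV_potGrad (w : C3) (F : ℂ) : HasDV (potGrad D w F)
    (fun v => gamv (flow D x) v *ᵥ potGrad D w F x + F • v) x := by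
  have hL := hasDM_lmat D x
  have hy := hasDV_yvec D x
  have hs : HasDV (fun x => w + (F / 4) • (yvec D x + (lmat D x * lmat D x).mulVec (yvec D x)))
      (fun v => F • (lmat D x * lmat D x * lmat D x) *ᵥ v) x := by
    refine ((hasDV_const w x).add ((hy.add ((hL.mul hL).mulVec hy)).const_smul _)).congr_deriv
      fun v => ?_
    have hc := (bmat_commute_lmat (x := x) hD v).eq
    have e : (-bmat D v * lmat D x + lmat D x * -bmat D v) = (-2 : ℂ) • (lmat D x * bmat D v) := by
      rw [Matrix.neg_mul, Matrix.mul_neg, hc]; module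
    rw [e, smul_mulVec, ← mulVec_mulVec, bmat_mulVec_yvec hD, mulVec_mulVec, mulVec_smul,
      mulVec_mulVec, Matrix.mul_sub, Matrix.mul_one, sub_mulVec, ← Matrix.mul_assoc]
    module
  refine ((hasDM_nmat_cube hD hx).mulVec hs).congr_deriv fun v => ?_
  have e1 : nmat D x * nmat D x * nmat D x * (lmat D x * lmat D x * lmat D x) = 1 := by
    rw [← Matrix.mul_assoc, ← Matrix.mul_assoc, nmat_cube_lmat hx, nmat_sq_lmat hx,
      nmat_mul_lmat hx]
  have e2 : gamv (flow D x) v = (3 : ℂ) • (nmat D x * bmat D v) := by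
    rw [gamv_flow hD hx, ← (bmat_commute_nmat hD hx v).eq, bmat, Matrix.smul_mul, smul_smul]
    norm_num
  rw [mulVec_smul, mulVec_mulVec, e1, one_mulVec, e2, potGrad, mulVec_mulVec, smul_mulVec,
    Matrix.smul_mul, smul_mulVec]

/-- The closed first-order system that the Killing tensors of any superintegrable system satisfy
(compare `killingDeriv`). Its cyclic sum vanishes, which is the Killing equation. -/
theorem hasDM_killing (A : Matrix (Fin 3) (Fin 3) ℂ) : HasDM (killing D A)
    (fun v => (2 : ℂ) • bmat (flow D x) (killing D A x *ᵥ v) - bmat (flow D x) v * killing D A x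
      - killing D A x * bmat (flow D x) v) x := by
  have hL := hasDM_lmat D x
  have hy := hasDV_yvec D x
  refine (((hL.mul (hasDM_const A x)).mul hL).add (HasDM.comp_linear (bmat_isLinearMap D)
    ((hasDM_const A x).mulVec hy))).congr_deriv fun v => ?_
  have hBL := fun u => (bmat_commute_lmat (x := x) hD u).eq
  have hBN := fun u => (bmat_commute_nmat hD hx u).eq
  have hBB := fun u v => (bmat_commute hD u v).eq
  have hbl : ∀ u, bmat D (lmat D x *ᵥ u) = bmat D u * lmat D x := fun u => by
    rw [lmat, sub_mulVec, one_mulVec, bmat_sub, bmat_bmat_mulVec hD, hBB x u, Matrix.mul_sub,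
      Matrix.mul_one]
  have e1 : bmat (flow D x) (killing D A x *ᵥ v)
      = bmat D (A *ᵥ lmat D x *ᵥ v) + bmat D (A *ᵥ yvec D x) * bmat D v * nmat D x := by
    rw [bmat_flow hD hx, killing, add_mulVec, bmat_add, bmat_bmat_mulVec hD, Matrix.mul_assoc,
      ← mulVec_mulVec, hbl, Matrix.add_mul, Matrix.mul_assoc (bmat D _) (lmat D x),
      lmat_mul_nmat hx, Matrix.mul_one, mulVec_mulVec]
  have e2 : bmat (flow D x) v * killing D A x
      = bmat D v * A * lmat D x + bmat D (A *ᵥ yvec D x) * bmat D v * nmat D x := by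
    rw [bmat_flow hD hx, killing, Matrix.mul_add, Matrix.mul_assoc, ← Matrix.mul_assoc (nmat D x),
      ← Matrix.mul_assoc (nmat D x), nmat_mul_lmat hx, Matrix.one_mul, Matrix.mul_assoc (bmat D v),
      ← hBN, ← Matrix.mul_assoc (bmat D v), ← Matrix.mul_assoc (bmat D v), hBB v]
  have e3 : killing D A x * bmat (flow D x) v
      = lmat D x * A * bmat D v + bmat D (A *ᵥ yvec D x) * bmat D v * nmat D x := by
    rw [bmat_flow hD hx, killing, Matrix.add_mul, hBN v, ← Matrix.mul_assoc (lmat D x * A * _),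
      Matrix.mul_assoc (lmat D x * A), lmat_mul_nmat hx, Matrix.mul_one, ← hBN v,
      Matrix.mul_assoc (bmat D _) (bmat D v)]
  rw [e1, e2, e3]
  simp only [zero_mulVec, zero_add, mulVec_smul, bmat_smul, Matrix.mul_zero, add_zero,
    Matrix.neg_mul, Matrix.mul_neg]
  module

theorem hasDD_killingPot {A : Matrix (Fin 3) (Fin 3) ℂ} (hA : A.transpose = A) (w : C3) (F : ℂ) :
    HasDD (killingPot D A w F) (fun v => killing D A x *ᵥ v ⬝ᵥ potGrad D w F x) x := by
  have hq := hasDV_qvec hD hx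
  have hAy := (hasDM_const A x).mulVec (hasDV_yvec D x)
  refine (((hAy.dotProduct ((hasDM_nmat_mul_nmat hD hx).mulVec (hasDV_const w x))).const_mul _).add
    ((hAy.dotProduct hq).const_mul _)).congr_deriv fun v => ?_
  set N := nmat D x
  set L := lmat D x
  set y := yvec D x
  set B := bmat D v
  have hNL : N * L = 1 := nmat_mul_lmat hx
  have hLN : L * N = 1 := lmat_mul_nmat hx
  have hBN : B * N = N * B := (bmat_commute_nmat hD hx v).eq
  have hBy : B *ᵥ y = (1 - L * L) *ᵥ v := bmat_mulVec_yvec hD x v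
  have hk : killing D A x *ᵥ v = L *ᵥ A *ᵥ L *ᵥ v + B *ᵥ A *ᵥ y := by
    rw [killing, add_mulVec, bmat_mulVec_comm D (A *ᵥ yvec D x) v, ← mulVec_mulVec, ← mulVec_mulVec]
  have hLt : L.transpose = L := lmat_transpose
  have hBt : B.transpose = B := bmat_transpose D v
  set s := A *ᵥ L *ᵥ v
  set u := A *ᵥ y
  have hsy : s ⬝ᵥ y = u ⬝ᵥ L *ᵥ v := by
    rw [mulVec_dotProduct_of_transpose hA, dotProduct_comm]
  have e1 : L * (N * N * N) = N * N := by rw [← Matrix.mul_assoc, ← Matrix.mul_assoc, hLN, Matrix.one_mul]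
  have e2 : N * N * N * (L * L) = N := by
    rw [← Matrix.mul_assoc, nmat_cube_lmat hx, nmat_sq_lmat hx]
  have e3 : N * N * (L * L) = 1 := by rw [← Matrix.mul_assoc, nmat_sq_lmat hx, hNL]
  have hB3 : B * (N * N * N) = N * N * N * B :=
    ((bmat_commute_nmat hD hx v).mul_right (bmat_commute_nmat hD hx v)).mul_right
      (bmat_commute_nmat hD hx v)
  have hg : killing D A x *ᵥ v ⬝ᵥ potGrad D w F x
      = s ⬝ᵥ (N * N) *ᵥ w + F / 4 * (s ⬝ᵥ (N * N) *ᵥ y + u ⬝ᵥ L *ᵥ v)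
        + (u ⬝ᵥ (B * (N * N * N)) *ᵥ w + F / 4 * (u ⬝ᵥ (N * N * N) *ᵥ B *ᵥ y
          + u ⬝ᵥ N *ᵥ B *ᵥ y)) := by
    have h1 : L *ᵥ potGrad D w F x = (N * N) *ᵥ w + (F / 4) • ((N * N) *ᵥ y + y) := by
      rw [potGrad, mulVec_mulVec, e1, mulVec_add, mulVec_smul, mulVec_add, mulVec_mulVec, e3,
        one_mulVec]
    have h2 : B *ᵥ potGrad D w F x = (B * (N * N * N)) *ᵥ w
        + (F / 4) • ((N * N * N) *ᵥ B *ᵥ y + N *ᵥ B *ᵥ y) := by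
      rw [potGrad, mulVec_mulVec, mulVec_add, mulVec_smul, mulVec_add]
      congr 3
      · rw [hB3, mulVec_mulVec]
      · rw [mulVec_mulVec, Matrix.mul_assoc, e2, hBN, mulVec_mulVec]
    rw [hk, add_dotProduct, mulVec_dotProduct_of_transpose hLt, mulVec_dotProduct_of_transpose hBt,
      h1, h2]
    simp only [dotProduct_add, dotProduct_smul, smul_eq_mul, hsy]
  -- Here L + N (1 - L²) = N, because N L = 1.
  have h3 : u ⬝ᵥ L *ᵥ v + u ⬝ᵥ N *ᵥ B *ᵥ y = u ⬝ᵥ N *ᵥ v := by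
    rw [hBy, mulVec_mulVec, ← dotProduct_add, ← add_mulVec, Matrix.mul_sub, ← Matrix.mul_assoc, hNL,
      Matrix.one_mul, Matrix.mul_one, add_sub_cancel]
  have h4 : (N * N * N) *ᵥ B *ᵥ y = (N * N * N) *ᵥ v - N *ᵥ v := by
    rw [hBy, mulVec_mulVec, Matrix.mul_sub, Matrix.mul_one, e2, sub_mulVec]
  rw [hg]
  simp only [zero_mulVec, zero_add, mulVec_smul, smul_mulVec, smul_dotProduct, dotProduct_smul,
    smul_eq_mul, mulVec_zero, add_zero, ← hB3]
  have h5 : s ⬝ᵥ qvec D x = s ⬝ᵥ (N * N) *ᵥ y := rfl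
  have h6 : u ⬝ᵥ (N * N * N) *ᵥ B *ᵥ y = u ⬝ᵥ (N * N * N) *ᵥ v - u ⬝ᵥ N *ᵥ v := by
    rw [h4, dotProduct_sub]
  change 1 / 2 * (2 * (s ⬝ᵥ (N * N) *ᵥ w) + 2 * (u ⬝ᵥ (B * (N * N * N)) *ᵥ w))
    + F / 8 * (2 * (s ⬝ᵥ qvec D x) + 2 * (u ⬝ᵥ (N * N * N) *ᵥ v)) = _
  rw [h5, h6]
  linear_combination -F / 4 * h3

end

section
open Matrix

/-! ### The potentials of the explicit systems -/

lemma HasDD.comp_sub {f f' : C3 → ℂ} {x c : C3} (h : HasDD f f' (x - c)) :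
    HasDD (fun y => f (y - c)) f' x := by
  have h1 : HasFDerivAt (fun y : C3 => y - c) (.id ℂ C3) x := (hasFDerivAt_id x).sub_const c
  exact .of_hasFDerivAt (h.1.hasFDerivAt.comp x h1) fun v => by simp [h.2]

lemma HasDV.hasDD_cub {E E' : C3 → Ten} {x : C3} (h : HasDV E E' x) (i j k : Fin 3) :
    HasDD (fun y => cub (E y) i j k) (fun v => cub (E' v) i j k) x := by
  obtain ⟨L, hL, hL'⟩ := h.exists_hasFDerivAt
  have hlin : IsLinearMap ℂ fun D : Ten => cub D i j k :=
    ⟨fun D E => cub_add D E i j k, fun s D => cub_smul s D i j k⟩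
  refine .of_hasFDerivAt
    ((LinearMap.toContinuousLinearMap hlin.mk').hasFDerivAt.comp x hL) fun v => ?_
  rw [← hL']; rfl

lemma gamv_mulVec_apply (D : Ten) (v g : C3) (j : Fin 3) :
    (gamv D v *ᵥ g) j = ∑ l, v l * ∑ k, cub D l j k * g k := by
  simp only [mulVec, dotProduct, gamv_apply, Finset.sum_mul, Finset.mul_sum]
  rw [Finset.sum_comm]
  exact Finset.sum_congr rfl fun _ _ => Finset.sum_congr rfl fun _ _ => by ring

lemma cub_transField_apply {D : Ten} (hD : D ∈ variety) (l i j k : Fin 3) :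
    cub (transField (Pi.single l 1) D) i j k = 1 / 3 * (gam D l * gam D i) j k := by
  rw [← gam_apply, gam_transField_of_mem hD, ← gam_eq_gamv]; rfl

/-- The function `F` of a potential on a translation flow is locally constant. -/
lemma pd_eq_zero_of_hasHessian {E : C3 → Ten} {V F : C3 → ℂ} {N : Set C3} (hN : IsOpen N)
    (hE : ∀ y ∈ N, E y ∈ variety) (hT : ∀ y ∈ N, SolvesTranslation E y)
    (hV : DifferentiableOn ℂ V N) (hH : ∀ y ∈ N, HasHessian (E y) (F y) V y)
    {x : C3} (hx : x ∈ N) : DifferentiableAt ℂ F x ∧ ∀ l, pd l F x = 0 := by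
  have hn := hN.mem_nhds hx
  have hV1 : ∀ k, DifferentiableOn ℂ (pd k V) N := differentiableOn_pd hN hV
  have hV2 : ∀ i j, DifferentiableOn ℂ (pd i (pd j V)) N := fun i j =>
    differentiableOn_pd hN (hV1 j) i
  have hg : ∀ k, HasDD (pd k V) (fun v => ∑ l, v l * pd l (pd k V) x) x := fun k =>
    hasDD_of_differentiableAt ((hV1 k).differentiableAt hn)
  have hc : ∀ i j k, HasDD (fun y => cub (E y) i j k) (fun v => cub (transField v (E x)) i j k) x :=
    (hT x hx).hasDD_cub
  have hs : ∀ i j, HasDD (fun y => ∑ k, cub (E y) i j k * pd k V y) _ x := fun i j =>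
    HasDD.sum Finset.univ fun k => (hc i j k).mul (hg k)
  have hF : HasDD F (fun v => ∑ l, v l * pd l F x) x := by
    refine hasDD_of_differentiableAt ?_
    have : F =ᶠ[𝓝 x] fun y => pd 0 (pd 0 V) y - ∑ k, cub (E y) 0 0 k * pd k V y :=
      Filter.eventually_of_mem hn fun y hy => by
        have := hH y hy 0 0
        rw [if_pos rfl] at this
        linear_combination -this
    exact (((hV2 0 0).differentiableAt hn).sub (hs 0 0).1).congr_of_eventuallyEq this
  refine ⟨hF.1, fun l => ?_⟩
  -- The factor 4/3 consists of 1/3 from ∂ₗGᵢ = ⅓ Gₗ Gᵢ and 1 from inserting the Hessian for the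
  -- derivatives of Vₖ.
  have key : ∀ l i j, pd l (pd i (pd j V)) x = (if i = j then pd l F x else 0)
      + ∑ k, (4 / 3 * (gam (E x) l * gam (E x) i) j k) * pd k V x + F x * cub (E x) i j l := by
    intro l i j
    have h1 : HasDD (pd i (pd j V)) (fun v => (if i = j then 1 else 0) * (∑ l, v l * pd l F x)
        + _) x := ((hF.const_mul (if i = j then 1 else 0)).add (hs i j)).congr
      (Filter.eventually_of_mem hn fun y hy => by rw [hH y hy i j]; simp)
    rw [h1.pd l]
    have e1 : ∑ k, cub (E x) i j k * ∑ a, (Pi.single l 1 : C3) a * pd a (pd k V) x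
        = ∑ k, (gam (E x) i * gam (E x) l) j k * pd k V x + F x * cub (E x) i j l := by
      simp only [Pi.single_apply, ite_mul, one_mul, zero_mul, Finset.sum_ite_eq', Finset.mem_univ,
        if_true, hH x hx l _, mul_add, mul_ite, mul_zero, Finset.sum_add_distrib,
        Finset.sum_ite_eq, Matrix.mul_apply, gam_apply, Finset.mul_sum, Finset.sum_mul]
      rw [Finset.sum_comm, add_comm, mul_comm (F x)]
      congr 1
      refine Finset.sum_congr rfl fun a _ => Finset.sum_congr rfl fun b _ => ?_
      ring
    simp only [Finset.sum_add_distrib, e1, cub_transField_apply (hE x hx),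
      mem_variety_iff.mp (hE x hx) i l]
    simp only [Pi.single_apply, ite_mul, one_mul, zero_mul, Finset.sum_ite_eq', Finset.mem_univ,
      if_true]
    simp only [Fin.sum_univ_three]
    ring
  -- Comparing ∂ₗ∂ᵢ∂ᵢV with ∂ᵢ∂ₗ∂ᵢV for i ≠ l, everything except ∂ₗF is symmetric.
  obtain ⟨i, hi⟩ : ∃ i : Fin 3, i ≠ l := exists_ne l
  have h1 := key l i i
  have h2 := key i l i
  rw [pd_comm hN (hV1 i) hx l i, h2, if_neg hi.symm, if_pos rfl, mem_variety_iff.mp (hE x hx) i l,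
    cub_comm₁₂ (E x) l i i, cub_comm₂₃ (E x) i l i] at h1
  linear_combination -h1

lemma eventually_const_of_pd_eq_zero {f : C3 → ℂ} {N : Set C3} (hN : IsOpen N) {x : C3} (hx : x ∈ N)
    (h : ∀ y ∈ N, DifferentiableAt ℂ f y ∧ ∀ v, fderiv ℂ f y v = 0) : ∀ᶠ y in 𝓝 x, f y = f x := by
  obtain ⟨r, hr, hsub⟩ := Metric.isOpen_iff.mp hN x hx
  refine Filter.eventually_of_mem (Metric.ball_mem_nhds x hr) fun y hy => ?_
  refine (convex_ball x r).is_const_of_fderivWithin_eq_zero (𝕜 := ℂ)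
    (fun z hz => (h z (hsub hz)).1.differentiableWithinAt) (fun z hz => ?_) hy
    (Metric.mem_ball_self hr)
  rw [fderivWithin_of_isOpen Metric.isOpen_ball hz]
  ext1 v; exact (h z (hsub hz)).2 v

/-- For F = 0 the vector L³∇V is constant: d(L³) = -3 L² B_v cancels the Hessian 3 B_v N. This
replaces an integration of the gradient equations in the proof of uniqueness. -/
lemma lmat_cube_cancel {L N B : Matrix (Fin 3) (Fin 3) ℂ} (hLN : L * N = 1) (hBN : B * N = N * B)
    (hc : B * L = L * B) :
    (-B * L + L * -B) * L + L * L * -B + L * L * L * ((3 : ℂ) • B * N) = 0 := by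
  have e : L * L * L * ((3 : ℂ) • B * N) = (3 : ℂ) • (L * L * B) := by
    rw [Matrix.smul_mul, Matrix.mul_smul, hBN, ← Matrix.mul_assoc, Matrix.mul_assoc (L * L) L N,
      hLN, Matrix.mul_one]
  rw [e]
  simp only [Matrix.neg_mul, Matrix.mul_neg, Matrix.add_mul, hc]
  rw [Matrix.mul_assoc L B L, hc, ← Matrix.mul_assoc]
  module

/-- A potential with vanishing data vanishes. -/
theorem eventually_eq_zero_of_potential {D : Ten} (hD : D ∈ variety) {c : C3} {V F : C3 → ℂ}
    {N : Set C3} (hN : IsOpen N) (hsub : ∀ y ∈ N, y - c ∈ flowDomain D)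
    (hV : DifferentiableOn ℂ V N) (hH : ∀ y ∈ N, HasHessian (flow D (y - c)) (F y) V y)
    {x : C3} (hx : x ∈ N) (h0 : V x = 0) (h1 : ∀ k, pd k V x = 0) (h2 : F x = 0) :
    ∀ᶠ y in 𝓝 x, V y = 0 := by
  have hF := eventually_const_of_pd_eq_zero hN hx (f := F) fun y hy => by
    obtain ⟨ha, hb⟩ := pd_eq_zero_of_hasHessian (E := fun y => flow D (y - c)) hN
      (fun y hy => flow_mem_variety hD (hsub y hy))
      (fun y hy => (solvesTranslation_flow hD (hsub y hy)).comp_sub) hV hH hy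
    exact ⟨ha, fun v => by rw [fderiv_eq_sum_pd]; simp [hb]⟩
  obtain ⟨N₁, hN₁, hN₁o, hx₁⟩ := eventually_nhds_iff.mp (hF.and (hN.mem_nhds hx))
  have hV1 : ∀ k, DifferentiableOn ℂ (pd k V) N := differentiableOn_pd hN hV
  have hg : ∀ y ∈ N₁, HasDV (fun y k => pd k V y)
      (fun v => gamv (flow D (y - c)) v *ᵥ fun k => pd k V y) y := fun y hy k => by
    refine (hasDD_of_differentiableAt ((hV1 k).differentiableAt
      (hN.mem_nhds (hN₁ y hy).2))).congr_deriv fun v => ?_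
    refine Eq.trans (Finset.sum_congr rfl fun l _ => ?_) (gamv_mulVec_apply _ _ _ _).symm
    rw [hH y (hN₁ y hy).2, (hN₁ y hy).1, h2, ite_self, zero_add]
  have hL : ∀ y ∈ N₁, HasDV (fun y => (lmat D (y - c) * lmat D (y - c) * lmat D (y - c)) *ᵥ
      fun k => pd k V y) (fun _ => 0) y := fun y hy => by
    have hl : HasDM (fun y => lmat D (y - c)) (fun v => -bmat D v) y := fun i j =>
      (hasDM_lmat D (y - c) i j).comp_sub
    refine (((hl.mul hl).mul hl).mulVec (hg y hy)).congr_deriv fun v => ?_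
    have hy' := hsub y (hN₁ y hy).2
    have hc := (bmat_commute_lmat (x := y - c) hD v).eq
    rw [gamv_flow hD hy', show gamv D v = (3 : ℂ) • bmat D v by rw [bmat, smul_smul]; norm_num,
      mulVec_mulVec, ← add_mulVec]
    refine (congrArg (· *ᵥ _) (lmat_cube_cancel (lmat_mul_nmat hy')
      (bmat_commute_nmat hD hy' v).eq hc)).trans (zero_mulVec _)
  have hg0 : ∀ᶠ y in 𝓝 x, ∀ k, pd k V y = 0 := by
    have h3 : ∀ k, ∀ᶠ y in 𝓝 x, ((lmat D (y - c) * lmat D (y - c) * lmat D (y - c)) *ᵥ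
        fun k => pd k V y) k = 0 := fun k => by
      have := eventually_const_of_pd_eq_zero hN₁o hx₁ (f := fun y =>
        ((lmat D (y - c) * lmat D (y - c) * lmat D (y - c)) *ᵥ fun k => pd k V y) k)
        fun y hy => ⟨(hL y hy k).1, (hL y hy k).2⟩
      filter_upwards [this] with y hy
      rw [hy]
      simp only [h1]
      exact congrFun (mulVec_zero _) k
    -- L³ is invertible on the domain of the flow, so the gradient itself vanishes near x.
    filter_upwards [Filter.eventually_all.mpr h3, hN.mem_nhds hx] with y hy hyN
    have hy' := hsub y hyN
    have e : (nmat D (y - c) * nmat D (y - c) * nmat D (y - c))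
        * (lmat D (y - c) * lmat D (y - c) * lmat D (y - c)) = 1 := by
      rw [← Matrix.mul_assoc, ← Matrix.mul_assoc, nmat_cube_lmat hy', nmat_sq_lmat hy',
        nmat_mul_lmat hy']
    have h4 : (fun k => pd k V y) = 0 := by
      rw [← one_mulVec (fun k => pd k V y), ← e, ← mulVec_mulVec, funext hy]
      exact mulVec_zero _
    exact fun k => congrFun h4 k
  obtain ⟨N₂, hN₂, hN₂o, hx₂⟩ := eventually_nhds_iff.mp (hg0.and (hN.mem_nhds hx))
  have := eventually_const_of_pd_eq_zero hN₂o hx₂ (f := V) fun y hy =>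
    ⟨hV.differentiableAt (hN.mem_nhds (hN₂ y hy).2), fun v => by
      rw [fderiv_eq_sum_pd]; simp [(hN₂ y hy).1]⟩
  filter_upwards [this] with y hy
  rw [hy, h0]

lemma pd_sub {f g : C3 → ℂ} {x : C3} (hf : DifferentiableAt ℂ f x) (hg : DifferentiableAt ℂ g x)
    (i : Fin 3) : pd i (fun y => f y - g y) x = pd i f x - pd i g x := by
  simp only [pd]; rw [fderiv_fun_sub hf hg]; rfl

lemma pd_pd_sub {f g : C3 → ℂ} {N : Set C3} (hN : IsOpen N) (hf : DifferentiableOn ℂ f N)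
    (hg : DifferentiableOn ℂ g N) {x : C3} (hx : x ∈ N) (i j : Fin 3) :
    pd i (pd j fun y => f y - g y) x = pd i (pd j f) x - pd i (pd j g) x := by
  have hn := hN.mem_nhds hx
  have h : (pd j fun y => f y - g y) =ᶠ[𝓝 x] fun y => pd j f y - pd j g y :=
    Filter.eventually_of_mem hn fun y hy => pd_sub (hf.differentiableAt (hN.mem_nhds hy))
      (hg.differentiableAt (hN.mem_nhds hy)) j
  rw [pd, h.fderiv_eq]
  exact pd_sub ((differentiableOn_pd hN hf j).differentiableAt hn)
    ((differentiableOn_pd hN hg j).differentiableAt hn) i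

/-- Uniqueness of potentials with given data. -/
theorem potential_unique {D : Ten} (hD : D ∈ variety) {c : C3} {V V' : C3 → ℂ} {N : Set C3}
    (hN : IsOpen N) (hsub : ∀ y ∈ N, y - c ∈ flowDomain D)
    (hV : IsPotential (fun y => coeffs (flow D (y - c))) N V)
    (hV' : IsPotential (fun y => coeffs (flow D (y - c))) N V')
    {x : C3} (hx : x ∈ N) (h0 : V x = V' x) (h1 : ∀ k, pd k V x = pd k V' x)
    (h2 : pd 0 (pd 0 V) x = pd 0 (pd 0 V') x) : V =ᶠ[𝓝 x] V' := by
  rw [isPotential_iff hN (E := fun y => flow D (y - c)) fun _ _ => rfl] at hV hV'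
  obtain ⟨hd, hH⟩ := hV
  obtain ⟨hd', hH'⟩ := hV'
  choose! F hF using hH
  choose! F' hF' using hH'
  have hdiff := fun y (hy : y ∈ N) => hd.differentiableAt (hN.mem_nhds hy)
  have hdiff' := fun y (hy : y ∈ N) => hd'.differentiableAt (hN.mem_nhds hy)
  have := eventually_eq_zero_of_potential hD (V := fun y => V y - V' y) (F := fun y => F y - F' y)
    hN hsub (hd.sub hd') (fun y hy i j => ?_) hx (by simp [h0])
    (fun k => by rw [pd_sub (hdiff x hx) (hdiff' x hx), h1, sub_self]) ?_
  · filter_upwards [this] with y hy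
    exact sub_eq_zero.mp hy
  · rw [pd_pd_sub hN hd hd' hy, hF y hy, hF' y hy]
    simp only [pd_sub (hdiff y hy) (hdiff' y hy), mul_sub, Finset.sum_sub_distrib]
    split_ifs <;> ring
  · have e := hF x hx 0 0
    have e' := hF' x hx 0 0
    rw [h2] at e
    simp only [h1] at e
    simp only [if_true] at e e'
    linear_combination e' - e

section
variable {D : Ten} (hD : D ∈ variety) {c : C3} {U : Set C3} (hU : IsOpen U)
  (hsub : ∀ y ∈ U, y - c ∈ flowDomain D)
include hD hU hsub

omit hU in
lemma pd_pot (k₀ : ℂ) (w : C3) (F : ℂ) {y : C3} (hy : y ∈ U) (j : Fin 3) :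
    pd j (fun y => pot D k₀ w F (y - c)) y = potGrad D w F (y - c) j := by
  rw [((hasDD_pot hD (hsub y hy) k₀ w F).comp_sub).pd j, dotProduct_single, mul_one]

lemma pd_pd_pot (k₀ : ℂ) (w : C3) (F : ℂ) {y : C3} (hy : y ∈ U) :
    HasHessian (flow D (y - c)) F (fun y => pot D k₀ w F (y - c)) y := by
  intro i j
  have h : (pd j fun y => pot D k₀ w F (y - c)) =ᶠ[𝓝 y] fun y => potGrad D w F (y - c) j :=
    Filter.eventually_of_mem (hU.mem_nhds hy) fun z hz => pd_pot hD hsub k₀ w F hz j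
  rw [pd, h.fderiv_eq]
  refine (((hasDV_potGrad hD (hsub y hy) w F) j).comp_sub.2 _).trans ?_
  simp only [pd_pot hD hsub k₀ w F hy, Pi.add_apply, gamv_mulVec_apply, Pi.smul_apply,
    Pi.single_apply, ite_mul, one_mul, zero_mul, Finset.sum_ite_eq', Finset.mem_univ, if_true,
    smul_eq_mul, mul_ite, mul_one, mul_zero, eq_comm (a := j) (b := i)]
  rw [add_comm]

theorem isPotential_pot (k₀ : ℂ) (w : C3) (F : ℂ) :
    IsPotential (fun y => coeffs (flow D (y - c))) U (fun y => pot D k₀ w F (y - c)) := by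
  rw [isPotential_iff hU (E := fun y => flow D (y - c)) fun _ _ => rfl]
  exact ⟨fun y hy => ((hasDD_pot hD (hsub y hy) k₀ w F).comp_sub).1.differentiableWithinAt,
    fun y hy => ⟨F, pd_pd_pot hD hU hsub k₀ w F hy⟩⟩

/-- The data are solved for the parameters in turn: V₁₁ and the gradient give F, inversion of N³ in
`potGrad` gives w, and the value gives the constant. -/
theorem exists_pot_data {x : C3} (hx : x ∈ U) (k : ℂ) (g : C3) (k₁₁ : ℂ) :
    ∃ k₀ w F, HasData (fun y => pot D k₀ w F (y - c)) x k g k₁₁ := by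
  set z := x - c with hz
  have hzd := hsub x hx
  set F := k₁₁ - ∑ i, cub (flow D z) 0 0 i * g i with hF
  set w := (lmat D z * lmat D z * lmat D z) *ᵥ g
    - (F / 4) • (yvec D z + (lmat D z * lmat D z).mulVec (yvec D z)) with hw
  have hgrad : potGrad D w F z = g := by
    rw [potGrad, hw, sub_add_cancel, mulVec_mulVec, ← Matrix.mul_assoc, ← Matrix.mul_assoc,
      nmat_cube_lmat hzd, nmat_sq_lmat hzd, nmat_mul_lmat hzd, one_mulVec]
  have hg : ∀ i, pd i (fun y => pot D (k - pot D 0 w F z) w F (y - c)) x = g i := fun i => by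
    rw [pd_pot hD hsub _ w F hx, ← hz, hgrad]
  refine ⟨k - pot D 0 w F z, w, F, ?_, hg, ?_⟩
  · simp only [pot, ← hz]; ring
  · rw [pd_pd_pot hD hU hsub _ w F hx 0 0, if_pos rfl]
    simp only [hg, ← hz]
    rw [hF]; ring

theorem isNondegenerate_flow : IsNondegenerate U (fun y => coeffs (flow D (y - c))) := by
  intro x hx k g k₁₁
  refine ⟨⟨U, hU, hx, subset_rfl, ?_⟩, fun N V V' hN hxN hNU hV hd hV' hd' => ?_⟩
  · obtain ⟨k₀, w, F, h⟩ := exists_pot_data hD hU hsub hx k g k₁₁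
    exact ⟨_, isPotential_pot hD hU hsub k₀ w F, h⟩
  · exact potential_unique hD hN (fun y hy => hsub y (hNU hy)) hV hV' hxN (hd.1.trans hd'.1.symm)
      (fun i => (hd.2.1 i).trans (hd'.2.1 i).symm) (hd.2.2.trans hd'.2.2.symm)

end

end

section
open Matrix

/-! ### The explicit superintegrable systems -/

/-- A basis of the symmetric forms, starting with the form of the Hamiltonian. -/
def symBasis : Fin 6 → Matrix (Fin 3) (Fin 3) ℂ :=
  ![1, !![0, 1, 0; 1, 0, 0; 0, 0, 0], !![0, 0, 1; 0, 0, 0; 1, 0, 0], !![0, 0, 0; 0, 0, 1; 0, 1, 0],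
    !![1, 0, 0; 0, 0, 0; 0, 0, 0], !![0, 0, 0; 0, 1, 0; 0, 0, 0]]

lemma symBasis_transpose (h : Fin 6) : (symBasis h).transpose = symBasis h := by
  fin_cases h <;> ext i j <;> fin_cases i <;> fin_cases j <;> simp [symBasis]

lemma linearIndependent_symBasis : LinearIndependent ℂ symBasis := by
  rw [Fintype.linearIndependent_iff]
  intro g hg
  have h := fun i j => congrFun (congrFun hg i) j
  have h00 := h 0 0; have h11 := h 1 1; have h22 := h 2 2
  have h01 := h 0 1; have h02 := h 0 2; have h12 := h 1 2
  simp [Fin.sum_univ_six, symBasis] at h00 h11 h22 h01 h02 h12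
  intro i
  fin_cases i <;> simp <;> grind

/-- The five Killing tensors of the explicit system and a sixth form that is independent of them. -/
def killingFamily (D : Ten) (x : C3) (h : Fin 6) : Matrix (Fin 3) (Fin 3) ℂ :=
  if h = 5 then symBasis 5 else killing D (symBasis h) x

/-- The set of translations on which the explicit system is regular. -/
def regularSet (D : Ten) : Set C3 :=
  {x | x ∈ flowDomain D ∧ LinearIndependent ℂ (killingFamily D x)}

/-- At 0 the family is the basis `symBasis`, and linear independence is an open condition. -/
lemma regularSet_mem_nhds {D : Ten} (hD : D ∈ variety) : regularSet D ∈ 𝓝 (0 : C3) := by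
  have h1 := (isOpen_flowDomain D).mem_nhds (zero_mem_flowDomain D)
  have hc : ContinuousAt (fun x h i j => killingFamily D x h i j) (0 : C3) := by
    refine continuousAt_pi.mpr fun h => continuousAt_pi.mpr fun i => continuousAt_pi.mpr fun j => ?_
    simp only [killingFamily]
    split_ifs
    · exact continuousAt_const
    · exact (hasDM_killing hD (zero_mem_flowDomain D) (symBasis h) i j).1.continuousAt
  have h2 : ∀ᶠ x in 𝓝 (0 : C3), LinearIndependent ℂ (fun h i j => killingFamily D x h i j) := by
    have hopen := isOpen_setOfPred_linearIndependent (𝕜 := ℂ) (E := Fin 3 → Fin 3 → ℂ) (ι := Fin 6)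
    refine hc.eventually (hopen.mem_nhds ?_)
    have : killingFamily D 0 = symBasis := by
      ext1 h
      simp only [killingFamily, killing_zero]
      split_ifs with h5
      · rw [h5]
      · rfl
    change LinearIndependent ℂ fun h => (killingFamily D 0 h : Fin 3 → Fin 3 → ℂ)
    rw [this]
    exact linearIndependent_symBasis
  filter_upwards [h1, h2] with x ha hb
  exact ⟨ha, hb⟩

lemma cub_rotate (D : Ten) (i j k : Fin 3) : cub D i j k = cub D k i j := by
  rw [cub_comm₂₃, cub_comm₁₂]

section
variable {D : Ten} (hD : D ∈ variety) {c : C3} {U : Set C3}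
  (hsub : ∀ y ∈ U, y - c ∈ flowDomain D)
include hD hsub

lemma pd_killing {A : Matrix (Fin 3) (Fin 3) ℂ} (hA : A.transpose = A) {y : C3} (hy : y ∈ U)
    (j k l : Fin 3) :
    pd j (fun y => killing D A (y - c) k l) y = 1 / 3 *
      (2 * ∑ m, killing D A (y - c) m j * cub (flow D (y - c)) m k l
        - ∑ m, killing D A (y - c) m l * cub (flow D (y - c)) m j k
        - ∑ m, killing D A (y - c) m k * cub (flow D (y - c)) m j l) := by
  refine ((((hasDM_killing hD (hsub y hy) A) k l).comp_sub).pd j).trans ?_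
  have hs : ∀ i j, killing D A (y - c) i j = killing D A (y - c) j i := fun i j =>
    congrFun (congrFun (killing_transpose hA (y - c)) j) i
  have e1 : bmat (flow D (y - c)) (Pi.single j 1) = (1 / 3 : ℂ) • gam (flow D (y - c)) j := by
    rw [bmat, ← gam_eq_gamv]
  change ((2 : ℂ) • bmat (flow D (y - c)) (killing D A (y - c) *ᵥ Pi.single j 1)
    - bmat (flow D (y - c)) (Pi.single j 1) * killing D A (y - c)
    - killing D A (y - c) * bmat (flow D (y - c)) (Pi.single j 1)) k l = _
  rw [e1]
  simp only [bmat, Matrix.sub_apply, Matrix.smul_apply, gamv_apply, smul_eq_mul, Matrix.smul_mul,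
    Matrix.mul_smul, Matrix.mul_apply, gam_apply, mulVec_single, MulOpposite.op_one, one_smul,
    Matrix.col_apply]
  have e2 : ∑ m, cub (flow D (y - c)) j k m * killing D A (y - c) m l
      = ∑ m, killing D A (y - c) m l * cub (flow D (y - c)) m j k :=
    Finset.sum_congr rfl fun m _ => by rw [cub_rotate]; ring
  have e3 : ∑ m, killing D A (y - c) k m * cub (flow D (y - c)) j m l
      = ∑ m, killing D A (y - c) m k * cub (flow D (y - c)) m j l :=
    Finset.sum_congr rfl fun m _ => by rw [cub_comm₁₂, hs]
  rw [e2, e3]; ring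

lemma isConstantOfMotion_killing {N : Set C3} (hN : IsOpen N) (hNU : N ⊆ U) {V : C3 → ℂ} {k₀ : ℂ}
    {w : C3} {F : ℂ} (hV : ∀ y ∈ N, V y = pot D k₀ w F (y - c)) {A : Matrix (Fin 3) (Fin 3) ℂ}
    (hA : A.transpose = A) :
    IsConstantOfMotion N V (fun y => killing D A (y - c)) (fun y => killingPot D A w F (y - c)) := by
  have hV' : ∀ y ∈ N, V =ᶠ[𝓝 y] fun y => pot D k₀ w F (y - c) := fun y hy =>
    Filter.eventually_of_mem (hN.mem_nhds hy) hV
  refine isConstantOfMotion_of hN ?_ ?_ (fun y _ => killing_transpose hA _) ?_ ?_ ?_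
  · exact fun y hy => ((((hasDD_pot hD (hsub y (hNU hy)) k₀ w F).comp_sub).1).congr_of_eventuallyEq
      (hV' y hy)).differentiableWithinAt
  · exact fun y hy =>
      ((hasDD_killingPot hD (hsub y (hNU hy)) hA w F).comp_sub).1.differentiableWithinAt
  · exact fun j k y hy =>
      ((hasDM_killing hD (hsub y (hNU hy)) A j k).comp_sub).1.differentiableWithinAt
  · intro y hy j k l
    simp only [pd_killing hD hsub hA (hNU hy), cub_comm₂₃ _ _ l j, cub_comm₂₃ _ _ k j,
      cub_comm₂₃ _ _ l k]
    ring
  · intro y hy j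
    have h1 : ∀ k, pd k V y = potGrad D w F (y - c) k := fun k => by
      rw [← pd_pot hD hsub k₀ w F (hNU hy) k, pd, pd, (hV' y hy).fderiv_eq]
    rw [((hasDD_killingPot hD (hsub y (hNU hy)) hA w F).comp_sub).pd j, mulVec_single]
    simp only [h1, MulOpposite.op_one, one_smul, dotProduct, Matrix.col_apply]
    exact Finset.sum_congr rfl fun k _ => congrArg (· * _)
      (congrFun (congrFun (killing_transpose hA (y - c)) j) k)

/-- Functional independence of the five constants of the motion for a suitable potential. -/
lemma linearIndependent_fderiv_quadFun {x : C3} (hx : x ∈ U) (hreg : x - c ∈ regularSet D) {w : C3}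
    {F : ℂ} (hw : ∀ k, potGrad D w F (x - c) k
      = (Pi.single 2 1 : C3) k - 2 / 3 * cub (flow D (x - c)) k 0 0) :
    LinearIndependent ℂ (fun h : Fin 5 => fderiv ℂ (quadFun
      (fun y => killing D (symBasis h.castSucc) (y - c))
      (fun y => killingPot D (symBasis h.castSucc) w F (y - c))) (x, Pi.single 0 1)) := by
  rw [Fintype.linearIndependent_iff]
  intro g hg
  have hA := symBasis_transpose
  have hd : ∀ u η, ∑ h : Fin 5, g h * fderiv ℂ (quadFun
      (fun y => killing D (symBasis h.castSucc) (y - c))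
      (fun y => killingPot D (symBasis h.castSucc) w F (y - c))) (x, Pi.single 0 1) (u, η) = 0 :=
    fun u η => by
      have := congrArg (fun L : Phase →L[ℂ] ℂ => L (u, η)) hg
      simpa [_root_.sum_apply] using this
  simp only [fderiv_quadFun (fun j k => ((hasDM_killing hD (hsub x hx) _ j k).comp_sub).1)
    ((hasDD_killingPot hD (hsub x hx) (hA _) w F).comp_sub).1] at hd
  set M : Matrix (Fin 3) (Fin 3) ℂ := ∑ h : Fin 5, g h • killing D (symBasis h.castSucc) (x - c)
    with hM
  have hMa : ∀ i j, M i j = ∑ h : Fin 5, g h * killing D (symBasis h.castSucc) (x - c) i j :=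
    fun i j => by simp [hM, Matrix.sum_apply]
  have hks : ∀ h i j, killing D (symBasis h) (x - c) i j = killing D (symBasis h) (x - c) j i :=
    fun h i j => congrFun (congrFun (killing_transpose (hA h) (x - c)) j) i
  have hMs : ∀ i j, M i j = M j i := fun i j => by
    rw [hMa, hMa]; exact Finset.sum_congr rfl fun h _ => by rw [hks]
  -- The derivatives in the momenta at p = e₀ give M e₀ = 0.
  have h1 : ∀ i, M i 0 = 0 := fun i => by
    have := hd 0 (Pi.single i 1)
    simp only [map_zero, Pi.single_apply, mul_ite, mul_one, mul_zero, zero_add, add_zero,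
      Finset.sum_add_distrib, Finset.sum_ite_eq', Finset.mem_univ, if_true, mul_add,
      hks _ 0 i] at this
    rw [hMa]
    linear_combination this / 2
  -- The derivatives in x give ∂ᵢM₀₀ (with coefficients held fixed) plus (M∇V)ᵢ. The correction -⅔
  -- Gₖ₀₀ in ∇V cancels the first part of ∂ᵢM₀₀, and the rest contains M e₀ = 0, so M e₂ = 0.
  have h2 : ∀ i, M i 2 = 0 := fun i => by
    have := hd (Pi.single i 1) 0
    have e1 : ∀ h : Fin 6, fderiv ℂ (fun y => killing D (symBasis h) (y - c) 0 0) x (Pi.single i 1)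
        = _ := fun h => pd_killing hD hsub (hA h) hx i 0 0
    have e2 : ∀ h : Fin 6, fderiv ℂ (fun y => killingPot D (symBasis h) w F (y - c)) x
        (Pi.single i 1) = ∑ m, killing D (symBasis h) (x - c) m i * potGrad D w F (x - c) m := by
      intro h
      refine (((hasDD_killingPot hD (hsub x hx) (hA h) w F).comp_sub).2 _).trans ?_
      simp [mulVec_single, dotProduct]
    simp only [Pi.single_apply, mul_ite, mul_one, mul_zero, add_zero, Pi.zero_apply,
      ite_self, Finset.sum_ite_eq', Finset.mem_univ, if_true] at this
    have e3 : ∀ h : Fin 5, g h * (fderiv ℂ (fun y => killing D (symBasis h.castSucc) (y - c) 0 0) x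
        (Pi.single i 1) + fderiv ℂ (fun y => killingPot D (symBasis h.castSucc) w F (y - c)) x
        (Pi.single i 1)) = g h * killing D (symBasis h.castSucc) (x - c) i 2
          - 2 / 3 * ∑ m, cub (flow D (x - c)) m i 0 *
            (g h * killing D (symBasis h.castSucc) (x - c) m 0) := by
      intro h
      rw [e1, e2, hks _ i 2]
      simp only [hw, Fin.sum_univ_three, Pi.single_apply]
      simp
      ring
    have e4 := (Finset.sum_congr rfl fun h _ => (e3 h).symm).trans this
    rw [Finset.sum_sub_distrib, ← hMa, ← Finset.mul_sum, Finset.sum_comm] at e4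
    simp only [← Finset.mul_sum, ← hMa, h1, mul_zero, Finset.sum_const_zero, sub_zero] at e4
    exact e4
  have hM5 : M = M 1 1 • symBasis 5 := by
    ext i j
    fin_cases i <;> fin_cases j <;> simp [symBasis, h1, h2, hMs 0 _, hMs 2 _]
  -- M is now a multiple of the sixth form. This is why regularity demands that the five Killing
  -- tensors be independent of that form as well.
  have hli := Fintype.linearIndependent_iff.mp hreg.2 (Fin.snoc (α := fun _ => ℂ) g (-M 1 1)) ?_
  · intro i
    simpa using hli i.castSucc
  · rw [Fin.sum_univ_castSucc]
    simp only [Fin.snoc_castSucc, Fin.snoc_last, killingFamily]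
    rw [if_pos (show Fin.last 5 = 5 from rfl)]
    have : ∀ h : Fin 5, (h.castSucc = (5 : Fin 6)) = False := fun h =>
      eq_false (Fin.castSucc_lt_last h).ne
    simp only [this, if_false, ← hM]
    rw [neg_smul, ← sub_eq_add_neg, sub_eq_zero]
    exact hM5

theorem isSuperintegrable_flow (hU : IsOpen U) (hreg : ∀ y ∈ U, y - c ∈ regularSet D) :
    IsSuperintegrable U (fun y => coeffs (flow D (y - c))) := by
  have hA := symBasis_transpose
  refine ⟨fun h y => killing D (symBasis h.castSucc) (y - c), fun y hy => ?_,
    fun h y hy => killing_transpose (hA _) _, fun h i j y hy => ?_, fun y hy => ?_, ?_, ?_⟩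
  · exact killing_one hD _
  · exact ((hasDM_killing hD (hsub y hy) _ i j).comp_sub).1.differentiableWithinAt
  · have := (hreg y hy).2.comp (Fin.castSucc : Fin 5 → Fin 6) (Fin.castSucc_injective 5)
    convert this using 1
    ext1 h
    simp only [Function.comp, killingFamily]
    rw [if_neg (show h.castSucc ≠ (5 : Fin 6) from (Fin.castSucc_lt_last h).ne)]
  · intro x hx N V hN hxN hNU hV
    -- By uniqueness every potential coincides near x with an explicit one, for which the extra
    -- terms W are known.
    obtain ⟨k₀, w, F, hd⟩ := exists_pot_data hD hU hsub hx (V x) (fun i => pd i V x)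
      (pd 0 (pd 0 V) x)
    have heq := potential_unique hD hN (fun y hy => hsub y (hNU hy)) hV
      (isPotential_pot hD hN (fun y hy => hsub y (hNU hy)) k₀ w F) hxN hd.1.symm
      (fun k => (hd.2.1 k).symm) hd.2.2.symm
    obtain ⟨N', hN', hN'o, hx'⟩ := eventually_nhds_iff.mp (heq.and (hN.mem_nhds hxN))
    exact ⟨N', hN'o, hx', fun y hy => (hN' y hy).2, fun h y => killingPot D (symBasis h.castSucc) w F (y - c),
      fun h => isConstantOfMotion_killing hD hsub hN'o (fun y hy => hNU (hN' y hy).2)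
        (fun y hy => (hN' y hy).1) (hA _)⟩
  · intro x hx
    obtain ⟨k₀, w, F, hd⟩ := exists_pot_data hD hU hsub hx 0
      (fun k => (Pi.single 2 1 : C3) k - 2 / 3 * cub (flow D (x - c)) k 0 0) 0
    refine ⟨U, fun y => pot D k₀ w F (y - c),
      fun h y => killingPot D (symBasis h.castSucc) w F (y - c), Pi.single 0 1, hU, hx, subset_rfl,
      isPotential_pot hD hU hsub k₀ w F, fun h => isConstantOfMotion_killing hD hsub hU subset_rfl
        (fun y _ => rfl) (hA _), ?_⟩
    refine linearIndependent_fderiv_quadFun hD hsub hx (hreg x hx) fun k => ?_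
    rw [← pd_pot hD hsub k₀ w F hx k, hd.2.1]

end

/-- The explicit system through `D` at the point `c` over a small connected open set. -/
def flowSystem {D : Ten} (hD : D ∈ variety) (c : C3) (U : Set C3) (hU : IsOpen U)
    (hUc : IsConnected U) (hreg : ∀ y ∈ U, y - c ∈ regularSet D) : System where
  U := U
  isOpen := hU
  isConnected := hUc
  K := fun y => coeffs (flow D (y - c))
  holomorphic := fun r k y hy => by
    have hE := ((solvesTranslation_flow hD (hreg y hy).1).comp_sub (c := c)).hasDD_cub
    have h : ∀ i j k, DifferentiableAt ℂ (fun y => cub (flow D (y - c)) i j k) y := fun i j k =>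
      (hE i j k).1
    have ht : ∀ i j, DifferentiableAt ℂ (fun y => tensor (flow D (y - c)) i j k) y := fun i j => by
      -- The added diagonal term is G₀₀ₖ itself, since `tensor` vanishes at i = j = 0.
      have : (fun y => tensor (flow D (y - c)) i j k) = fun y => cub (flow D (y - c)) i j k
          - if i = j then cub (flow D (y - c)) 0 0 k else 0 := by
        ext y
        rcases eq_or_ne i j with rfl | hij
        · simp only [cub, if_true]
          fin_cases k <;> simp [tensor]
        · simp [cub, hij]
      rw [this]
      split_ifs
      · exact (h _ _ _).sub (h _ _ _)
      · exact (h _ _ _).sub (differentiableAt_const _)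
    refine DifferentiableAt.differentiableWithinAt ?_
    fin_cases r
    · exact ht 1 1
    · exact ht 2 2
    · exact ht 0 1
    · exact ht 0 2
    · exact ht 1 2
  nondegenerate := isNondegenerate_flow hD hU fun y hy => (hreg y hy).1
  superintegrable := isSuperintegrable_flow hD (fun y hy => (hreg y hy).1) hU hreg

lemma exists_ball_regular {D : Ten} (hD : D ∈ variety) (c : C3) :
    ∃ r > 0, ∀ y ∈ Metric.ball c r, y - c ∈ regularSet D := by
  obtain ⟨r, hr, hsub⟩ := Metric.mem_nhds_iff.mp (regularSet_mem_nhds hD)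
  exact ⟨r, hr, fun y hy => hsub (by simpa [dist_eq_norm] using hy)⟩

theorem exists_system {D : Ten} (hD : D ∈ variety) (x : C3) :
    ∃ S : System, x ∈ S.U ∧ tenOf (S.K x) = D := by
  obtain ⟨r, hr, h⟩ := exists_ball_regular hD x
  refine ⟨flowSystem hD x (Metric.ball x r) Metric.isOpen_ball
    ((convex_ball x r).isConnected (Metric.nonempty_ball.mpr hr)) h, Metric.mem_ball_self hr, ?_⟩
  change tenOf (coeffs (flow D (x - x))) = D
  rw [tenOf_coeffs, sub_self, flow_zero]

end

/-! ### Linear algebra of five independent symmetric matrices -/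

/-- The six independent components of a symmetric matrix. -/
def symVec (a : Matrix (Fin 3) (Fin 3) ℂ) : Fin 6 → ℂ :=
  ![a 0 0, a 0 1, a 0 2, a 1 1, a 1 2, a 2 2]

lemma linearIndependent_symVec {a : Fin 5 → Matrix (Fin 3) (Fin 3) ℂ}
    (hs : ∀ h, (a h).IsSymm) (ha : LinearIndependent ℂ a) :
    LinearIndependent ℂ fun h => symVec (a h) := by
  rw [Fintype.linearIndependent_iff] at ha ⊢
  intro g hg
  refine ha g ?_
  have e := fun n => congrFun hg n
  have e0 := e 0; have e1 := e 1; have e2 := e 2; have e3 := e 3; have e4 := e 4; have e5 := e 5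
  simp [symVec, Finset.sum_apply] at e0 e1 e2 e3 e4 e5
  have h10 := fun h => (hs h).apply 0 1
  have h20 := fun h => (hs h).apply 0 2
  have h21 := fun h => (hs h).apply 1 2
  ext i j
  fin_cases i <;> fin_cases j <;> simp [Matrix.sum_apply, *]

/-- Two linear functionals that vanish on five independent vectors of a six-dimensional space are
proportional. -/
lemma minor_eq_of_dotProduct_eq_zero {v : Fin 5 → Fin 6 → ℂ} (hv : LinearIndependent ℂ v)
    {f g : Fin 6 → ℂ} (hf : ∀ h, f ⬝ᵥ v h = 0) (hg : ∀ h, g ⬝ᵥ v h = 0) (i j : Fin 6) :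
    f i * g j - f j * g i = 0 := by
  by_contra hne
  let φ : (Fin 6 → ℂ) →ₗ[ℂ] (Fin 2 → ℂ) := Matrix.mulVecLin (Matrix.of ![f, g])
  have hφ : ∀ w, φ w = ![f ⬝ᵥ w, g ⬝ᵥ w] := fun w => by
    ext n; fin_cases n <;> simp [φ, Matrix.mulVec]
  have hsurj : Function.Surjective φ := by
    intro w
    refine ⟨(f i * g j - f j * g i)⁻¹ • ((w 0 * g j - w 1 * f j) • Pi.single i 1
      + (f i * w 1 - g i * w 0) • Pi.single j 1), ?_⟩
    rw [hφ]
    ext n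
    fin_cases n <;> simp only [dotProduct_add, dotProduct_smul, dotProduct_single_one, smul_eq_mul,
      Fin.zero_eta, Fin.mk_one, Matrix.cons_val] <;> rw [inv_mul_eq_iff_eq_mul₀ hne] <;> ring
  have hr := LinearMap.finrank_range_add_finrank_ker φ
  rw [LinearMap.range_eq_top.mpr hsurj, finrank_top] at hr
  simp only [Module.finrank_fintype_fun_eq_card, Fintype.card_fin] at hr
  -- A nonzero minor makes φ surjective onto ℂ², so its kernel has dimension four, too small for
  -- five independent vectors.
  let w : Fin 5 → LinearMap.ker φ := fun h => ⟨v h, by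
    rw [LinearMap.mem_ker, hφ, hf, hg]; ext n; fin_cases n <;> rfl⟩
  have hw : LinearIndependent ℂ w :=
    LinearIndependent.of_comp (LinearMap.ker φ).subtype (by exact hv)
  have := hw.fintype_card_le_finrank
  simp at this
  omega

/-- The Kronecker symbol. -/
def kron (i j : Fin 3) : ℂ := if i = j then 1 else 0

/-- The tensor built from a totally symmetric tensor and a symmetric matrix. -/
def curv (s : Fin 3 → Fin 3 → Fin 3 → Fin 3 → ℂ) (q : Fin 3 → Fin 3 → ℂ) (u w x y : Fin 3) : ℂ :=
  s u w x y + 5 / 18 * kron u w * q x y + 2 / 18 * q u w * kron x y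

/-- The commutator of two matrices. -/
def comq (q : Fin 3 → Fin 3 → ℂ) (a : Matrix (Fin 3) (Fin 3) ℂ) (i j : Fin 3) : ℂ :=
  ∑ k, (q i k * a k j - a i k * q k j)

set_option linter.unusedSimpArgs false in
set_option maxHeartbeats 400000 in
/-- If the integrability conditions of the Killing tensors hold for five independent symmetric
matrices, then the curvature terms are scalar. -/
theorem rigidity {a : Fin 5 → Matrix (Fin 3) (Fin 3) ℂ}
    (hs : ∀ h, (a h).IsSymm) (ha : LinearIndependent ℂ a)
    {s : Fin 3 → Fin 3 → Fin 3 → Fin 3 → ℂ} {q : Fin 3 → Fin 3 → ℂ}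
    (s₁ : ∀ i j k l, s i j k l = s j i k l) (s₂ : ∀ i j k l, s i j k l = s i k j l)
    (s₃ : ∀ i j k l, s i j k l = s i j l k) (hq : ∀ i j, q i j = q j i)
    (hR : ∀ h u v x y, 2 * ∑ k, (curv s q u k x y * a h k v - curv s q v k x y * a h k u)
      + 1 / 9 * (kron u x * comq q (a h) y v + kron u y * comq q (a h) x v
        - kron v x * comq q (a h) y u - kron v y * comq q (a h) x u) = 0) :
    (∃ τ, ∀ i j, q i j = τ * kron i j) ∧ ∀ i j k l, s i j k l = 0 := by
  have hv := linearIndependent_symVec hs ha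
  have h10 := fun h => (hs h).apply 0 1
  have h20 := fun h => (hs h).apply 0 2
  have h21 := fun h => (hs h).apply 1 2
  have q10 := hq 1 0; have q20 := hq 2 0; have q21 := hq 2 1
  have a10 := s₁ 1 0; have a20 := s₁ 2 0; have a21 := s₁ 2 1
  have b10 := fun i => s₂ i 1 0; have b20 := fun i => s₂ i 2 0; have b21 := fun i => s₂ i 2 1
  have c10 := fun i j => s₃ i j 1 0; have c20 := fun i j => s₃ i j 2 0
  have c21 := fun i j => s₃ i j 2 1
  -- Each choice of u, v, x, y gives a linear functional that annihilates the five matrices; the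
  -- factor 18 clears denominators. All these functionals are proportional to each other.
  have row : ∀ (u v x y : Fin 3) (f : Fin 6 → ℂ), (∀ h, f ⬝ᵥ symVec (a h) = 18 *
      (2 * ∑ k, (curv s q u k x y * a h k v - curv s q v k x y * a h k u)
      + 1 / 9 * (kron u x * comq q (a h) y v + kron u y * comq q (a h) x v
        - kron v x * comq q (a h) y u - kron v y * comq q (a h) x u))) →
      ∀ h, f ⬝ᵥ symVec (a h) = 0 := fun u v x y f hf h => by
    rw [hf, hR, mul_zero]
  have r1000 := row 1 0 0 0 ![36 * s 0 0 0 1 + 8 * q 0 1,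
      -36 * s 0 0 0 0 + 36 * s 0 0 1 1 - 8 * q 0 0 + 8 * q 1 1, 36 * s 0 0 1 2 + 8 * q 1 2,
      -36 * s 0 0 0 1 - 8 * q 0 1, -36 * s 0 0 0 2 - 8 * q 0 2, 0] (by
    intro h; simp [dotProduct, symVec, Fin.sum_univ_succ, curv, comq, kron, h10, h20, h21,
      q10, q20, q21, a10, a20, a21, b10, b20, b21, c10, c20, c21]; ring)
  have r2000 := row 2 0 0 0 ![36 * s 0 0 0 2 + 8 * q 0 2, 36 * s 0 0 1 2 + 8 * q 1 2,
      -36 * s 0 0 0 0 + 36 * s 0 0 2 2 - 8 * q 0 0 + 8 * q 2 2, 0, -36 * s 0 0 0 1 - 8 * q 0 1,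
      -36 * s 0 0 0 2 - 8 * q 0 2] (by
    intro h; simp [dotProduct, symVec, Fin.sum_univ_succ, curv, comq, kron, h10, h20, h21,
      q10, q20, q21, a10, a20, a21, b10, b20, b21, c10, c20, c21]; ring)
  have r1011 := row 1 0 1 1 ![36 * s 0 1 1 1 + 8 * q 0 1,
      -36 * s 0 0 1 1 + 36 * s 1 1 1 1 - 8 * q 0 0 + 8 * q 1 1, 36 * s 1 1 1 2 + 8 * q 1 2,
      -36 * s 0 1 1 1 - 8 * q 0 1, -36 * s 0 1 1 2 - 8 * q 0 2, 0] (by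
    intro h; simp [dotProduct, symVec, Fin.sum_univ_succ, curv, comq, kron, h10, h20, h21,
      q10, q20, q21, a10, a20, a21, b10, b20, b21, c10, c20, c21]; ring)
  have r2111 := row 2 1 1 1 ![0, 36 * s 0 1 1 2 + 8 * q 0 2, -36 * s 0 1 1 1 - 8 * q 0 1,
      36 * s 1 1 1 2 + 8 * q 1 2, -36 * s 1 1 1 1 + 36 * s 1 1 2 2 - 8 * q 1 1 + 8 * q 2 2,
      -36 * s 1 1 1 2 - 8 * q 1 2] (by
    intro h; simp [dotProduct, symVec, Fin.sum_univ_succ, curv, comq, kron, h10, h20, h21,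
      q10, q20, q21, a10, a20, a21, b10, b20, b21, c10, c20, c21]; ring)
  have r2022 := row 2 0 2 2 ![36 * s 0 2 2 2 + 8 * q 0 2, 36 * s 1 2 2 2 + 8 * q 1 2,
      -36 * s 0 0 2 2 + 36 * s 2 2 2 2 - 8 * q 0 0 + 8 * q 2 2, 0, -36 * s 0 1 2 2 - 8 * q 0 1,
      -36 * s 0 2 2 2 - 8 * q 0 2] (by
    intro h; simp [dotProduct, symVec, Fin.sum_univ_succ, curv, comq, kron, h10, h20, h21,
      q10, q20, q21, a10, a20, a21, b10, b20, b21, c10, c20, c21]; ring)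
  have r2122 := row 2 1 2 2 ![0, 36 * s 0 2 2 2 + 8 * q 0 2, -36 * s 0 1 2 2 - 8 * q 0 1,
      36 * s 1 2 2 2 + 8 * q 1 2, -36 * s 1 1 2 2 + 36 * s 2 2 2 2 - 8 * q 1 1 + 8 * q 2 2,
      -36 * s 1 2 2 2 - 8 * q 1 2] (by
    intro h; simp [dotProduct, symVec, Fin.sum_univ_succ, curv, comq, kron, h10, h20, h21,
      q10, q20, q21, a10, a20, a21, b10, b20, b21, c10, c20, c21]; ring)
  have r1022 := row 1 0 2 2 ![36 * s 0 1 2 2 + 4 * q 0 1,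
      -36 * s 0 0 2 2 + 36 * s 1 1 2 2 - 4 * q 0 0 + 4 * q 1 1, 36 * s 1 2 2 2 + 4 * q 1 2,
      -36 * s 0 1 2 2 - 4 * q 0 1, -36 * s 0 2 2 2 - 4 * q 0 2, 0] (by
    intro h; simp [dotProduct, symVec, Fin.sum_univ_succ, curv, comq, kron, h10, h20, h21,
      q10, q20, q21, a10, a20, a21, b10, b20, b21, c10, c20, c21]; ring)
  have r2011 := row 2 0 1 1 ![36 * s 0 1 1 2 + 4 * q 0 2, 36 * s 1 1 1 2 + 4 * q 1 2,
      -36 * s 0 0 1 1 + 36 * s 1 1 2 2 - 4 * q 0 0 + 4 * q 2 2, 0, -36 * s 0 1 1 1 - 4 * q 0 1,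
      -36 * s 0 1 1 2 - 4 * q 0 2] (by
    intro h; simp [dotProduct, symVec, Fin.sum_univ_succ, curv, comq, kron, h10, h20, h21,
      q10, q20, q21, a10, a20, a21, b10, b20, b21, c10, c20, c21]; ring)
  have r2100 := row 2 1 0 0 ![0, 36 * s 0 0 0 2 + 4 * q 0 2, -36 * s 0 0 0 1 - 4 * q 0 1,
      36 * s 0 0 1 2 + 4 * q 1 2, -36 * s 0 0 1 1 + 36 * s 0 0 2 2 - 4 * q 1 1 + 4 * q 2 2,
      -36 * s 0 0 1 2 - 4 * q 1 2] (by
    intro h; simp [dotProduct, symVec, Fin.sum_univ_succ, curv, comq, kron, h10, h20, h21,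
      q10, q20, q21, a10, a20, a21, b10, b20, b21, c10, c20, c21]; ring)
  have r1010 := row 1 0 1 0 ![36 * s 0 0 1 1, -36 * s 0 0 0 1 + 36 * s 0 1 1 1, 36 * s 0 1 1 2,
      -36 * s 0 0 1 1, -36 * s 0 0 1 2, 0] (by
    intro h; simp [dotProduct, symVec, Fin.sum_univ_succ, curv, comq, kron, h10, h20, h21,
      q10, q20, q21, a10, a20, a21, b10, b20, b21, c10, c20, c21]; ring)
  have r2020 := row 2 0 2 0 ![36 * s 0 0 2 2, 36 * s 0 1 2 2, -36 * s 0 0 0 2 + 36 * s 0 2 2 2, 0,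
      -36 * s 0 0 1 2, -36 * s 0 0 2 2] (by
    intro h; simp [dotProduct, symVec, Fin.sum_univ_succ, curv, comq, kron, h10, h20, h21,
      q10, q20, q21, a10, a20, a21, b10, b20, b21, c10, c20, c21]; ring)
  have r2121 := row 2 1 2 1 ![0, 36 * s 0 1 2 2, -36 * s 0 1 1 2, 36 * s 1 1 2 2,
      -36 * s 1 1 1 2 + 36 * s 1 2 2 2, -36 * s 1 1 2 2] (by
    intro h; simp [dotProduct, symVec, Fin.sum_univ_succ, curv, comq, kron, h10, h20, h21,
      q10, q20, q21, a10, a20, a21, b10, b20, b21, c10, c20, c21]; ring)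
  have r1020 := row 1 0 2 0 ![36 * s 0 0 1 2, -36 * s 0 0 0 2 + 36 * s 0 1 1 2 - 2 * q 0 2,
      36 * s 0 1 2 2 + 2 * q 0 1, -36 * s 0 0 1 2 - 2 * q 1 2,
      -36 * s 0 0 2 2 + 2 * q 1 1 - 2 * q 2 2, 2 * q 1 2] (by
    intro h; simp [dotProduct, symVec, Fin.sum_univ_succ, curv, comq, kron, h10, h20, h21,
      q10, q20, q21, a10, a20, a21, b10, b20, b21, c10, c20, c21]; ring)
  have r1021 := row 1 0 2 1 ![36 * s 0 1 1 2 + 2 * q 0 2,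
      -36 * s 0 0 1 2 + 36 * s 1 1 1 2 + 2 * q 1 2, 36 * s 1 1 2 2 - 2 * q 0 0 + 2 * q 2 2,
      -36 * s 0 1 1 2, -36 * s 0 1 2 2 - 2 * q 0 1, -2 * q 0 2] (by
    intro h; simp [dotProduct, symVec, Fin.sum_univ_succ, curv, comq, kron, h10, h20, h21,
      q10, q20, q21, a10, a20, a21, b10, b20, b21, c10, c20, c21]; ring)
  have r2021 := row 2 0 2 1 ![36 * s 0 1 2 2 + 2 * q 0 1, 36 * s 1 1 2 2 - 2 * q 0 0 + 2 * q 1 1,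
      -36 * s 0 0 1 2 + 36 * s 1 2 2 2 + 2 * q 1 2, -2 * q 0 1, -36 * s 0 1 1 2 - 2 * q 0 2,
      -36 * s 0 1 2 2] (by
    intro h; simp [dotProduct, symVec, Fin.sum_univ_succ, curv, comq, kron, h10, h20, h21,
      q10, q20, q21, a10, a20, a21, b10, b20, b21, c10, c20, c21]; ring)
  have r2010 := row 2 0 1 0 ![36 * s 0 0 1 2, 36 * s 0 1 1 2 + 2 * q 0 2,
      -36 * s 0 0 0 1 + 36 * s 0 1 2 2 - 2 * q 0 1, 2 * q 1 2,
      -36 * s 0 0 1 1 - 2 * q 1 1 + 2 * q 2 2, -36 * s 0 0 1 2 - 2 * q 1 2] (by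
    intro h; simp [dotProduct, symVec, Fin.sum_univ_succ, curv, comq, kron, h10, h20, h21,
      q10, q20, q21, a10, a20, a21, b10, b20, b21, c10, c20, c21]; ring)
  have r2120 := row 2 1 2 0 ![-2 * q 0 1, 36 * s 0 0 2 2 + 2 * q 0 0 - 2 * q 1 1,
      -36 * s 0 0 1 2 - 2 * q 1 2, 36 * s 0 1 2 2 + 2 * q 0 1,
      -36 * s 0 1 1 2 + 36 * s 0 2 2 2 + 2 * q 0 2, -36 * s 0 1 2 2] (by
    intro h; simp [dotProduct, symVec, Fin.sum_univ_succ, curv, comq, kron, h10, h20, h21,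
      q10, q20, q21, a10, a20, a21, b10, b20, b21, c10, c20, c21]; ring)
  -- The method of the whole proof: a 2×2 minor of two rows that is a multiple of a square forces
  -- its root to vanish.
  have sq : ∀ {f g : Fin 6 → ℂ}, (∀ h, f ⬝ᵥ symVec (a h) = 0) → (∀ h, g ⬝ᵥ symVec (a h) = 0) →
      ∀ (i j : Fin 6) {z : ℂ} (c : ℂ), z ^ 2 = c * (f i * g j - f j * g i) → z = 0 :=
    fun hf hg i j z c e => by
      rw [minor_eq_of_dotProduct_eq_zero hv hf hg, mul_zero] at e
      exact pow_eq_zero_iff two_ne_zero |>.mp e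
  have z01 : 36 * s 0 0 0 1 + 8 * q 0 1 = 0 := sq r1000 r2000 3 4 (1) (by simp only [Matrix.cons_val]; ring)
  have z02 : 36 * s 0 0 0 2 + 8 * q 0 2 = 0 := sq r1000 r2000 4 5 (1) (by simp only [Matrix.cons_val]; ring)
  have z10 : 36 * s 0 1 1 1 + 8 * q 0 1 = 0 := sq r1011 r2111 0 2 (-1) (by simp only [Matrix.cons_val]; ring)
  have z12 : 36 * s 1 1 1 2 + 8 * q 1 2 = 0 := sq r1011 r2111 2 5 (-1) (by simp only [Matrix.cons_val]; ring)
  have z20 : 36 * s 0 2 2 2 + 8 * q 0 2 = 0 := sq r2022 r2122 0 1 (1) (by simp only [Matrix.cons_val]; ring)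
  have z21 : 36 * s 1 2 2 2 + 8 * q 1 2 = 0 := sq r2022 r2122 1 3 (1) (by simp only [Matrix.cons_val]; ring)
  -- Sums over x = y. These rows contain the traces of s and give the entries s i j k k with i, j, k
  -- distinct.
  have add3 : ∀ {f g k : Fin 6 → ℂ}, (∀ h, f ⬝ᵥ symVec (a h) = 0) → (∀ h, g ⬝ᵥ symVec (a h) = 0) →
      (∀ h, k ⬝ᵥ symVec (a h) = 0) → ∀ h, (f + g + k) ⬝ᵥ symVec (a h) = 0 := fun hf hg hk h => by
    rw [add_dotProduct, add_dotProduct, hf, hg, hk, add_zero, add_zero]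
  have t10 := add3 r1000 r1011 r1022
  have t20 := add3 r2000 r2011 r2022
  have t21 := add3 r2100 r2111 r2122
  have p01 : 36 * (s 0 0 0 1 + s 0 1 1 1 + s 0 1 2 2) + 20 * q 0 1 = 0 := sq t10 t20 3 4 (1) (by
    simp only [Pi.add_apply, Matrix.cons_val]; ring)
  have p02 : 36 * (s 0 0 0 2 + s 0 1 1 2 + s 0 2 2 2) + 20 * q 0 2 = 0 := sq t10 t20 4 5 (1) (by
    simp only [Pi.add_apply, Matrix.cons_val]; ring)
  have p12 : 36 * (s 0 0 1 2 + s 1 1 1 2 + s 1 2 2 2) + 20 * q 1 2 = 0 := sq t10 t21 2 5 (-1) (by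
    simp only [Pi.add_apply, Matrix.cons_val]; ring)
  have y01 : s 0 1 2 2 = -(1 / 9) * q 0 1 := by linear_combination (p01 - z01 - z10) / 36
  have y02 : s 0 1 1 2 = -(1 / 9) * q 0 2 := by linear_combination (p02 - z02 - z20) / 36
  have y12 : s 0 0 1 2 = -(1 / 9) * q 1 2 := by linear_combination (p12 - z12 - z21) / 36
  have w12 : q 1 2 = 0 := sq r1010 r1020 4 5 (1 / 8) (by
    simp only [Matrix.cons_val]; rw [y12]; ring)
  have w02 : q 0 2 = 0 := sq r1010 r1021 2 5 (1 / 8) (by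
    simp only [Matrix.cons_val]; rw [y02]; ring)
  have w01 : q 0 1 = 0 := sq r2020 r2021 1 3 (1 / 8) (by
    simp only [Matrix.cons_val]; rw [y01]; ring)
  have v01 : s 0 0 0 1 = 0 := by linear_combination z01 / 36 - 8 / 36 * w01
  have v02 : s 0 0 0 2 = 0 := by linear_combination z02 / 36 - 8 / 36 * w02
  have v10 : s 0 1 1 1 = 0 := by linear_combination z10 / 36 - 8 / 36 * w01
  have v12 : s 1 1 1 2 = 0 := by linear_combination z12 / 36 - 8 / 36 * w12
  have v20 : s 0 2 2 2 = 0 := by linear_combination z20 / 36 - 8 / 36 * w02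
  have v21 : s 1 2 2 2 = 0 := by linear_combination z21 / 36 - 8 / 36 * w12
  have u01 : s 0 1 2 2 = 0 := by rw [y01, w01, mul_zero]
  have u02 : s 0 1 1 2 = 0 := by rw [y02, w02, mul_zero]
  have u12 : s 0 0 1 2 = 0 := by rw [y12, w12, mul_zero]
  have mn := fun {f g : Fin 6 → ℂ} (hf : ∀ h, f ⬝ᵥ symVec (a h) = 0)
    (hg : ∀ h, g ⬝ᵥ symVec (a h) = 0) => minor_eq_of_dotProduct_eq_zero hv hf hg
  simp only [w01, w02, w12, v01, v02, v10, v12, v20, v21, u01, u02, u12, mul_zero, add_zero,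
    zero_add, sub_zero, neg_zero]
      at r1000 r2000 r1011 r2111 r2022 r2122 r1010 r2020 r2121 r1020 r1021 r2021 r2010 r2120
  have m1 := mn r1010 r2020 3 5
  have m2 := mn r1010 r2010 3 4
  have m3 := mn r1010 r1020 3 4
  have m4 := mn r2020 r1020 5 4
  have m5 := mn r2020 r2010 5 4
  have m6 := mn r2020 r2121 0 3
  have m7 := mn r2121 r2021 3 1
  have m8 := mn r2121 r2120 3 1
  simp only [Matrix.cons_val] at m1 m2 m3 m4 m5 m6 m7 m8
  -- In `m2 + m3` the differences of diagonal entries of q cancel, and `m1` removes the mixed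
  -- product; the square 36² s² remains.
  have x01 : s 0 0 1 1 = 0 := pow_eq_zero_iff two_ne_zero |>.mp (by
    linear_combination (m2 + m3 - m1) / 1296)
  have x02 : s 0 0 2 2 = 0 := pow_eq_zero_iff two_ne_zero |>.mp (by
    linear_combination (m4 + m5 - m1) / 1296)
  have x12 : s 1 1 2 2 = 0 := pow_eq_zero_iff two_ne_zero |>.mp (by
    linear_combination (m7 + m8 - m6) / 1296)
  simp only [x01, x02, x12, mul_zero, add_zero, zero_add, sub_zero, zero_sub, neg_zero]
    at r1000 r2000 r1011 r2111 r2022 r2122 r1020 r1021 r2021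
  have n1 := mn r2021 r1021 1 2
  have n2 := mn r2021 r1020 1 4
  have n3 := mn r1021 r1020 2 4
  have n4 := mn r1000 r2000 1 2
  have n5 := mn r1011 r2111 1 4
  have n6 := mn r2022 r2122 2 4
  simp only [Matrix.cons_val] at n1 n2 n3 n4 n5 n6
  have d01 : q 0 0 - q 1 1 = 0 := pow_eq_zero_iff two_ne_zero |>.mp (by
    linear_combination (n1 + n2) / 4)
  have d12 : q 1 1 - q 2 2 = 0 := pow_eq_zero_iff two_ne_zero |>.mp (by
    linear_combination (n2 - n3) / 4)
  have e1 : q 1 1 = q 0 0 := by linear_combination -d01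
  have e2 : q 2 2 = q 0 0 := by linear_combination -d01 - d12
  simp only [e1, e2] at n4 n5 n6
  have f0 : s 0 0 0 0 = 0 := pow_eq_zero_iff two_ne_zero |>.mp (by linear_combination n4 / 1296)
  have f1 : s 1 1 1 1 = 0 := pow_eq_zero_iff two_ne_zero |>.mp (by linear_combination -n5 / 1296)
  have f2 : s 2 2 2 2 = 0 := pow_eq_zero_iff two_ne_zero |>.mp (by linear_combination n6 / 1296)
  refine ⟨⟨q 0 0, fun i j => ?_⟩, fun i j k l => ?_⟩
  · fin_cases i <;> fin_cases j <;> simp [kron, q10, q20, q21, w01, w02, w12, e1, e2]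
  · fin_cases i <;> fin_cases j <;> fin_cases k <;> fin_cases l <;>
      simp only [Fin.zero_eta, Fin.mk_one, Fin.reduceFinMk, a10, a20, a21, b10, b20, b21, c10, c20,
        c21, f0, f1, f2, x01, x02, x12, v01, v02, v10, v12, v20, v21, u01, u02, u12]

/-! ### Reduction of the integrability conditions to a single scalar. -/

lemma kron_comm (i j : Fin 3) : kron i j = kron j i := by simp [kron, eq_comm]

lemma sum_kron_mul (f : Fin 3 → ℂ) (i : Fin 3) : ∑ k, kron i k * f k = f i := by simp [kron]

/-- The coefficients of the integrability conditions of the equations of the Killing tensors. -/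
def omg (θ b : Fin 3 → Fin 3 → Fin 3 → Fin 3 → ℂ) (u w x y : Fin 3) : ℂ :=
  θ u w x y - 3 * b u w x y + b u x w y + b w x u y

section
variable {θ b : Fin 3 → Fin 3 → Fin 3 → Fin 3 → ℂ} {q : Fin 3 → Fin 3 → ℂ}
  (θ₁ : ∀ u i j k, θ u i j k = θ u j i k) (θ₂ : ∀ u i j k, θ u i j k = θ u i k j)
  (b₁ : ∀ i j k l, b i j k l = b j i k l) (b₂ : ∀ i j k l, b i j k l = b k l i j)
  (hE : ∀ u v x y, 3 * (θ u v x y - θ v u x y) + 9 * (b v x u y - b u x v y)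
    + kron v x * q u y - kron u x * q v y = 0)
include θ₁ θ₂ b₁ b₂ hE

/-- Two contractions of the same relation: v = x produces 2 qₗₘ, and x = y produces qₗₘ - qₘₗ. In
the antisymmetric combination the terms with θ and b cancel by their symmetries, but q survives. -/
lemma symm_of_integrability (l m : Fin 3) : q l m = q m l := by
  have h1 : ∀ l m, ∑ i, (3 * (θ l i i m - θ i l i m) + 9 * (b i i l m - b l i i m))
      + 2 * q l m = 0 := by
    intro l m
    have h := Finset.sum_eq_zero (s := Finset.univ) fun i _ => hE l i i m
    simp only [Finset.sum_sub_distrib, Finset.sum_add_distrib, sum_kron_mul] at h ⊢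
    have h3 : ∑ i : Fin 3, kron i i * q l m = 3 * q l m := by simp [kron]
    linear_combination h - h3
  have h2 : ∑ j, 3 * (θ l m j j - θ m l j j) + q l m - q m l = 0 := by
    have h := Finset.sum_eq_zero (s := Finset.univ) fun j _ => hE l m j j
    simp only [Finset.sum_sub_distrib, Finset.sum_add_distrib, sum_kron_mul] at h
    have h3 : ∑ j, 9 * (b m j l j - b l j m j) = 0 := Finset.sum_eq_zero fun j _ => by
      rw [b₂ m j l j]; ring
    linear_combination h - h3
  have h3 : ∑ i, (3 * (θ l i i m - θ i l i m) + 9 * (b i i l m - b l i i m))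
      - ∑ i, (3 * (θ m i i l - θ i m i l) + 9 * (b i i m l - b m i i l))
      - ∑ j, 3 * (θ l m j j - θ m l j j) = 0 := by
    rw [← Finset.sum_sub_distrib, ← Finset.sum_sub_distrib]
    refine Finset.sum_eq_zero fun i _ => ?_
    linear_combination 3 * θ₂ l i i m + 3 * θ₁ l i m i - 3 * θ₂ m i i l - 3 * θ₁ m i l i
      + 3 * θ₁ i m i l + 3 * θ₂ i i m l - 3 * θ₁ i l i m
      + 9 * b₂ i i l m + 9 * b₁ l m i i + 9 * b₂ m l i i - 9 * b₁ l i i m - 9 * b₂ i l i m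
      - 9 * b₁ i m i l
  linear_combination -(h3 - h1 l m + h1 m l + h2)

/-- The relation `hE` splits into its parts symmetric and antisymmetric in x, y, which express the
antisymmetrizations of θ and of b by q alone. After subtraction of suitable q-terms `omg` becomes a
totally symmetric s, and the condition `hR` takes the form required by `rigidity`. -/
theorem scalar_of_integrability {a : Fin 5 → Matrix (Fin 3) (Fin 3) ℂ}
    (hs : ∀ h, (a h).IsSymm) (ha : LinearIndependent ℂ a)
    (hR : ∀ h u v x y, 2 * ∑ k, (omg θ b u k x y * a h k v - omg θ b v k x y * a h k u)
      - ∑ k, ((θ u v x k - θ v u x k) * a h k y + a h x k * (θ u v k y - θ v u k y))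
      + ∑ k, ((b v x u k - b u x v k) * a h k y - a h x k * (b v k u y - b u k v y)) = 0) :
    ∃ τ : ℂ, (∀ u w x y, θ u w x y = b u w x y + τ / 6 * kron u w * kron x y
        + τ / 18 * (kron u x * kron w y + kron u y * kron w x)) ∧
      ∀ u v x y, 9 * (b v x u y - b u x v y) = -τ * (kron v x * kron u y - kron u x * kron v y) := by
  have hq := symm_of_integrability θ₁ θ₂ b₁ b₂ hE
  have b₃ : ∀ i j k l, b i j k l = b i j l k := fun i j k l => by rw [b₂, b₁, b₂]
  have hθ : ∀ u v x y, 3 * (θ u v x y - θ v u x y) = -(1 / 2) * (kron v x * q u y + kron v y * q u x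
      - kron u x * q v y - kron u y * q v x) := fun u v x y => by
    linear_combination (hE u v x y + hE u v y x) / 2 + 3 / 2 * θ₂ u v x y - 3 / 2 * θ₂ v u x y
      - 9 / 2 * b₂ v x u y - 9 / 2 * b₂ v y u x
  have hb : ∀ u v x y, 9 * (b v x u y - b u x v y) = -(1 / 2) * (kron v x * q u y - kron v y * q u x
      - kron u x * q v y + kron u y * q v x) := fun u v x y => by
    linear_combination (hE u v x y - hE u v y x) / 2 - 3 / 2 * θ₂ u v x y + 3 / 2 * θ₂ v u x y
      + 9 / 2 * b₂ v x u y + 9 / 2 * b₂ v y u x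
  set s : Fin 3 → Fin 3 → Fin 3 → Fin 3 → ℂ := fun u w x y => omg θ b u w x y
    - 1 / 18 * (kron u x * q w y + kron u y * q w x)
    + 1 / 9 * (q u x * kron w y + q u y * kron w x)
    - 5 / 18 * kron u w * q x y - 2 / 18 * q u w * kron x y with hsdef
  have s₁ : ∀ u w x y, s u w x y = s w u x y := fun u w x y => by
    simp only [hsdef, omg]
    linear_combination hθ u w x y / 3 - 3 * b₁ u w x y + 5 / 18 * q x y * kron_comm w u
      + 2 / 18 * kron x y * hq w u
  have s₂ : ∀ u w x y, s u w x y = s u x w y := fun u w x y => by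
    simp only [hsdef, omg]
    linear_combination θ₁ u w x y + 4 / 9 * hb w x u y + 4 * b₁ u x w y - 4 * b₁ u w x y
      + b₁ w x u y + 2 / 9 * q w y * kron_comm u x - 1 / 18 * kron u y * hq w x
      + 2 / 9 * kron w y * hq u x + 1 / 9 * q u y * kron_comm w x - 2 / 9 * q x y * kron_comm u w
      - 2 / 9 * kron x y * hq u w
  have s₃ : ∀ u w x y, s u w x y = s u w y x := fun u w x y => by
    simp only [hsdef, omg]
    linear_combination θ₂ u w x y - 3 * b₃ u w x y + b₂ u x w y + b₂ w x u y
      - 5 / 18 * kron u w * hq x y - 2 / 18 * q u w * kron_comm x y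
  obtain ⟨⟨τ, hτ⟩, h0⟩ := rigidity hs ha s₁ s₂ s₃ hq fun h u v x y => by
    have hA : ∀ i j, a h i j = a h j i := fun i j => (hs h).apply j i
    have hk : ∀ i j, ∑ k, kron k i * a h k j = a h i j := fun i j => by
      simp only [kron_comm _ i, sum_kron_mul]
    have hk' : ∀ i j, ∑ k, kron i k * a h k j = a h i j := fun i j => sum_kron_mul _ i
    obtain ⟨m, hm⟩ : ∃ m : Fin 3 → Fin 3 → ℂ, ∀ i j, ∑ k, q i k * a h k j = m i j := ⟨_, fun _ _ => rfl⟩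
    have hm' : ∀ i j, ∑ k, q k i * a h k j = m i j := fun i j => by simp only [hq _ i, hm]
    have hc : ∀ i j, comq q (a h) i j = m i j - m j i := fun i j => by
      rw [comq, Finset.sum_sub_distrib, hm, ← hm j i]
      congr 1
      exact Finset.sum_congr rfl fun k _ => by rw [hA i k, hq k j]; ring
    have h2 : ∀ u v, ∑ k, curv s q u k x y * a h k v = ∑ k, omg θ b u k x y * a h k v
        - 1 / 18 * (kron u x * m y v + kron u y * m x v)
        + 1 / 9 * (q u x * a h y v + q u y * a h x v) := fun u v => by
      rw [← hm' y v, ← hm' x v, ← hk y v, ← hk x v]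
      simp only [Finset.mul_sum, ← Finset.sum_add_distrib, ← Finset.sum_sub_distrib]
      exact Finset.sum_congr rfl fun k _ => by simp only [curv, hsdef]; ring
    have h3 : ∀ x y, ∑ k, (θ u v x k - θ v u x k) * a h k y = -(1 / 6) * (kron v x * m u y
        + q u x * a h v y - kron u x * m v y - q v x * a h u y) := fun x y => by
      rw [← hm u y, ← hm v y, ← hk' v y, ← hk' u y]
      simp only [Finset.mul_sum, ← Finset.sum_add_distrib, ← Finset.sum_sub_distrib]
      exact Finset.sum_congr rfl fun k _ => by linear_combination a h k y / 3 * hθ u v x k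
    have h4 : ∀ x y, ∑ k, (b v x u k - b u x v k) * a h k y = -(1 / 18) * (kron v x * m u y
        - q u x * a h v y - kron u x * m v y + q v x * a h u y) := fun x y => by
      rw [← hm u y, ← hm v y, ← hk' v y, ← hk' u y]
      simp only [Finset.mul_sum, ← Finset.sum_add_distrib, ← Finset.sum_sub_distrib]
      exact Finset.sum_congr rfl fun k _ => by linear_combination a h k y / 9 * hb u v x k
    have h5 : ∑ k, a h x k * (θ u v k y - θ v u k y) = ∑ k, (θ u v y k - θ v u y k) * a h k x :=
      Finset.sum_congr rfl fun k _ => by rw [hA x k, θ₂ u v k y, θ₂ v u k y]; ring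
    have h6 : ∑ k, a h x k * (b v k u y - b u k v y)
        = -∑ k, (b v y u k - b u y v k) * a h k x := by
      rw [← Finset.sum_neg_distrib]
      exact Finset.sum_congr rfl fun k _ => by rw [hA x k, b₂ v k u y, b₂ u k v y]; ring
    have h1 := hR h u v x y
    rw [Finset.sum_sub_distrib,
      Finset.sum_add_distrib (f := fun k => (θ u v x k - θ v u x k) * a h k y),
      Finset.sum_sub_distrib (f := fun k => (b v x u k - b u x v k) * a h k y), h3, h5, h3, h4, h6,
      h4] at h1
    rw [Finset.sum_sub_distrib, h2, h2, hc, hc, hc, hc]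
    linear_combination h1 + 2 / 9 * q u x * hA y v + 2 / 9 * q u y * hA x v
      - 2 / 9 * q v x * hA y u - 2 / 9 * q v y * hA x u
  refine ⟨τ, fun u w x y => ?_, ?_⟩
  · have h := h0 u w x y
    have h1 := hb w x u y
    have h2 := hb u x w y
    simp only [hsdef, omg, hτ, kron_comm x] at h h1 h2
    simp only [kron_comm x]
    linear_combination h - h1 / 9 - h2 / 9 - b₁ u x w y + b₁ u w x y - b₁ w x u y
      + τ / 9 * kron y x * kron_comm u w
  · intro u v x y
    rw [hb, hτ, hτ, hτ, hτ]; ring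
end

/-! ### Integrability conditions of the canonical equations -/

lemma hasDD_pd {f : C3 → ℂ} {x : C3} (h : DifferentiableAt ℂ f x) :
    HasDD f (fun v => fderiv ℂ f x v) x := ⟨h, fun _ => rfl⟩

/-- Symmetry of the third derivatives of a function whose Hessian is `δᵢⱼ Φ + ∑ₖ Tᵢⱼₖ Vₖ`. -/
lemma third_derivative_symm {N : Set C3} (hN : IsOpen N) {V Φ : C3 → ℂ}
    {T : C3 → Fin 3 → Fin 3 → Fin 3 → ℂ} (hV : DifferentiableOn ℂ V N)
    (hT : ∀ i j k, DifferentiableOn ℂ (fun y => T y i j k) N) (hΦ : DifferentiableOn ℂ Φ N)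
    (h : ∀ y ∈ N, ∀ i j, pd i (pd j V) y = kron i j * Φ y + ∑ k, T y i j k * pd k V y)
    {x : C3} (hx : x ∈ N) (l i j : Fin 3) :
    kron i j * pd l Φ x - kron l j * pd i Φ x + (T x i j l - T x l j i) * Φ x
      + ∑ m, (pd l (fun y => T y i j m) x - pd i (fun y => T y l j m) x
        + ∑ k, (T x i j k * T x l k m - T x l j k * T x i k m)) * pd m V x = 0 := by
  have hn := hN.mem_nhds hx
  have key : ∀ l i, pd l (pd i (pd j V)) x = kron i j * pd l Φ x
      + ∑ k, (pd l (fun y => T y i j k) x * pd k V x + T x i j k * pd l (pd k V) x) := by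
    intro l i
    have h1 : HasDD (fun y => kron i j * Φ y + ∑ k, T y i j k * pd k V y) _ x :=
      ((hasDD_pd (hΦ.differentiableAt hn)).const_mul (kron i j)).add
        (HasDD.sum Finset.univ fun k => (hasDD_pd ((hT i j k).differentiableAt hn)).mul
          (hasDD_pd ((differentiableOn_pd hN hV k).differentiableAt hn)))
    exact (h1.congr (Filter.eventually_of_mem hn fun y hy => h y hy i j)).pd l
  have hc := pd_comm hN (differentiableOn_pd hN hV j) hx l i
  rw [key, key] at hc
  have hs : ∀ l i, ∑ k, T x i j k * pd l (pd k V) x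
      = T x i j l * Φ x + ∑ m, (∑ k, T x i j k * T x l k m) * pd m V x := by
    intro l i
    simp only [h x hx]
    have : ∑ k, T x i j k * (kron l k * Φ x) = T x i j l * Φ x := by
      rw [← sum_kron_mul (fun k => T x i j k * Φ x) l]
      exact Finset.sum_congr rfl fun k _ => by ring
    simp only [mul_add, Finset.sum_add_distrib, this, Finset.mul_sum, Finset.sum_mul]
    rw [Finset.sum_comm]
    simp only [mul_assoc]
  simp only [Finset.sum_add_distrib, hs] at hc
  simp only [add_mul, sub_mul, Finset.sum_add_distrib, Finset.sum_sub_distrib]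
  linear_combination hc

/-- The coefficients of `Vₖ` in `Vᵢⱼ - δᵢⱼ V₁₁`. -/
def coeffTensor (K : Coeffs) : Fin 3 → Fin 3 → Fin 3 → ℂ :=
  ![![0, K 2, K 3], ![K 2, K 0, K 4], ![K 3, K 4, K 1]]

lemma IsPotential.hessian {K : C3 → Coeffs} {N : Set C3} {V : C3 → ℂ} (hN : IsOpen N)
    (hV : IsPotential K N V) {y : C3} (hy : y ∈ N) (i j : Fin 3) :
    pd i (pd j V) y = kron i j * pd 0 (pd 0 V) y + ∑ k, coeffTensor (K y) i j k * pd k V y := by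
  obtain ⟨h11, h22, h01, h02, h12⟩ := hV.2 y hy
  have h10 := pd_comm hN hV.1 hy 1 0
  have h20 := pd_comm hN hV.1 hy 2 0
  have h21 := pd_comm hN hV.1 hy 2 1
  fin_cases i <;> fin_cases j <;> simp [kron, coeffTensor, *]

lemma System.differentiableOn_coeffTensor (S : System) (i j k : Fin 3) :
    DifferentiableOn ℂ (fun y => coeffTensor (S.K y) i j k) S.U := by
  have := S.holomorphic
  fin_cases i <;> fin_cases j <;> simp [coeffTensor, this]

/-- The fifteen coefficients of a system are determined by the ten-tuple. -/
theorem System.coeffs_eq (S : System) {x : C3} (hx : x ∈ S.U) :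
    S.K x = coeffs (tenOf (S.K x)) := by
  -- With zero gradient and V₁₁ = 1 only the terms with Φ and its derivatives remain in the
  -- third-derivative identity. Elimination of the three derivatives of Φ gives the relations for
  -- the five missing coefficients.
  obtain ⟨⟨N, hN, hxN, hNU, V, hV, -, hg, h1⟩, -⟩ := S.nondegenerate x hx 0 0 1
  have key := fun l i j => third_derivative_symm hN hV.1
    (fun i j k => (S.differentiableOn_coeffTensor i j k).mono hNU)
    (differentiableOn_pd hN (differentiableOn_pd hN hV.1 0) 0)
    (fun y hy => hV.hessian hN hy) hxN l i j
  simp only [hg, h1, Pi.zero_apply, mul_zero, Finset.sum_const_zero, add_zero, mul_one] at key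
  have e0 := key 0 1 1; have e0' := key 0 2 2
  have e1 := key 1 0 0; have e1' := key 1 2 2
  have e2 := key 2 0 0; have e2' := key 2 1 1
  have f0 := key 0 1 2; have f1 := key 1 2 0; have f2 := key 2 0 1
  simp [kron, coeffTensor] at e0 e0' e1 e1' e2 e2' f0 f1 f2
  ext r k
  fin_cases r <;> fin_cases k <;> simp [coeffs, tensor, tenOf] <;> grind

/-- The ten-tuple of a system as a function of the point. -/
def System.ten (S : System) (x : C3) : Ten := tenOf (S.K x)

lemma System.hasDV_ten (S : System) {x : C3} (hx : x ∈ S.U) :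
    HasDV S.ten (fun v n => fderiv ℂ (fun y => S.ten y n) x v) x := by
  intro n
  refine hasDD_pd ?_
  have := fun r k => (S.holomorphic r k).differentiableAt (S.isOpen.mem_nhds hx)
  fin_cases n <;> simp [System.ten, tenOf, this]

lemma System.differentiableOn_cub (S : System) (i j k : Fin 3) :
    DifferentiableOn ℂ (fun y => cub (S.ten y) i j k) S.U := fun _ hx =>
  ((S.hasDV_ten hx).hasDD_cub i j k).1.differentiableWithinAt

/-- The function `F` in the Hessian `δᵢⱼ F + ∑ₖ Gᵢⱼₖ Vₖ` of a potential. -/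
def System.hessianTrace (S : System) (V : C3 → ℂ) (y : C3) : ℂ :=
  pd 0 (pd 0 V) y - ∑ k, cub (S.ten y) 0 0 k * pd k V y

lemma System.hessian (S : System) {N : Set C3} {V : C3 → ℂ} (hN : IsOpen N) (hNU : N ⊆ S.U)
    (hV : IsPotential S.K N V) {y : C3} (hy : y ∈ N) (i j : Fin 3) :
    pd i (pd j V) y = kron i j * S.hessianTrace V y + ∑ k, cub (S.ten y) i j k * pd k V y := by
  obtain ⟨F, hF⟩ := ((isPotential_iff (E := S.ten) hN
    fun y hy => S.coeffs_eq (hNU hy)).mp hV).2 y hy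
  have h0 : S.hessianTrace V y = F := by rw [hessianTrace, hF 0 0]; simp
  rw [hF, h0, kron]; split_ifs <;> simp

lemma System.differentiableOn_hessianTrace (S : System) {N : Set C3} {V : C3 → ℂ} (hN : IsOpen N)
    (hNU : N ⊆ S.U) (hV : IsPotential S.K N V) : DifferentiableOn ℂ (S.hessianTrace V) N :=
  (differentiableOn_pd hN (differentiableOn_pd hN hV.1 0) 0).sub <|
    DifferentiableOn.fun_sum fun k _ => ((S.differentiableOn_cub 0 0 k).mono hNU).mul
      (differentiableOn_pd hN hV.1 k)

/-- Potentials with prescribed gradient at a point. -/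
lemma System.exists_potential (S : System) {x : C3} (hx : x ∈ S.U) (g : C3) :
    ∃ N, IsOpen N ∧ x ∈ N ∧ N ⊆ S.U ∧ ∃ V, IsPotential S.K N V ∧ ∀ i, pd i V x = g i := by
  obtain ⟨⟨N, hN, hxN, hNU, V, hV, -, hg, -⟩, -⟩ := S.nondegenerate x hx 0 g 0
  exact ⟨N, hN, hxN, hNU, V, hV, hg⟩

/-- The integrability conditions of the canonical equations. -/
theorem System.integrability (S : System) {x : C3} (hx : x ∈ S.U) :
    ∃ q : Fin 3 → Fin 3 → ℂ, ∀ l i j m,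
      pd l (fun y => cub (S.ten y) i j m) x - pd i (fun y => cub (S.ten y) l j m) x
        + ∑ k, (cub (S.ten x) i j k * cub (S.ten x) l k m
          - cub (S.ten x) l j k * cub (S.ten x) i k m)
        + kron i j * q l m - kron l j * q i m = 0 := by
  -- A potential with gradient eₘ isolates the coefficient of Vₘ. The unknown derivatives of its F
  -- become q l m; F itself drops out by total symmetry of G.
  choose N hN hxN hNU V hV hg using fun m : Fin 3 => S.exists_potential hx (Pi.single m 1)
  refine ⟨fun l m => pd l (S.hessianTrace (V m)) x, fun l i j m => ?_⟩
  have key := third_derivative_symm (hN m) (hV m).1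
    (fun i j k => (S.differentiableOn_cub i j k).mono (hNU m))
    (S.differentiableOn_hessianTrace (hN m) (hNU m) (hV m))
    (fun y hy => S.hessian (hN m) (hNU m) (hV m) hy) (hxN m) l i j
  have hsym : cub (S.ten x) i j l = cub (S.ten x) l j i := by
    rw [cub_comm₂₃, cub_comm₁₂, cub_comm₂₃]
  have hsum : ∀ f : Fin 3 → ℂ, ∑ n, f n * (Pi.single m 1 : C3) n = f m := fun f => by
    simp [Pi.single_apply]
  simp only [hg, hsum] at key
  linear_combination key - S.hessianTrace (V m) x * hsym

/-! ### Integrability conditions of the Killing tensors -/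

/-- The coefficients `Bᵢⱼₖ = Gᵢⱼₖ / 3` of a system. -/
def System.bten (S : System) (y : C3) (i j k : Fin 3) : ℂ := 1 / 3 * cub (S.ten y) i j k

lemma System.bten_comm₁₂ (S : System) (y : C3) (i j k : Fin 3) : S.bten y i j k = S.bten y j i k := by
  rw [bten, cub_comm₁₂, bten]

lemma System.bten_comm₂₃ (S : System) (y : C3) (i j k : Fin 3) : S.bten y i j k = S.bten y i k j := by
  rw [bten, cub_comm₂₃, bten]

lemma System.differentiableOn_bten (S : System) (i j k : Fin 3) :
    DifferentiableOn ℂ (fun y => S.bten y i j k) S.U :=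
  (S.differentiableOn_cub i j k).const_mul _

/-- The derivatives of the Killing tensors in terms of the coefficients of the system. -/
def killingDeriv (B : Fin 3 → Fin 3 → Fin 3 → ℂ) (a : Matrix (Fin 3) (Fin 3) ℂ) (u x y : Fin 3) : ℂ :=
  2 * ∑ k, a u k * B k x y - ∑ k, B u x k * a k y - ∑ k, a x k * B u k y

/-- The Bertrand–Darboux equations, solved for the derivatives of the Killing tensor. -/
theorem System.pd_killing (S : System) {a : C3 → Matrix (Fin 3) (Fin 3) ℂ}
    (hs : ∀ x ∈ S.U, (a x).IsSymm) (ha : ∀ i j, DifferentiableOn ℂ (fun x => a x i j) S.U)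
    (hW : ∀ x₀ ∈ S.U, ∀ (N : Set C3) (V : C3 → ℂ), IsOpen N → x₀ ∈ N → N ⊆ S.U →
      IsPotential S.K N V → ∃ N' : Set C3, IsOpen N' ∧ x₀ ∈ N' ∧ N' ⊆ N ∧
        ∃ W : C3 → ℂ, IsConstantOfMotion N' V a W) {z : C3} (hz : z ∈ S.U) (l j m : Fin 3) :
    pd l (fun y => a y j m) z = killingDeriv (S.bten z) (a z) l j m := by
  have hA : ∀ i j, a z i j = a z j i := fun i j => (hs z hz).apply j i
  -- Vanishing curl of a∇V for a potential with gradient eₘ. The F-term drops out since a is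
  -- symmetric.
  have key : ∀ m, (∀ l j, pd l (fun y => a y j m) z - pd j (fun y => a y l m) z
        = ∑ k, a z l k * cub (S.ten z) k j m - ∑ k, a z j k * cub (S.ten z) k l m) ∧
      ∀ j k l, pd j (fun y => a y k l) z + pd k (fun y => a y l j) z
        + pd l (fun y => a y j k) z = 0 := by
    intro m
    obtain ⟨N, hN, hxN, hNU, V, hV, hg⟩ := S.exists_potential hz (Pi.single m 1)
    obtain ⟨N', hN', hxN', hNN', W, hc⟩ := hW z hz N V hN hxN hNU hV
    have hV' := hV.1.mono hNN'
    have hcond := fun {y} hy => hc.conditions hN' hV' (fun y hy => hs y (hNU (hNN' hy)))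
      (fun j k => (ha j k).mono (hNN'.trans hNU)) (x := y) hy
    refine ⟨fun l j => ?_, (hcond hxN').2⟩
    have hn := hN'.mem_nhds hxN'
    have hd : ∀ l j, pd l (pd j W) z
        = ∑ k, (pd l (fun y => a y j k) z * pd k V z + a z j k * pd l (pd k V) z) := by
      intro l j
      have h1 : HasDD (fun y => ∑ k, a y j k * pd k V y) _ z :=
        HasDD.sum Finset.univ fun k =>
          (hasDD_pd (((ha j k).mono (hNN'.trans hNU)).differentiableAt hn)).mul
          (hasDD_pd ((differentiableOn_pd hN' hV' k).differentiableAt hn))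
      exact (h1.congr (Filter.eventually_of_mem hn fun y hy => (hcond hy).1 j)).pd l
    have hc := pd_comm hN' hc.1 hxN' l j
    rw [hd, hd] at hc
    have hsum : ∀ f : Fin 3 → ℂ, ∑ n, f n * (Pi.single m 1 : C3) n = f m := fun f => by
      simp [Pi.single_apply]
    have hsum' : ∀ l j (F : ℂ), ∑ k, a z j k * (kron l k * F + cub (S.ten z) l k m)
        = a z j l * F + ∑ k, a z j k * cub (S.ten z) k l m := fun l j F => by
      simp only [mul_add, Finset.sum_add_distrib, cub_comm₁₂ (S.ten z) l]
      rw [← sum_kron_mul (fun k => a z j k * F) l]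
      congr 1
      exact Finset.sum_congr rfl fun k _ => by ring
    simp only [S.hessian hN hNU hV hxN, hg, hsum, Finset.sum_add_distrib, hsum'] at hc
    linear_combination hc - S.hessianTrace V z * hA j l
  have hsymm : ∀ j k l, pd j (fun y => a y k l) z = pd j (fun y => a y l k) z := fun j k l => by
    have : (fun y => a y k l) =ᶠ[𝓝 z] fun y => a y l k :=
      Filter.eventually_of_mem (S.isOpen.mem_nhds hz) fun y hy => (hs y hy).apply l k
    simp only [pd, this.fderiv_eq]
  have h1 := (key m).1 l j
  have h2 := (key j).1 l m
  have h3 := (key m).2 l j m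
  have e1 : ∑ k, S.bten z l j k * a z k m = 1 / 3 * ∑ k, a z m k * cub (S.ten z) k l j := by
    rw [Finset.mul_sum]
    exact Finset.sum_congr rfl fun k _ => by
      rw [System.bten, hA m k, cub_comm₁₂ _ k, cub_comm₂₃ _ l k]; ring
  have e2 : ∑ k, a z j k * S.bten z l k m = 1 / 3 * ∑ k, a z j k * cub (S.ten z) k l m := by
    rw [Finset.mul_sum]
    exact Finset.sum_congr rfl fun k _ => by rw [System.bten, cub_comm₁₂ _ k]; ring
  have e3 : ∑ k, a z l k * S.bten z k j m = 1 / 3 * ∑ k, a z l k * cub (S.ten z) k j m := by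
    rw [Finset.mul_sum]
    exact Finset.sum_congr rfl fun k _ => by rw [System.bten]; ring
  have e4 : ∑ k, a z l k * cub (S.ten z) k m j = ∑ k, a z l k * cub (S.ten z) k j m :=
    Finset.sum_congr rfl fun k _ => by rw [cub_comm₂₃]
  rw [killingDeriv, e1, e2, e3]
  rw [hsymm l m j, hsymm m l j, e4] at h2
  rw [hsymm j m l, hsymm m l j] at h3
  -- Two Bertrand–Darboux equations and the Killing equation add up to three times the single
  -- derivative ∂ₗaⱼₘ.
  linear_combination (h1 + h2 + h3) / 3

/-- The products `∑ₚ Bᵢⱼₚ Bₚₖₗ`. -/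
def bprod (B : Fin 3 → Fin 3 → Fin 3 → ℂ) (i j k l : Fin 3) : ℂ := ∑ p, B i j p * B p k l

section
variable {B : Fin 3 → Fin 3 → Fin 3 → ℂ} (h₁ : ∀ i j k, B i j k = B j i k)
  (h₂ : ∀ i j k, B i j k = B i k j)
include h₁ in
lemma bprod_comm₁₂ (i j k l : Fin 3) : bprod B i j k l = bprod B j i k l := by
  simp only [bprod, h₁ i j]

include h₁ h₂ in
lemma bprod_swap (i j k l : Fin 3) : bprod B i j k l = bprod B k l i j :=
  Finset.sum_congr rfl fun p _ => by rw [h₁ p k l, h₂ k p l, h₂ i j p, h₁ i p j]; ring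

/-- The second derivatives of a Killing tensor. -/
def killingDeriv₂ (B : Fin 3 → Fin 3 → Fin 3 → ℂ) (θ : Fin 3 → Fin 3 → Fin 3 → Fin 3 → ℂ)
    (a : Matrix (Fin 3) (Fin 3) ℂ) (v u x y : Fin 3) : ℂ :=
  2 * ∑ k, (killingDeriv B a v u k * B k x y + a u k * θ v k x y)
    - ∑ k, (θ v u x k * a k y + B u x k * killingDeriv B a v k y)
    - ∑ k, (killingDeriv B a v x k * B u k y + a x k * θ v u k y)

include h₁ h₂ in
/-- The symmetry of the second derivatives of a Killing tensor. -/
lemma killing_integrability {θ : Fin 3 → Fin 3 → Fin 3 → Fin 3 → ℂ}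
    {a : Matrix (Fin 3) (Fin 3) ℂ} (ha : a.IsSymm) {u v x y : Fin 3}
    (h : killingDeriv₂ B θ a v u x y = killingDeriv₂ B θ a u v x y) :
    2 * ∑ k, (omg θ (bprod B) u k x y * a k v - omg θ (bprod B) v k x y * a k u)
      - ∑ k, ((θ u v x k - θ v u x k) * a k y + a x k * (θ u v k y - θ v u k y))
      + ∑ k, ((bprod B v x u k - bprod B u x v k) * a k y
        - a x k * (bprod B v k u y - bprod B u k v y)) = 0 := by
  have hA : ∀ i j, a i j = a j i := fun i j => ha.apply j i
  have b₁ := bprod_comm₁₂ h₁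
  have b₂ := bprod_swap h₁ h₂
  have e0 : ∀ v k, killingDeriv B a v k y
      = 2 * ∑ p, a v p * B k p y - ∑ p, B k v p * a p y - ∑ p, a k p * B p v y := fun v k => by
    simp only [killingDeriv, h₁ v, h₁ _ k y]
  -- The terms with a between two factors B; they cancel upon antisymmetrization in u and v.
  set t : Fin 3 → Fin 3 → Fin 3 → Fin 3 → ℂ := fun i j k l => ∑ p, ∑ r, B i j p * a p r * B r k l
    with ht
  have t₁ : ∀ i j k l, t i j k l = t j i k l := fun i j k l => by simp only [ht, h₁ i j]
  have e1 : ∀ u v, ∑ k, killingDeriv B a v u k * B k x y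
      = 2 * ∑ p, a v p * bprod B p u x y - t v u x y - ∑ p, a u p * bprod B v p x y := fun u v => by
    simp only [killingDeriv, bprod, ht, Fin.sum_univ_three]; ring
  have e2 : ∀ u v, ∑ k, B u x k * killingDeriv B a v k y
      = 2 * ∑ p, a v p * bprod B u x p y - ∑ p, bprod B u x v p * a p y - t u x v y := fun u v => by
    simp only [e0, bprod, ht, Fin.sum_univ_three]; ring
  have e3 : ∀ u v, ∑ k, killingDeriv B a v x k * B u k y
      = 2 * ∑ p, a v p * bprod B p x u y - t v x u y - ∑ p, a x p * bprod B v p u y := fun u v => by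
    simp only [h₁ u, killingDeriv, bprod, ht, Fin.sum_univ_three]; ring
  simp only [killingDeriv₂, Finset.sum_add_distrib, e1, e2, e3] at h
  rw [t₁ v u] at h
  have h' : ∑ k, (4 * a v k * bprod B k u x y - 2 * a u k * bprod B v k x y + 2 * a u k * θ v k x y
        - θ v u x k * a k y - 2 * a v k * bprod B u x k y + bprod B u x v k * a k y
        - 2 * a v k * bprod B k x u y + a x k * bprod B v k u y - a x k * θ v u k y)
      - ∑ k, (4 * a u k * bprod B k v x y - 2 * a v k * bprod B u k x y + 2 * a v k * θ u k x y
        - θ u v x k * a k y - 2 * a u k * bprod B v x k y + bprod B v x u k * a k y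
        - 2 * a u k * bprod B k x v y + a x k * bprod B u k v y - a x k * θ u v k y) = 0 := by
    simp only [Finset.sum_add_distrib, Finset.sum_sub_distrib, mul_assoc, ← Finset.mul_sum]
    linear_combination h
  rw [← neg_eq_zero, ← h', Finset.mul_sum, ← Finset.sum_sub_distrib, ← Finset.sum_add_distrib,
    ← Finset.sum_sub_distrib, ← Finset.sum_neg_distrib]
  refine Finset.sum_congr rfl fun k _ => ?_
  rw [omg, omg, hA v k, hA u k, b₁ k u, b₁ k v]
  ring
end

/-- The derivatives of the coefficients `B`. -/
def System.btenDeriv (S : System) (z : C3) (u i j k : Fin 3) : ℂ := pd u (fun y => S.bten y i j k) z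

/-- Both sets of integrability conditions, for the potentials and for the five Killing tensors, are
inserted into `scalar_of_integrability`. At this stage τ may depend on the point. -/
theorem System.scalar_relations (S : System) {z : C3} (hz : z ∈ S.U) :
    ∃ τ : ℂ, (∀ u w x y, S.btenDeriv z u w x y = bprod (S.bten z) u w x y
        + τ / 6 * kron u w * kron x y + τ / 18 * (kron u x * kron w y + kron u y * kron w x)) ∧
      ∀ u v x y, 9 * (bprod (S.bten z) v x u y - bprod (S.bten z) u x v y)
        = -τ * (kron v x * kron u y - kron u x * kron v y) := by
  obtain ⟨a, -, hs, ha, hli, hW, -⟩ := S.superintegrable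
  obtain ⟨q, hq⟩ := S.integrability hz
  have hn := S.isOpen.mem_nhds hz
  have hB := fun i j k => (S.differentiableOn_bten i j k).differentiableAt hn
  refine scalar_of_integrability (q := q) (a := fun h => a h z) (fun u i j k => ?_) (fun u i j k => ?_)
    (bprod_comm₁₂ (S.bten_comm₁₂ z)) (bprod_swap (S.bten_comm₁₂ z) (S.bten_comm₂₃ z))
    (fun u v x y => ?_) (fun h => hs h z hz) (hli z hz) (fun h u v x y => ?_)
  · simp only [System.btenDeriv, S.bten_comm₁₂ _ i j k]
  · simp only [System.btenDeriv, S.bten_comm₂₃ _ i j k]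
  · have h := hq u v x y
    have hd : ∀ u v, S.btenDeriv z u v x y = 1 / 3 * pd u (fun w => cub (S.ten w) v x y) z :=
      fun u v => ((hasDD_pd ((S.differentiableOn_cub v x y).differentiableAt hn)).const_mul
        (1 / 3)).pd u
    have hp : ∀ u v, bprod (S.bten z) v x u y
        = 1 / 9 * ∑ k, cub (S.ten z) v x k * cub (S.ten z) u k y := fun u v => by
      rw [bprod, Finset.mul_sum]
      exact Finset.sum_congr rfl fun k _ => by
        rw [System.bten, System.bten, cub_comm₁₂ _ k u]; ring
    rw [hd, hd, hp, hp]
    rw [Finset.sum_sub_distrib] at h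
    linear_combination h
  · refine killing_integrability (S.bten_comm₁₂ z) (S.bten_comm₂₃ z) (hs h z hz) ?_
    have hpd : ∀ y ∈ S.U, ∀ l j m, pd l (fun y => a h y j m) y
        = killingDeriv (S.bten y) (a h y) l j m := fun y hy =>
      S.pd_killing (hs h) (ha h) (fun x₀ hx₀ N V hN hx hNU hV => by
        obtain ⟨N', hN', hxN', hNN', W, hc⟩ := hW x₀ hx₀ N V hN hx hNU hV
        exact ⟨N', hN', hxN', hNN', W h, hc h⟩) hy
    have hA := fun i j => (ha h i j).differentiableAt hn
    have key : ∀ v u, pd v (pd u (fun w => a h w x y)) z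
        = killingDeriv₂ (S.bten z) (S.btenDeriv z) (a h z) v u x y := by
      intro v u
      have h1 : HasDD (fun w => killingDeriv (S.bten w) (a h w) u x y) _ z :=
        (((HasDD.sum Finset.univ fun k => (hasDD_pd (hA u k)).mul (hasDD_pd (hB k x y))).const_mul
          2).sub (HasDD.sum Finset.univ fun k => (hasDD_pd (hB u x k)).mul (hasDD_pd (hA k y)))).sub
          (HasDD.sum Finset.univ fun k => (hasDD_pd (hA x k)).mul (hasDD_pd (hB u k y)))
      have h2 := (h1.congr (Filter.eventually_of_mem hn fun w hw => hpd w hw u x y)).pd v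
      simp only [killingDeriv₂, ← hpd z hz]
      exact h2
    rw [← key, ← key]
    exact pd_comm S.isOpen (ha h x y) hz v u

/-! ### The values of systems lie in the variety -/

section
variable {B : Fin 3 → Fin 3 → Fin 3 → ℂ} {θ : Fin 3 → Fin 3 → Fin 3 → Fin 3 → ℂ} {τ : ℂ}
  (h₁ : ∀ i j k, B i j k = B j i k) (h₂ : ∀ i j k, B i j k = B i k j)
  (hθ : ∀ u w x y, θ u w x y = bprod B u w x y + τ / 6 * kron u w * kron x y
    + τ / 18 * (kron u x * kron w y + kron u y * kron w x))
  (hb : ∀ u v x y, 9 * (bprod B v x u y - bprod B u x v y)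
    = -τ * (kron v x * kron u y - kron u x * kron v y))
include h₁ h₂ hθ hb

/-- The derivative of the commutator relation. -/
lemma commutator_deriv (w u v x y : Fin 3) :
    ∑ p, (θ w v x p * B p u y + B v x p * θ w p u y)
      - ∑ p, (θ w u x p * B p v y + B u x p * θ w p v y)
      = -(τ / 18) * (kron v x * B w u y + kron u y * B w v x - kron u x * B w v y
        - kron v y * B w u x) := by
  have b₁ := bprod_comm₁₂ h₁
  have b₂ := bprod_swap h₁ h₂
  have θ₁ : ∀ w u x y, θ w u x y = θ w u y x := fun w u x y => by
    rw [hθ, hθ, b₂ w u x y, b₁ x y, b₂ y x, kron_comm x y]; ring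
  have θ₂ : ∀ w u x y, θ w u x y = θ w x u y := fun w u x y => by
    rw [hθ, hθ]
    linear_combination hb x u w y / 9 + b₁ w u x y - b₁ w x u y
      + τ / 9 * kron x y * kron_comm w u - τ / 9 * kron u y * kron_comm w x
      + τ / 18 * kron w y * kron_comm u x
  have e1 : ∀ u v x y, ∑ p, θ w v x p * B p u y = ∑ r, B w v r * bprod B r x u y
      + τ / 6 * kron w v * B x u y + τ / 18 * (kron w x * B v u y + kron v x * B w u y) := by
    intro u v x y
    rw [← sum_kron_mul (fun p => B p u y) x, ← sum_kron_mul (fun p => B p u y) v,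
      ← sum_kron_mul (fun p => B p u y) w]
    have : ∑ r, B w v r * bprod B r x u y = ∑ p, bprod B w v x p * B p u y := by
      simp only [bprod, Fin.sum_univ_three]; ring
    rw [this]
    simp only [Finset.mul_sum, ← Finset.sum_add_distrib]
    exact Finset.sum_congr rfl fun p _ => by rw [hθ]; ring
  have e2 : ∀ u v x y, ∑ p, B v x p * θ w p u y = ∑ p, θ w u y p * B p v x := fun u v x y =>
    Finset.sum_congr rfl fun p _ => by
      rw [θ₂ w p u y, θ₁ w u p y, h₂ v x p, h₁ v p x]; ring
  have e3 : ∀ v x y u, ∑ r, B w v r * (bprod B r x u y - bprod B r y u x)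
      = -(τ / 9) * (kron u y * B w v x - kron u x * B w v y) := by
    intro v x y u
    rw [← sum_kron_mul (fun r => B w v r) x, ← sum_kron_mul (fun r => B w v r) y]
    simp only [Finset.mul_sum, ← Finset.sum_sub_distrib]
    refine Finset.sum_congr rfl fun r _ => ?_
    have h := hb y x r u
    have e : bprod B x r y u = bprod B r x u y := by rw [b₁, b₂, b₁, b₂]
    have e' : bprod B y r x u = bprod B r y u x := by rw [b₁, b₂, b₁, b₂]
    rw [e, e', kron_comm y u, kron_comm x u] at h
    linear_combination B w v r / 9 * h
  have f1 := e3 v x y u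
  have f2 := e3 u y x v
  simp only [mul_sub, Finset.sum_sub_distrib] at f1 f2
  simp only [Finset.sum_add_distrib, e2]
  rw [e1 u v x y, e1 v u y x, e1 v u x y, e1 u v y x]
  have g1 : B x u y = B y u x := by rw [h₁, h₂, h₁]
  have g2 : B y v x = B x v y := by rw [h₁, h₂, h₁]
  rw [g1, g2, h₁ v u]
  linear_combination f1 + f2 + τ / 18 * kron w y * h₁ u v x

/-- If the commutator relation holds with derivative `c`, then the scalar `τ` vanishes. -/
lemma scalar_eq_zero {c : Fin 3 → ℂ}
    (hc : ∀ w u v x y, ∑ p, (θ w v x p * B p u y + B v x p * θ w p u y)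
      - ∑ p, (θ w u x p * B p v y + B u x p * θ w p v y)
      = -c w * (kron v x * kron u y - kron u x * kron v y)) : τ = 0 := by
  have key : ∀ w u v x y, τ / 18 * (kron v x * B w u y + kron u y * B w v x - kron u x * B w v y
      - kron v y * B w u x) = c w * (kron v x * kron u y - kron u x * kron v y) := fun w u v x y => by
    linear_combination commutator_deriv h₁ h₂ hθ hb w u v x y - hc w u v x y
  have h12 := fun w => key w 1 0 0 2
  have h02 := fun w => key w 0 1 1 2
  have h01 := fun w => key w 0 2 2 1
  have k01 := fun w => key w 1 0 0 1
  have k02 := fun w => key w 2 0 0 2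
  have k12 := fun w => key w 2 1 1 2
  simp [kron] at h12 h02 h01 k01 k02 k12
  by_contra hτ
  simp only [hτ, false_or] at h12 h02 h01
  -- If τ ≠ 0, each matrix B w is scalar. Total symmetry of B then forces B = 0, and the commutator
  -- relation gives τ = 0 after all.
  have d : ∀ w, B w 0 0 = B w 1 1 ∧ B w 0 0 = B w 2 2 := fun w => by
    constructor
    · exact mul_left_cancel₀ hτ (by linear_combination 18 * (k02 w - k12 w))
    · exact mul_left_cancel₀ hτ (by linear_combination 18 * (k01 w - k12 w))
  have h10 : ∀ w, B w 1 0 = 0 := fun w => by rw [h₂, h01]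
  have h20 : ∀ w, B w 2 0 = 0 := fun w => by rw [h₂, h02]
  have h21 : ∀ w, B w 2 1 = 0 := fun w => by rw [h₂, h12]
  have z1 : B 0 1 1 = 0 := by rw [h₁, h01]
  have z2 : B 1 0 0 = 0 := by rw [h₁, h10]
  have z3 : B 2 0 0 = 0 := by rw [h₁, h20]
  have hB : ∀ i j k, B i j k = 0 := by
    intro i j k
    have := d 0; have := d 1; have := d 2
    fin_cases i <;> fin_cases j <;> fin_cases k <;> simp [*] <;> grind
  have := hb 0 1 0 1
  simp [bprod, hB, kron] at this
  exact hτ this.symm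
end

lemma hasDV_of_cub {E E' : C3 → Ten} {x : C3}
    (h : ∀ i j k, HasDD (fun y => cub (E y) i j k) (fun v => cub (E' v) i j k) x) : HasDV E E' x := by
  intro n
  rw [show (fun v => E' v n) = fun v => tenOfTensor (cub (E' v)) n by simp only [tenOfTensor_cub],
    show (fun y => E y n) = fun y => tenOfTensor (cub (E y)) n by simp only [tenOfTensor_cub]]
  fin_cases n
  · exact h 0 1 0
  · exact h 0 2 0
  · exact (h 1 1 0).sub (h 0 0 0)
  · exact h 1 2 0
  · exact (h 2 2 0).sub (h 0 0 0)
  · exact h 0 1 1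
  · exact (h 1 1 1).sub (h 0 0 1)
  · exact h 1 2 1
  · exact (h 2 2 1).sub (h 0 0 1)
  · exact (h 2 2 2).sub (h 0 0 2)

/-- The ten-tuples of a system lie in the variety and satisfy the translation equations. -/
theorem System.mem_variety_and_solvesTranslation (S : System) {z : C3} (hz : z ∈ S.U) :
    S.ten z ∈ variety ∧ SolvesTranslation S.ten z := by
  have hn := S.isOpen.mem_nhds hz
  obtain ⟨τ, hθ, hb⟩ := S.scalar_relations hz
  have hB := fun i j k => (S.differentiableOn_bten i j k).differentiableAt hn
  have hprod : ∀ i j k l, HasDD (fun y => bprod (S.bten y) i j k l) (fun v => ∑ p,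
      (fderiv ℂ (fun y => S.bten y i j p) z v * S.bten z p k l
        + S.bten z i j p * fderiv ℂ (fun y => S.bten y p k l) z v)) z := fun i j k l =>
    HasDD.sum Finset.univ fun p => (hasDD_pd (hB i j p)).mul (hasDD_pd (hB p k l))
  have h0 : τ = 0 := by
    refine scalar_eq_zero (S.bten_comm₁₂ z) (S.bten_comm₂₃ z) hθ hb
      -- This commutator component equals τ/9 at every point, so its differentiability spares a
      -- separate discussion of τ as a function.
      (c := fun w => pd w (fun y => bprod (S.bten y) 1 0 0 1 - bprod (S.bten y) 0 0 1 1) z)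
      fun w u v x y => ?_
    have h1 := ((hprod v x u y).sub (hprod u x v y)).pd w
    have h2 := ((((hprod 1 0 0 1).sub (hprod 0 0 1 1)).const_mul
      (-(kron v x * kron u y - kron u x * kron v y))).congr
      (g := fun y' => bprod (S.bten y') v x u y - bprod (S.bten y') u x v y)
      (Filter.eventually_of_mem hn fun y' hy' => by
        obtain ⟨τ', -, hb'⟩ := S.scalar_relations hy'
        have e1 := hb' u v x y
        have e2 := hb' 0 1 0 1
        simp [kron] at e2
        linear_combination e1 / 9 + (kron v x * kron u y - kron u x * kron v y) * e2 / 9)).pd w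
    have h3 := ((hprod 1 0 0 1).sub (hprod 0 0 1 1)).pd w
    rw [h3]
    refine h1.symm.trans (h2.trans ?_)
    ring
  subst h0
  have hmem : S.ten z ∈ variety := by
    rw [mem_variety_iff]
    intro i l
    ext j k
    have h := hb l i j k
    simp only [neg_zero, zero_mul, bprod, System.bten] at h
    simp only [Matrix.mul_apply, gam_apply]
    have e : ∀ i l, ∑ p, cub (S.ten z) i j p * cub (S.ten z) l p k
        = 9 * ∑ p, 1 / 3 * cub (S.ten z) i j p * (1 / 3 * cub (S.ten z) p l k) := fun i l => by
      rw [Finset.mul_sum]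
      exact Finset.sum_congr rfl fun p _ => by rw [cub_comm₁₂ _ p l]; ring
    rw [e, e]
    linear_combination h
  refine ⟨hmem, ?_⟩
  have hcub : ∀ i j k, HasDD (fun y => cub (S.ten y) i j k)
      (fun v => cub (transField v (S.ten z)) i j k) z := by
    intro i j k
    refine (hasDD_of_differentiableAt
      ((S.differentiableOn_cub i j k).differentiableAt hn)).congr_deriv fun v => ?_
    have hpd : ∀ l, pd l (fun y => cub (S.ten y) i j k) z
        = 1 / 3 * ∑ p, cub (S.ten z) l j p * cub (S.ten z) i p k := fun l => by
      have h1 : S.btenDeriv z l i j k = 1 / 3 * pd l (fun y => cub (S.ten y) i j k) z :=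
        ((hasDD_pd ((S.differentiableOn_cub i j k).differentiableAt hn)).const_mul (1 / 3)).pd l
      have h2 := hθ l i j k
      have h3 := hb j i l k
      have h4 := bprod_comm₁₂ (S.bten_comm₁₂ z) l i j k
      have h5 := bprod_comm₁₂ (S.bten_comm₁₂ z) l j i k
      have h6 : bprod (S.bten z) l j i k = 1 / 9 * ∑ p, cub (S.ten z) l j p * cub (S.ten z) i p k := by
        rw [bprod, Finset.mul_sum]
        exact Finset.sum_congr rfl fun p _ => by
          rw [System.bten, System.bten, cub_comm₁₂ _ p i]; ring
      linear_combination -3 * h1 + 3 * h2 + 3 * h4 + h3 / 3 - 3 * h5 + 3 * h6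
    rw [← gam_apply, gam_transField_of_mem hmem]
    simp only [hpd, Matrix.smul_apply, Matrix.mul_apply, gamv_apply, gam_apply, smul_eq_mul,
      Fin.sum_univ_three]
    ring
  exact hasDV_of_cub hcub

theorem System.ten_mem_variety (S : System) {z : C3} (hz : z ∈ S.U) : S.ten z ∈ variety :=
  (S.mem_variety_and_solvesTranslation hz).1

theorem System.solvesTranslation (S : System) {z : C3} (hz : z ∈ S.U) :
    SolvesTranslation S.ten z := (S.mem_variety_and_solvesTranslation hz).2

/-- A system is locally determined by its ten-tuple at one point. -/
theorem System.eventuallyEq_of_ten_eq (S S' : System) {x : C3} (hx : x ∈ S.U) (hx' : x ∈ S'.U)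
    (h : S.ten x = S'.ten x) : S.K =ᶠ[𝓝 x] S'.K := by
  obtain ⟨r, hr, hsub⟩ := Metric.isOpen_iff.mp (S.isOpen.inter S'.isOpen) x ⟨hx, hx'⟩
  have := eqOn_ball_of_solvesTranslation (fun y hy => S.solvesTranslation (hsub hy).1)
    (fun y hy => S'.solvesTranslation (hsub hy).2) h
  refine Filter.eventually_of_mem (Metric.ball_mem_nhds x hr) fun y hy => ?_
  rw [S.coeffs_eq (hsub hy).1, S'.coeffs_eq (hsub hy).2]
  exact congrArg coeffs (this hy)

/-! ### Euclidean motions -/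

section
variable {R : Matrix (Fin 3) (Fin 3) ℂ} (hR : IsRotation R) (b : C3)
include hR

lemma motion_inv_motion (y : C3) : R.transpose.mulVec (R.mulVec y + b - b) = y := by
  rw [add_sub_cancel_right, Matrix.mulVec_mulVec, hR.transpose_mul, Matrix.one_mulVec]

lemma motion_motion_inv (z : C3) : R.mulVec (R.transpose.mulVec (z - b)) + b = z := by
  rw [Matrix.mulVec_mulVec, hR.1, Matrix.one_mulVec, sub_add_cancel]

lemma image_motion (N : Set C3) : (fun y => R.mulVec y + b) '' N
    = (fun z => R.transpose.mulVec (z - b)) ⁻¹' N :=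
  congrFun (Set.image_eq_preimage_of_inverse (f := fun y => R.mulVec y + b)
    (g := fun z => R.transpose.mulVec (z - b)) (motion_inv_motion hR b) (motion_motion_inv hR b)) N

lemma isOpen_image_motion {N : Set C3} (hN : IsOpen N) :
    IsOpen ((fun y => R.mulVec y + b) '' N) := by
  rw [image_motion hR]
  exact hN.preimage (by fun_prop)

lemma hasDD_comp_motion {f : C3 → ℂ} {y : C3} (hf : DifferentiableAt ℂ f y) :
    HasDD (fun z => f (R.transpose.mulVec (z - b))) (fun v => fderiv ℂ f y (R.transpose.mulVec v))
      (R.mulVec y + b) := by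
  have h1 : HasFDerivAt (fun z : C3 => R.transpose.mulVec (z - b))
      (LinearMap.toContinuousLinearMap (Matrix.mulVecLin R.transpose)) (R.mulVec y + b) := by
    have := ((LinearMap.toContinuousLinearMap (Matrix.mulVecLin R.transpose)).hasFDerivAt
      (x := R.mulVec y + b - b)).comp (R.mulVec y + b) ((hasFDerivAt_id (𝕜 := ℂ) _).sub_const b)
    exact this
  have h2 : HasFDerivAt f (fderiv ℂ f y) (R.transpose.mulVec (R.mulVec y + b - b)) := by
    rw [motion_inv_motion hR]; exact hf.hasFDerivAt
  exact .of_hasFDerivAt (HasFDerivAt.comp (g := f) (f := fun z => R.transpose.mulVec (z - b))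
    (R.mulVec y + b) h2 h1) fun v => rfl

lemma pd_comp_motion {f : C3 → ℂ} {y : C3} (hf : DifferentiableAt ℂ f y) (i : Fin 3) :
    pd i (fun z => f (R.transpose.mulVec (z - b))) (R.mulVec y + b) = ∑ a, R i a * pd a f y := by
  rw [(hasDD_comp_motion hR b hf).pd, fderiv_eq_sum_pd]
  simp

section
variable {N : Set C3} (hN : IsOpen N) {V : C3 → ℂ} (hV : DifferentiableOn ℂ V N)
include hN hV

lemma differentiableOn_comp_motion : DifferentiableOn ℂ (fun z => V (R.transpose.mulVec (z - b)))
    ((fun y => R.mulVec y + b) '' N) := by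
  rintro _ ⟨y, hy, rfl⟩
  exact (hasDD_comp_motion hR b (hV.differentiableAt (hN.mem_nhds hy))).1.differentiableWithinAt

lemma pd_pd_comp_motion {y : C3} (hy : y ∈ N) (i j : Fin 3) :
    pd i (pd j (fun z => V (R.transpose.mulVec (z - b)))) (R.mulVec y + b)
      = ∑ a, ∑ c, R i a * R j c * pd a (pd c V) y := by
  have hmem : (fun y => R.mulVec y + b) '' N ∈ 𝓝 (R.mulVec y + b) :=
    (isOpen_image_motion hR b hN).mem_nhds ⟨y, hy, rfl⟩
  have hd := fun c => (differentiableOn_pd hN hV c).differentiableAt (hN.mem_nhds hy)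
  have h1 : HasDD (fun z => ∑ c, R j c * pd c V (R.transpose.mulVec (z - b))) _ (R.mulVec y + b) :=
    HasDD.sum Finset.univ fun c => (hasDD_comp_motion hR b (hd c)).const_mul (R j c)
  have h2 := (h1.congr (g := pd j (fun z => V (R.transpose.mulVec (z - b))))
    (Filter.eventually_of_mem hmem ?_)).pd i
  · rw [h2, Finset.sum_comm]
    refine Finset.sum_congr rfl fun c _ => ?_
    rw [fderiv_eq_sum_pd, Finset.mul_sum]
    exact Finset.sum_congr rfl fun a _ => by simp; ring
  · rintro _ ⟨w, hw, rfl⟩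
    simp only [pd_comp_motion hR b (hV.differentiableAt (hN.mem_nhds hw)), motion_inv_motion hR]

lemma HasHessian.motion {D : Ten} {F : ℂ} {y : C3} (hy : y ∈ N) (h : HasHessian D F V y) :
    HasHessian (rot R D) F (fun z => V (R.transpose.mulVec (z - b))) (R.mulVec y + b) := by
  intro i j
  rw [pd_pd_comp_motion hR b hN hV hy, cub_rot hR]
  simp only [pd_comp_motion hR b (hV.differentiableAt (hN.mem_nhds hy)), h _ _, act]
  have horth : ∀ i j, ∑ a, R i a * R j a = if i = j then 1 else 0 := fun i j => by
    have := congrFun (congrFun hR.1 i) j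
    rwa [Matrix.mul_apply, Matrix.one_apply] at this
  have horth' : ∀ i j, ∑ k, R k i * R k j = if i = j then 1 else 0 := fun i j => by
    have := congrFun (congrFun hR.transpose_mul i) j
    rwa [Matrix.mul_apply, Matrix.one_apply] at this
  have e1 : ∑ a, ∑ c, R i a * R j c * (if a = c then F else 0) = if i = j then F else 0 := by
    have := horth i j
    simp only [mul_ite, mul_zero, Finset.sum_ite_eq, Finset.mem_univ, if_true, ← Finset.sum_mul,
      this]
    simp
  have e2 : ∑ k, (∑ a, ∑ c, ∑ d, R i a * R j c * R k d * cub D a c d) * ∑ p, R k p * pd p V y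
      = ∑ a, ∑ c, R i a * R j c * ∑ d, cub D a c d * pd d V y := by
    obtain ⟨g, hg⟩ : ∃ g : Fin 3 → ℂ, ∀ k, ∑ p, R k p * pd p V y = g k := ⟨_, fun _ => rfl⟩
    have e3 : ∀ d, pd d V y = ∑ k, R k d * g k := fun d => by
      simp only [← hg, Finset.mul_sum, ← mul_assoc]
      rw [Finset.sum_comm]
      simp only [← Finset.sum_mul, horth']
      simp
    simp only [hg]
    simp only [e3, Fin.sum_univ_three]
    ring
  rw [e2, ← e1, ← Finset.sum_add_distrib]
  exact Finset.sum_congr rfl fun a _ => by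
    rw [← Finset.sum_add_distrib]
    exact Finset.sum_congr rfl fun c _ => by ring

end

lemma isPotential_motion_of {N : Set C3} (hN : IsOpen N) {V : C3 → ℂ} {K K' : C3 → Coeffs}
    {E : C3 → Ten} (hK : ∀ y ∈ N, K y = coeffs (E y))
    (hK' : ∀ y ∈ N, K' (R.mulVec y + b) = coeffs (rot R (E y))) (h : IsPotential K N V) :
    IsPotential K' ((fun y => R.mulVec y + b) '' N) (fun z => V (R.transpose.mulVec (z - b))) := by
  rw [isPotential_iff hN hK] at h
  refine (isPotential_iff (E := fun z => rot R (E (R.transpose.mulVec (z - b))))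
    (isOpen_image_motion hR b hN) ?_).mpr ⟨differentiableOn_comp_motion hR b hN h.1, ?_⟩
  · rintro _ ⟨y, hy, rfl⟩
    simp only [motion_inv_motion hR, hK' y hy]
  · rintro _ ⟨y, hy, rfl⟩
    obtain ⟨F, hF⟩ := h.2 y hy
    simp only [motion_inv_motion hR]
    exact ⟨F, hF.motion hR b hN h.1 hy⟩

/-- The converse is the direct statement for the inverse motion z ↦ Rᵀz - Rᵀb. -/
theorem isPotential_motion_iff {N : Set C3} (hN : IsOpen N) {V : C3 → ℂ} {K K' : C3 → Coeffs}
    {E : C3 → Ten} (hK : ∀ y ∈ N, K y = coeffs (E y))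
    (hK' : ∀ y ∈ N, K' (R.mulVec y + b) = coeffs (rot R (E y))) :
    IsPotential K N V ↔
      IsPotential K' ((fun y => R.mulVec y + b) '' N) (fun z => V (R.transpose.mulVec (z - b))) := by
  refine ⟨isPotential_motion_of hR b hN hK hK', fun h => ?_⟩
  have hinv : ∀ z : C3, R.transpose.mulVec z + -R.transpose.mulVec b = R.transpose.mulVec (z - b) :=
    fun z => by rw [Matrix.mulVec_sub, sub_eq_add_neg]
  have hinv' : ∀ y : C3, R.transpose.transpose.mulVec (y - -R.transpose.mulVec b)
      = R.mulVec y + b := fun y => by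
    rw [Matrix.transpose_transpose, sub_neg_eq_add, Matrix.mulVec_add, Matrix.mulVec_mulVec, hR.1,
      Matrix.one_mulVec]
  have h' := isPotential_motion_of hR.transpose (-R.transpose.mulVec b)
    (isOpen_image_motion hR b hN) (K' := K) (E := fun z => rot R (E (R.transpose.mulVec (z - b))))
    ?_ ?_ h
  · simp only [hinv', hinv, motion_inv_motion hR, Set.image_image, Set.image_id'] at h'
    exact h'
  · rintro _ ⟨y, hy, rfl⟩
    simp only [motion_inv_motion hR, hK' y hy]
  · rintro _ ⟨y, hy, rfl⟩
    simp only [hinv, motion_inv_motion hR]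
    rw [← rot_mul hR.transpose hR, hR.transpose_mul, rot_one, hK y hy]
end

/-- Comparison of two Hessians of one potential determines G only up to the unknown functions F;
this ambiguity does not affect the ten-tuple. -/
lemma eq_of_cub_eq_add_diag {D E : Ten} {f : Fin 3 → ℂ}
    (h : ∀ i j k, cub D i j k = cub E i j k + if i = j then f k else 0) : D = E := by
  rw [← tenOfTensor_cub D, ← tenOfTensor_cub E, ← tenOfTensor_add_diag (cub E) f]
  congr 1
  ext i j k
  exact h i j k

/-- A Euclidean motion of systems rotates the ten-tuples. -/
theorem System.IsMotionOf.ten_eq {S S' : System} {R : Matrix (Fin 3) (Fin 3) ℂ} {b : C3}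
    (hR : IsRotation R) (hU : S'.U = (fun x => R.mulVec x + b) '' S.U)
    (h : ∀ (N : Set C3) (V : C3 → ℂ), IsOpen N → N ⊆ S.U → (IsPotential S.K N V ↔
      IsPotential S'.K ((fun x => R.mulVec x + b) '' N) (fun y => V (R.transpose.mulVec (y - b)))))
    {x : C3} (hx : x ∈ S.U) : S'.ten (R.mulVec x + b) = rot R (S.ten x) := by
  have key : ∀ k, ∃ f : ℂ, ∀ i j, cub (S'.ten (R.mulVec x + b)) i j k
      = cub (rot R (S.ten x)) i j k + if i = j then f else 0 := by
    intro k
    -- The gradient Rᵀeₖ is chosen so that the moved potential has gradient eₖ.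
    obtain ⟨N, hN, hxN, hNU, V, hV, hg⟩ := S.exists_potential hx
      (R.transpose.mulVec (Pi.single k 1))
    have hV' := (h N V hN hNU).mp hV
    have hsub : (fun x => R.mulVec x + b) '' N ⊆ S'.U := by rw [hU]; exact Set.image_mono hNU
    obtain ⟨F, hF⟩ := ((isPotential_iff (E := S.ten) hN
      fun y hy => S.coeffs_eq (hNU hy)).mp hV).2 x hxN
    obtain ⟨F', hF'⟩ := ((isPotential_iff (E := S'.ten) (isOpen_image_motion hR b hN)
      fun y hy => S'.coeffs_eq (hsub hy)).mp hV').2 _ ⟨x, hxN, rfl⟩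
    have hF₂ := hF.motion hR b hN hV.1 hxN
    have hgrad : ∀ i, pd i (fun z => V (R.transpose.mulVec (z - b))) (R.mulVec x + b)
        = (Pi.single k 1 : C3) i := fun i => by
      rw [pd_comp_motion hR b (hV.1.differentiableAt (hN.mem_nhds hxN))]
      simp only [hg]
      have := congrFun (Matrix.mulVec_mulVec (Pi.single k 1) R R.transpose) i
      rw [hR.1, Matrix.one_mulVec] at this
      exact this
    refine ⟨F - F', fun i j => ?_⟩
    have h1 := hF' i j
    have h2 := hF₂ i j
    simp only [hgrad, Pi.single_apply, mul_ite, mul_one, mul_zero, Finset.sum_ite_eq',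
      Finset.mem_univ, if_true] at h1 h2
    split_ifs at * <;> linear_combination h2 - h1
  choose f hf using key
  exact eq_of_cub_eq_add_diag (f := f) fun i j k => hf k i j

/-! ### Systems with values on the same leaf -/

lemma System.Same.symm {S S' : System} (h : S.Same S') : S'.Same S := Relation.EqvGen.symm _ _ h

lemma System.Same.trans {S S' S'' : System} (h : S.Same S') (h' : S'.Same S'') : S.Same S'' :=
  Relation.EqvGen.trans _ _ _ h h'

lemma System.same_of_ten_eq {S S' : System} {x : C3} (hx : x ∈ S.U) (hx' : x ∈ S'.U)
    (h : S.ten x = S'.ten x) : S.Same S' := by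
  obtain ⟨N, hN, hNo, hxN⟩ := eventually_nhds_iff.mp ((S.eventuallyEq_of_ten_eq S' hx hx' h).and
    ((S.isOpen.inter S'.isOpen).mem_nhds ⟨hx, hx'⟩))
  exact .rel _ _ <| .inl ⟨N, hNo, ⟨x, hxN⟩, fun y hy => (hN y hy).2.1, fun y hy => (hN y hy).2.2,
    fun y hy => (hN y hy).1⟩

/-- Two systems whose ten-tuples at two points differ by a rotation are the same. -/
theorem System.same_of_rot {S S' : System} {x x' : C3} (hx : x ∈ S.U) (hx' : x' ∈ S'.U)
    {R : Matrix (Fin 3) (Fin 3) ℂ} (hR : IsRotation R) (h : S'.ten x' = rot R (S.ten x)) :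
    S.Same S' := by
  have hD := S.ten_mem_variety hx
  have hD' := rot_mem_variety hR hD
  obtain ⟨b, hb⟩ : ∃ b, R.mulVec x + b = x' := ⟨x' - R.mulVec x, by abel⟩
  obtain ⟨r, hr, hreg⟩ := exists_ball_regular hD x
  obtain ⟨r', hr', hreg'⟩ := exists_ball_regular hD' x'
  have hc : Continuous fun y : C3 => R.mulVec y + b := by fun_prop
  obtain ⟨ε, hε, hsub⟩ := Metric.mem_nhds_iff.mp (Filter.inter_mem (Metric.ball_mem_nhds x hr)
    (hc.continuousAt.preimage_mem_nhds (x := x) (by rw [hb]; exact Metric.ball_mem_nhds x' hr')))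
  have hconn : IsConnected (Metric.ball x ε) :=
    (convex_ball x ε).isConnected (Metric.nonempty_ball.mpr hε)
  -- The given systems need not have domains related by the motion. They are continued to two
  -- explicit systems T and T' whose domains correspond, and the motion is applied between these.
  let T := flowSystem hD x (Metric.ball x ε) Metric.isOpen_ball hconn
    fun y hy => hreg y (hsub hy).1
  let T' := flowSystem hD' x' ((fun y => R.mulVec y + b) '' Metric.ball x ε)
    (isOpen_image_motion hR b Metric.isOpen_ball) (hconn.image _ hc.continuousOn) (by
      rintro _ ⟨y, hy, rfl⟩
      exact hreg' _ (hsub hy).2)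
  have hxε := Metric.mem_ball_self (x := x) hε
  have hT : T.ten x = S.ten x := by
    change tenOf (coeffs (flow (S.ten x) (x - x))) = _
    rw [tenOf_coeffs, sub_self, flow_zero]
  have hT' : T'.ten x' = S'.ten x' := by
    change tenOf (coeffs (flow (rot R (S.ten x)) (x' - x'))) = _
    rw [tenOf_coeffs, sub_self, flow_zero, h]
  have h1 : S.Same T := System.same_of_ten_eq hx hxε hT.symm
  have h2 : T'.Same S' := System.same_of_ten_eq ⟨x, hxε, hb⟩ hx' hT'
  refine h1.trans (.trans (.rel _ _ (.inr ⟨R, b, hR, rfl, fun N V hN hNU => ?_⟩)) h2)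
  refine isPotential_motion_iff hR b hN (E := fun y => flow (S.ten x) (y - x)) (fun y _ => rfl)
    fun y hy => ?_
  have hy' : R.mulVec y + b - x' = R.mulVec (y - x) := by
    rw [← hb, Matrix.mulVec_sub]; abel
  change coeffs (flow (rot R (S.ten x)) (R.mulVec y + b - x')) = _
  rw [hy', flow_rot hR _ hD (hreg y (hsub (hNU hy)).1).1]

/-- The value may be taken at different points; the motion with R = 1 is then a translation between
them. -/
lemma System.same_of_takes {S S' : System} {D : Ten} (h : S.Takes D) (h' : S'.Takes D) :
    S.Same S' := by
  obtain ⟨x, hx, rfl⟩ := h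
  obtain ⟨x', hx', he⟩ := h'
  exact System.same_of_rot hx hx' IsRotation.one (by rw [rot_one]; exact he)

/-- All systems through two given ten-tuples are the same. -/
def Linked (D D' : Ten) : Prop := ∀ S S' : System, S.Takes D → S'.Takes D' → S.Same S'

lemma Linked.symm {D D' : Ten} (h : Linked D D') : Linked D' D := fun S S' hS hS' =>
  (h S' S hS' hS).symm

lemma Linked.trans {D D' D'' : Ten} (hD' : D' ∈ variety) (h : Linked D D') (h' : Linked D' D'') :
    Linked D D'' := fun S S' hS hS' => by
  obtain ⟨T, hT, hT'⟩ := exists_system hD' 0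
  exact (h S T hS ⟨0, hT, hT'⟩).trans (h' T S' ⟨0, hT, hT'⟩ hS')

lemma linked_of_takes {T : System} {D D' : Ten} (h : T.Takes D) (h' : T.Takes D') : Linked D D' :=
  fun _ _ hS hS' => (System.same_of_takes hS h).trans (System.same_of_takes h' hS')

/-- Nearby points of the flow through `D` are linked with `D`. -/
lemma linked_flow {D : Ten} (hD : D ∈ variety) : ∀ᶠ x in 𝓝 (0 : C3), x ∈ flowDomain D ∧
    Linked D (flow D x) := by
  obtain ⟨r, hr, hreg⟩ := exists_ball_regular hD 0
  refine Filter.eventually_of_mem (Metric.ball_mem_nhds 0 hr) fun x hx => ?_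
  have hreg' := (hreg x hx).1
  rw [sub_zero] at hreg'
  refine ⟨hreg', ?_⟩
  let T := flowSystem hD 0 (Metric.ball 0 r) Metric.isOpen_ball
    ((convex_ball 0 r).isConnected (Metric.nonempty_ball.mpr hr)) hreg
  have hT : ∀ y, T.ten y = flow D y := fun y => by
    change tenOf (coeffs (flow D (y - 0))) = _
    rw [tenOf_coeffs, sub_zero]
  exact linked_of_takes (T := T) ⟨0, Metric.mem_ball_self hr, (hT 0).trans (flow_zero D)⟩
    ⟨x, hx, hT x⟩

lemma transField_neg {D : Ten} (hD : D ∈ variety) (v : C3) : transField (-v) D = -transField v D := by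
  apply gam_injective
  intro i
  rw [gam_neg, gam_transField_of_mem hD, gam_transField_of_mem hD, ← neg_one_smul ℂ v, gamv_smul]
  simp

/-- Points on an integral curve are locally given by the flow, forwards and backwards. -/
lemma eq_flow_of_transCurve_two_sided {v : C3} {γ : ℝ → Ten} (hγ : IsTranslationCurve v γ)
    (hmem : ∀ t ∈ Set.Icc (0 : ℝ) 1, γ t ∈ variety) {s t : ℝ} (hs : s ∈ Set.Icc (0 : ℝ) 1)
    (ht : t ∈ Set.Icc (0 : ℝ) 1) {ε : ℝ} (hε : |t - s| < ε)
    (hd : ∀ t : ℝ, |t - s| < ε → ((t - s : ℝ) : ℂ) • v ∈ flowDomain (γ s)) :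
    γ t = flow (γ s) (((t - s : ℝ) : ℂ) • v) := by
  rcases le_total s t with hst | hst
  · have hsub : Set.Icc s t ⊆ Set.Icc 0 1 := Set.Icc_subset_Icc hs.1 ht.2
    refine eq_flow_of_transCurve (fun r hr => (hγ r (hsub hr)).mono hsub) (hmem s hs)
      (fun r hr => hd r ?_) t ⟨hst, le_rfl⟩
    rw [abs_of_nonneg (by linarith [hr.1])]
    rw [abs_of_nonneg (by linarith)] at hε
    linarith [hr.2]
  -- For t < s the curve is run backwards, as an integral curve of the translation -v.
  · have hsub : ∀ r ∈ Set.Icc (-s) (-t), -r ∈ Set.Icc (0 : ℝ) 1 := fun r hr =>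
      ⟨by linarith [hr.2, ht.1], by linarith [hr.1, hs.2]⟩
    have h := eq_flow_of_transCurve (v := -v) (γ := fun r => γ (-r)) (a := -s) (b := -t)
      (fun r hr => ?_) (by rw [neg_neg]; exact hmem s hs) (fun r hr => ?_) (-t)
      ⟨by linarith, le_rfl⟩
    · simp only [neg_neg] at h
      rw [h]
      congr 1
      push_cast
      module
    · have h1 := (hγ (-r) (hsub r hr)).scomp r (hasDerivAt_neg r).hasDerivWithinAt
        (s := Set.Icc (-s) (-t)) hsub
      rw [transField_neg (hmem _ (hsub r hr))]
      rw [neg_one_smul] at h1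
      exact h1
    · have h1 := hd (-r) (by
        rw [abs_of_nonpos (by linarith [hr.1])]
        rw [abs_of_nonpos (by linarith)] at hε
        linarith [hr.2])
      rw [neg_neg]
      convert h1 using 1
      push_cast
      module

/-- The curve may be too long for one explicit system. Nearby times are linked in both directions
through the local flow, and connectedness of [0, 1] together with transitivity links the ends. -/
theorem linked_of_transCurve {v : C3} {γ : ℝ → Ten} (hγ : IsTranslationCurve v γ)
    (hmem : ∀ t ∈ Set.Icc (0 : ℝ) 1, γ t ∈ variety) : Linked (γ 0) (γ 1) := by
  refine isPreconnected_Icc.induction₂' (fun s t => Linked (γ s) (γ t)) (fun s hs => ?_)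
    (fun r s t _ hs _ h h' => h.trans (hmem s hs) h') (Set.left_mem_Icc.mpr zero_le_one)
    (Set.right_mem_Icc.mpr zero_le_one)
  have hc : Continuous fun t : ℝ => ((t - s : ℝ) : ℂ) • v := by fun_prop
  have h0 : Filter.Tendsto (fun t : ℝ => ((t - s : ℝ) : ℂ) • v) (𝓝 s) (𝓝 0) := by
    have := hc.tendsto s
    simpa using this
  obtain ⟨ε, hε, hd⟩ := Metric.eventually_nhds_iff.mp (h0.eventually (linked_flow (hmem s hs)))
  refine eventually_nhdsWithin_iff.mpr (Metric.eventually_nhds_iff.mpr ⟨ε, hε, fun t ht htI => ?_⟩)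
  have he := eq_flow_of_transCurve_two_sided hγ hmem hs htI ht fun r hr => (hd hr).1
  have := (hd ht).2
  rw [← he] at this
  exact ⟨this, this.symm⟩

theorem sameSystem_of_sameLeaf {D D' : Ten} (hD : D ∈ variety) (h : SameLeaf D D') :
    SameSystem D D' := by
  -- A chain of steps and inverse steps passes through points not assumed to lie in the variety, so
  -- membership has to be carried along the induction.
  have key : (D ∈ variety ↔ D' ∈ variety) ∧ (D ∈ variety → Linked D D') := by
    clear hD
    induction h with
    | rel D D' h =>
      rcases h with ⟨hD, R, hR, rfl⟩ | ⟨v, γ, hγ, hmem, rfl, rfl⟩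
      · refine ⟨iff_of_true hD (rot_mem_variety hR hD), fun _ S S' hS hS' => ?_⟩
        obtain ⟨x, hx, rfl⟩ := hS
        obtain ⟨x', hx', he⟩ := hS'
        exact System.same_of_rot hx hx' hR he
      · exact ⟨iff_of_true (hmem 0 (Set.left_mem_Icc.mpr zero_le_one))
          (hmem 1 (Set.right_mem_Icc.mpr zero_le_one)), fun _ => linked_of_transCurve hγ hmem⟩
    | refl D => exact ⟨Iff.rfl, fun _ S S' hS hS' => System.same_of_takes hS hS'⟩
    | symm D D' _ ih => exact ⟨ih.1.symm, fun h => (ih.2 (ih.1.mpr h)).symm⟩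
    | trans D D' D'' _ _ ih ih' =>
      exact ⟨ih.1.trans ih'.1, fun h => (ih.2 h).trans (ih.1.mp h) (ih'.2 (ih.1.mp h))⟩
  obtain ⟨S, hS, hS'⟩ := exists_system hD 0
  obtain ⟨T, hT, hT'⟩ := exists_system (key.1.mp hD) 0
  exact ⟨S, T, ⟨0, hS, hS'⟩, ⟨0, hT, hT'⟩, key.2 hD S T ⟨0, hS, hS'⟩ ⟨0, hT, hT'⟩⟩

/-! ### The values of a system lie on one leaf -/

lemma SameLeaf.trans {D D' D'' : Ten} (h : SameLeaf D D') (h' : SameLeaf D' D'') :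
    SameLeaf D D'' := Relation.EqvGen.trans _ _ _ h h'

lemma SameLeaf.symm {D D' : Ten} (h : SameLeaf D D') : SameLeaf D' D :=
  Relation.EqvGen.symm _ _ h

/-- Along a segment in the domain the values of a system form an integral curve of a translation;
connectedness of the domain joins distant points by such curves. -/
theorem System.sameLeaf (S : System) {x y : C3} (hx : x ∈ S.U) (hy : y ∈ S.U) :
    SameLeaf (S.ten x) (S.ten y) := by
  refine S.isConnected.isPreconnected.induction₂' (fun x y => SameLeaf (S.ten x) (S.ten y))
    (fun x hx => ?_) (fun _ _ _ _ _ _ h h' => h.trans h') hx hy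
  obtain ⟨r, hr, hsub⟩ := Metric.isOpen_iff.mp S.isOpen x hx
  refine eventually_nhdsWithin_of_eventually_nhds
    (Filter.eventually_of_mem (Metric.ball_mem_nhds x hr) fun y hy => ?_)
  have hseg : ∀ t ∈ Set.Icc (0 : ℝ) 1, x + (t : ℂ) • (y - x) ∈ S.U := fun t ht => hsub <| by
    rw [mem_ball_iff_norm] at hy ⊢
    rw [add_sub_cancel_left, norm_smul, Complex.norm_real, Real.norm_of_nonneg ht.1]
    exact lt_of_le_of_lt (mul_le_of_le_one_left (norm_nonneg _) ht.2) hy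
  have h : SameLeaf (S.ten x) (S.ten y) := .rel _ _ <| .inr
    ⟨y - x, fun t => S.ten (x + (t : ℂ) • (y - x)),
      fun t ht => (S.solvesTranslation (hseg t ht)).hasDerivAt_line.hasDerivWithinAt,
      fun t ht => S.ten_mem_variety (hseg t ht), by simp, by simp⟩
  exact ⟨h, h.symm⟩

theorem sameLeaf_of_sameSystem {D D' : Ten} (h : SameSystem D D') : SameLeaf D D' := by
  obtain ⟨S, S', ⟨x, hx, rfl⟩, ⟨x', hx', rfl⟩, hSS'⟩ := h
  have key : ∀ x ∈ S.U, ∀ x' ∈ S'.U, SameLeaf (S.ten x) (S'.ten x') := by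
    clear hx hx' x x'
    induction hSS' with
    | rel S S' h =>
      intro x hx x' hx'
      rcases h with ⟨N, -, ⟨y, hy⟩, hN, hN', he⟩ | ⟨R, b, hR, hU, he⟩
      · have h1 : S.ten y = S'.ten y := congrArg tenOf (he y hy)
        have h2 := S.sameLeaf hx (hN hy)
        rw [h1] at h2
        exact h2.trans (S'.sameLeaf (hN' hy) hx')
      · rw [hU] at hx'
        obtain ⟨y, hy, rfl⟩ := hx'
        refine (S.sameLeaf hx hy).trans (.rel _ _ (.inl ⟨S.ten_mem_variety hy, R, hR, ?_⟩))
        exact System.IsMotionOf.ten_eq hR hU he hy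
    | refl S => exact fun x hx x' hx' => S.sameLeaf hx hx'
    | symm S S' _ ih => exact fun x hx x' hx' => (ih x' hx' x hx).symm
    | trans S S' S'' _ _ ih ih' =>
      intro x hx x' hx'
      -- Any point of the intermediate domain serves to connect the two halves of the chain.
      obtain ⟨y, hy⟩ := S'.isConnected.nonempty
      exact (ih x hx y hy).trans (ih' y hy x' hx')
  exact key x hx x' hx'

end Superintegrable

end

/-! ### The main theorem. -/

open Superintegrable in
theorem mainTheorem4 :
    -- rotations act linearly on ten-tuples, preserving the variety
    ((∀ D, rot 1 D = D) ∧
      (∀ R S, IsRotation R → IsRotation S → ∀ D, rot (R * S) D = rot R (rot S D)) ∧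
      (∀ R, IsLinearMap ℂ (rot R)) ∧
      (∀ R, IsRotation R → ∀ D ∈ variety, rot R D ∈ variety) ∧
      (∀ (R : ℂ → Matrix (Fin 3) (Fin 3) ℂ) (J : Matrix (Fin 3) (Fin 3) ℂ), R 0 = 1 →
        (∀ i j, HasDerivAt (fun t => R t i j) (J i j) 0) →
        ∀ D, HasDerivAt (fun t => rot (R t) D) (rotField J D) 0)) ∧
    -- the space of ten-tuples splits into irreducible blocks of dimensions three and seven
    (∃ WX WY : Submodule ℂ Ten, (WX : Set Ten) = blockX ∧ (WY : Set Ten) = blockY ∧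
      IsCompl WX WY ∧ Module.finrank ℂ WX = 3 ∧ Module.finrank ℂ WY = 7 ∧
      RotIrreducible WX ∧ RotIrreducible WY) ∧
    IsStandardBlock 1 X ∧ IsStandardBlock 3 Y ∧
    -- translations act by the derivative relations, on the variety by a local action of `ℂ³`
    (∀ v D, (∀ m, X (transField v D) m = transX v D m) ∧
      (∀ m, Y (transField v D) m = transY v D m)) ∧
    (∀ D ∈ variety, ∃ r > 0, ∃ Φ : C3 → Ten,
      IsTranslationFlow (Metric.ball 0 r) D Φ ∧ (∀ x ∈ Metric.ball 0 r, Φ x ∈ variety) ∧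
      ∀ Ψ : C3 → Ten, IsTranslationFlow (Metric.ball 0 r) D Ψ →
        Set.EqOn Φ Ψ (Metric.ball 0 r)) ∧
    (∀ v γ, IsTranslationCurve v γ → γ 0 ∈ variety →
      ∀ t ∈ Set.Icc (0 : ℝ) 1, γ t ∈ variety) ∧
    -- both fit together to an action of the Euclidean group and of its Lie algebra
    (∀ R, IsRotation R → ∀ v, ∀ D ∈ variety,
      rot R (transField v D) = transField (R.mulVec v) (rot R D)) ∧
    (∀ ξ η : Matrix (Fin 3) (Fin 3) ℂ × C3,
      ξ.1.transpose = -ξ.1 → η.1.transpose = -η.1 → ∀ D ∈ variety,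
      fderiv ℂ quadric D (euclField ξ D) = 0 ∧
      VectorField.lieBracket ℂ (euclField ξ) (euclField η) D = -euclField (euclBracket ξ η) D) ∧
    -- the points of the variety are the values of the nondegenerate superintegrable systems,
    -- and the value at one point determines the system
    (∀ S : System, ∀ x ∈ S.U, tenOf (S.K x) ∈ variety) ∧
    (∀ D ∈ variety, ∀ x : C3, ∃ S : System, x ∈ S.U ∧ tenOf (S.K x) = D) ∧
    (∀ S S' : System, ∀ x, x ∈ S.U → x ∈ S'.U → tenOf (S.K x) = tenOf (S'.K x) →
      S.K =ᶠ[nhds x] S'.K) ∧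
    -- two points determine the same system if and only if they lie on the same leaf
    (∀ D ∈ variety, ∀ D' ∈ variety, SameSystem D D' ↔ SameLeaf D D') := by
  refine ⟨⟨rot_one, fun R S hR hS D => rot_mul hR hS D, rot_isLinearMap,
      fun R hR D hD => rot_mem_variety hR hD, rot_hasDerivAt⟩,
    ⟨subX, subY, rfl, rfl, isCompl_subX_subY, finrank_subX, finrank_subY, rotIrreducible_subX,
      rotIrreducible_subY⟩,
    isStandardBlock_X, isStandardBlock_Y, fun v D => ⟨X_transField v D, Y_transField v D⟩,
    fun D hD => exists_translationFlow hD, fun v γ hγ h0 => transCurve_mem_variety hγ h0,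
    fun R hR v D hD => rot_transField hR v hD,
    fun ξ η hξ hη D hD => ⟨fderiv_quadric_of_isTangent (isTangent_euclField hD hξ),
      lieBracket_euclField hD hξ hη⟩,
    fun S x hx => S.ten_mem_variety hx, fun D hD x => exists_system hD x,
    fun S S' x hx hx' h => S.eventuallyEq_of_ten_eq S' hx hx' h,
    fun D hD D' _ => ⟨sameLeaf_of_sameSystem, sameSystem_of_sameLeaf hD⟩⟩
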